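/- Let $\mathbb K$ be a field of characteristic zero. **Conventions.** An $\mathbb S$-bimodule is a family $E=\{E(m,n)\}_{m,n\ge 0}$ of $\mathbb Z$-graded vector spaces with commuting left $\mathbb S_m$- and right $\mathbb S_n$-actions. A properad is an $\mathbb S$-bimodule $E$ with contraction maps $\mu_G\colon G\langle E\rangle\to E$ for all connected directed graphs $G$ built from at least one vertex, without directed cycles, and with labelled input and output legs; here $G\langle E\rangle$ is the space of decorations of the vertices of $G$ by elements of $E$ (an unordered tensor product with Koszul signs, coinvariants under automorphisms). The maps $\mu_G$ are equivariant, are the identity on corollas, and are associative with respect to contraction of subgraphs. The free properad generated by $E$ is $\mathcal F_c^\uparrow\langle E\rangle=\bigoplus_G G\langle E\rangle$. A dg properad has in addition an equivariant differential of degree $+1$ with $\delta\circ\mu_G=\mu_G\circ\delta_G$, where $\delta_G$ is the signed sum of the differentials of the decorations. For $m\ge 1$ let $P_{m-1}\subset\mathbb R^m$ be the permutahedron, the convex hull of the points $(\sigma(1),\dots,\sigma(m))$, $\sigma\in\mathbb S_m$. For an ordered partition $[m]=I_1\sqcup\dots\sqcup I_k$ into nonempty blocks, let $P_{m-1}^{I_1,\dots,I_k}$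 be the $(m-k)$-dimensional cell of $P_{m-1}$ spanned by the vertices whose values on $I_i$ are smaller than those on $I_j$ for all $i<j$. Let $C_\bullet(P_{m-1})$ be the complex of oriented cells of $P_{m-1}$ over $\mathbb K$, with $d$-dimensional cells in degree $-d$ and with the geometric boundary (outward normal first), on which $\mathbb S_m$ acts by permutations of the coordinates. **Proposition.** Let $W$ be the $\mathbb S$-bimodule with $W(m,n)=0$ for $n\ge 1$, and with $W(m,0)$ spanned, for all $k\ge1$, by the corollas $(I_1|\dots|I_k)$ with $m$ output legs gathered in $k$ bunches, indexed by the ordered partitions $[m]=I_1\sqcup\dots\sqcup I_k$ into nonempty blocks; the legs in each bunch are skewsymmetric, are labelled by $I_j$ increasingly from left to right, and the corolla has degree $k-m$. (In particular $W(0,0)=0$.) There is a dg properad $(\mathcal P_\bullet,\partial)$ whose underlying properad is the free properad $\mathcal F_c^\uparrow\langle W\rangle$ and whose differential is given on the generators by $$\partial\,(I_1|\dots|I_k)=\sum_{i=1}^k\ \sum_{I_i=I_i'\sqcup I_i'',\ I_i',I_i''\neq\emptyset}(-1)^{\varepsilon+\sigma(I_i',I_i'')}\,(I_1|\dots|I_{i-1}|I_i'|I_i''|I_{i+1}|\dots|I_k),$$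 where $\varepsilon=i+1+|I_1|+\dots+|I_{i-1}|+|I_i'|$ and $(-1)^{\sigma(I_i',I_i'')}$ is the sign of the permutation $I_i\to I_i'\sqcup I_i''$ of the increasingly ordered elements. It has the following properties. (i) The cell complex of the permutahedra is canonically isomorphic to $(\mathcal P_\bullet,\partial)$: for every $m\ge 1$ there is exactly one isomorphism $\mathcal P_\bullet(m,0)\cong C_\bullet(P_{m-1})$ of complexes of $\mathbb S_m$-modules which sends every generator $(I_1|\dots|I_k)$ to the cell $P_{m-1}^{I_1,\dots,I_k}$ with one of its two orientations, and the generator with a single block to $P_{m-1}$, oriented so that the outward normal $(1,\dots,1)$ of the half space $\sum_i x^i\le m(m+1)/2$ followed by the orientation of $P_{m-1}$ is the standard orientation of $\mathbb R^m$. Moreover $\mathcal P_\bullet(m,n)=0$ if $n\ge1$ or $m=0$, and $\mathcal P_\bullet$ vanishes in positive degrees. (ii) The cohomology of $(\mathcal P_\bullet,\partial)$ is concentrated in degree zero and, with the properad structure induced from $\mathcal P_\bullet$, is the free properad generated by one $(m,0)$-corolla of degree zero with symmetric legs for every $m\ge1$, namely the cohomology class of the sum of all vertices $\sum_{\sigma\in\mathbb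 S_m}(\sigma(1)|\sigma(2)|\dots|\sigma(m))$. -/

import Mathlib

open scoped BigOperators

namespace PermProp

universe u

/-! ## Graded `S`-bimodules -/

/-- An `S`-bimodule over `K`: graded vector spaces `E(m,n) = ⊕ᵢ E(m,n)ⁱ` with commuting actions,
of degree zero, of `S_m` from the left and of `S_n` from the right. -/
structure SBimodule (K : Type u) [Field K] where
  X : ℕ → ℕ → ℤ → Type u
  [grp : ∀ m n i, AddCommGroup (X m n i)]
  [mod : ∀ m n i, Module K (X m n i)]
  out : ∀ m n i, Representation K (Equiv.Perm (Fin m)) (X m n i)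
  inn : ∀ m n i, Representation K (Equiv.Perm (Fin n))ᵐᵒᵖ (X m n i)
  comm : ∀ m n i s t x, out m n i s (inn m n i t x) = inn m n i t (out m n i s x)

attribute [instance] SBimodule.grp SBimodule.mod

/-- Morphisms of `S`-bimodules (of degree zero). -/
structure Hom {K : Type u} [Field K] (E F : SBimodule K) where
  f : ∀ m n i, E.X m n i →ₗ[K] F.X m n i
  map_out : ∀ m n i s x, f m n i (E.out m n i s x) = F.out m n i s (f m n i x)
  map_inn : ∀ m n i t x, f m n i (E.inn m n i t x) = F.inn m n i t (f m n i x)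

/-! ## Connected directed graphs without directed cycles

A graph has vertices `v : V`, the vertex `v` having `p v` outgoing and `q v` incoming flags.  The
gluing sends every source of a flow line (an outgoing flag of a vertex, or an input leg of the
graph) to its target (an incoming flag of a vertex, or an output leg of the graph). -/

/-- The gluing data of a graph with `m` output legs and `n` input legs. -/
abbrev Wiring {V : Type} (p q : V → ℕ) (m n : ℕ) : Type :=
  ((Σ v, Fin (p v)) ⊕ Fin n) ≃ ((Σ v, Fin (q v)) ⊕ Fin m)

/-- There is an internal edge directed from `v` to `w`. -/
def Edge {V : Type} {p q : V → ℕ} {m n : ℕ} (e : Wiring p q m n) (v w : V) : Prop :=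
  ∃ i j, e (Sum.inl ⟨v, i⟩) = Sum.inl ⟨w, j⟩

/-- The graph is built from at least one corolla, is connected, has no closed directed paths, and
no input leg runs directly into an output leg. -/
structure IsProper {V : Type} {p q : V → ℕ} {m n : ℕ} (e : Wiring p q m n) : Prop where
  nonempty : Nonempty V
  connected : ∀ v w, Relation.EqvGen (Edge e) v w
  acyclic : ∀ v, ¬ Relation.TransGen (Edge e) v v
  legs : ∀ i j, e (Sum.inr i) ≠ Sum.inr j

theorem IsProper.congr {V : Type} {p q p' q' : V → ℕ} {m n m' n' : ℕ} {e : Wiring p q m n}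
    {e' : Wiring p' q' m' n'} (h : IsProper e) (hE : ∀ v w, Edge e' v w ↔ Edge e v w)
    (hl : ∀ i j, e' (Sum.inr i) ≠ Sum.inr j) : IsProper e' := by
  have : Edge e' = Edge e := by ext v w; exact hE v w
  refine ⟨h.nonempty, ?_, ?_, hl⟩
  · rw [this]; exact h.connected
  · rw [this]; exact h.acyclic

/-- A graph in the family of connected directed graphs without directed cycles, with `m` output
legs labelled by `Fin m` and `n` input legs labelled by `Fin n`, together with an ordering of its
vertices and of the flags at each vertex (these orderings are divided out below). -/
structure Graph (m n : ℕ) where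
  k : ℕ
  p : Fin k → ℕ
  q : Fin k → ℕ
  wire : Wiring p q m n
  proper : IsProper wire

/-- Renaming of vertices of a gluing. -/
def Wiring.reindex {V V' : Type} {p q : V → ℕ} {m n : ℕ} (e : Wiring p q m n) (f : V' ≃ V) :
    Wiring (fun v => p (f v)) (fun v => q (f v)) m n :=
  (Equiv.sumCongr (Equiv.sigmaCongrLeft (β := fun v => Fin (p v)) f) (Equiv.refl _)).trans
    (e.trans (Equiv.sumCongr (Equiv.sigmaCongrLeft (β := fun v => Fin (q v)) f)
      (Equiv.refl _)).symm)

theorem edge_reindex {V V' : Type} {p q : V → ℕ} {m n : ℕ} (e : Wiring p q m n) (f : V' ≃ V)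
    (v w : V') : Edge (e.reindex f) v w ↔ Edge e (f v) (f w) := by
  constructor
  · rintro ⟨i, j, h⟩
    refine ⟨i, j, ?_⟩
    simp only [Wiring.reindex, Equiv.trans_apply, Equiv.symm_apply_eq] at h
    exact h
  · rintro ⟨i, j, h⟩
    refine ⟨i, j, ?_⟩
    simp only [Wiring.reindex, Equiv.trans_apply, Equiv.symm_apply_eq]
    exact h

theorem IsProper.reindex {V V' : Type} {p q : V → ℕ} {m n : ℕ} {e : Wiring p q m n}
    (h : IsProper e) (f : V' ≃ V) : IsProper (e.reindex f) := by
  refine ⟨h.nonempty.map f.symm, ?_, ?_, ?_⟩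
  · have key : ∀ v w, Relation.EqvGen (Edge e) v w →
        Relation.EqvGen (Edge (e.reindex f)) (f.symm v) (f.symm w) := by
      intro v w hvw
      induction hvw with
      | rel x y hxy => exact .rel _ _ (by rw [edge_reindex]; simpa using hxy)
      | refl x => exact .refl _
      | symm x y _ ih => exact .symm _ _ ih
      | trans x y z _ _ ih1 ih2 => exact .trans _ _ _ ih1 ih2
    intro v w
    simpa using key (f v) (f w) (h.connected _ _)
  · intro v hv
    exact h.acyclic (f v) (Relation.TransGen.lift f
      (fun a b hab => (edge_reindex e f a b).1 hab) v v hv)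
  · intro i j hij
    simp only [Wiring.reindex, Equiv.trans_apply, Equiv.symm_apply_eq] at hij
    exact h.legs i j hij

/-- The `(m,n)`-corolla: the graph with a single vertex. -/
def corollaWire (m n : ℕ) : Wiring (fun _ : Fin 1 => m) (fun _ : Fin 1 => n) m n :=
  (Equiv.sumCongr (Equiv.uniqueSigma (fun _ : Fin 1 => Fin m)) (Equiv.refl _)).trans
    ((Equiv.sumComm _ _).trans
      (Equiv.sumCongr (Equiv.uniqueSigma (fun _ : Fin 1 => Fin n)).symm (Equiv.refl _)))

theorem not_edge_corollaWire (m n : ℕ) (v w : Fin 1) : ¬ Edge (corollaWire m n) v w := by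
  rintro ⟨i, j, h⟩
  simp [corollaWire] at h

/-- The `(m,n)`-corolla. -/
def Graph.corolla (m n : ℕ) : Graph m n where
  k := 1
  p := fun _ => m
  q := fun _ => n
  wire := corollaWire m n
  proper := by
    refine ⟨⟨0⟩, ?_, ?_, ?_⟩
    · intro v w
      rw [Subsingleton.elim v w]
      exact .refl _
    · intro v hv
      obtain ⟨w, hw, -⟩ := Relation.TransGen.head'_iff.1 hv
      exact not_edge_corollaWire m n _ _ hw
    · intro i j h
      simp [corollaWire] at h

/-- Reordering the vertices of a graph. -/
def Graph.permute {m n : ℕ} (G : Graph m n) (π : Equiv.Perm (Fin G.k)) : Graph m n where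
  k := G.k
  p := fun v => G.p (π v)
  q := fun v => G.q (π v)
  wire := G.wire.reindex π
  proper := G.proper.reindex π

/-- Reordering the flags at the vertices of a graph. -/
def Graph.relabel {m n : ℕ} (G : Graph m n) (s : ∀ v, Equiv.Perm (Fin (G.p v)))
    (t : ∀ v, Equiv.Perm (Fin (G.q v))) : Graph m n where
  k := G.k
  p := G.p
  q := G.q
  wire := (Equiv.sumCongr (Equiv.sigmaCongrRight s) (Equiv.refl _)).trans
    (G.wire.trans (Equiv.sumCongr (Equiv.sigmaCongrRight t) (Equiv.refl _)))
  proper := by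
    refine G.proper.congr ?_ ?_
    · intro v w
      constructor
      · rintro ⟨i, j, h⟩
        refine ⟨s v i, (t w).symm j, ?_⟩
        simp only [Equiv.trans_apply] at h
        rw [← Equiv.eq_symm_apply] at h
        exact h
      · rintro ⟨i, j, h⟩
        refine ⟨(s v).symm i, t w j, ?_⟩
        simp [h]
    · intro i j h
      simp only [Equiv.trans_apply] at h
      rw [← Equiv.eq_symm_apply] at h
      exact G.proper.legs i j h

/-- Permuting the labels of the legs of a graph. -/
def Graph.legs {m n : ℕ} (G : Graph m n) (s : Equiv.Perm (Fin m)) (t : Equiv.Perm (Fin n)) :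
    Graph m n where
  k := G.k
  p := G.p
  q := G.q
  wire := (Equiv.sumCongr (Equiv.refl _) t).trans
    (G.wire.trans (Equiv.sumCongr (Equiv.refl _) s))
  proper := by
    refine G.proper.congr ?_ ?_
    · intro v w
      constructor
      · rintro ⟨i, j, h⟩
        refine ⟨i, j, ?_⟩
        simp only [Equiv.trans_apply] at h
        rw [← Equiv.eq_symm_apply] at h
        exact h
      · rintro ⟨i, j, h⟩
        refine ⟨i, j, ?_⟩
        simp [h]
    · intro i j h
      simp only [Equiv.trans_apply] at h
      rw [← Equiv.eq_symm_apply] at h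
      exact G.proper.legs (t i) (s.symm j) h

/-! ### Substitution of graphs into the vertices of a graph -/

section Compose

variable {A B I O N M : Type}

/-- One half of the composite of two gluings: follow a flow line leaving a vertex of the inner
graphs, or entering at an input leg. -/
def composeFun (α : A ⊕ I ≃ B ⊕ O) (γ : O ⊕ N ≃ I ⊕ M)
    (hα : ∀ i, (α (Sum.inr i)).isLeft) : A ⊕ N → B ⊕ M :=
  let enter : I ⊕ M → B ⊕ M :=
    Sum.elim (fun i => Sum.inl ((α (Sum.inr i)).getLeft (hα i))) Sum.inr
  Sum.elim
    (fun a => Sum.elim Sum.inl (fun o => enter (γ (Sum.inl o))) (α (Sum.inl a)))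
    (fun n => enter (γ (Sum.inr n)))

theorem isLeft_symm (α : A ⊕ I ≃ B ⊕ O) (hα : ∀ i, (α (Sum.inr i)).isLeft) (o : O) :
    (α.symm (Sum.inr o)).isLeft := by
  rcases h : α.symm (Sum.inr o) with a | i
  · rfl
  · have := hα i
    rw [← h] at this
    simp at this

/-- The inverse of `composeFun`: follow the flow lines backwards. -/
def composeInv (α : A ⊕ I ≃ B ⊕ O) (γ : O ⊕ N ≃ I ⊕ M)
    (hα : ∀ i, (α (Sum.inr i)).isLeft) : B ⊕ M → A ⊕ N :=
  let back : O ⊕ N → A ⊕ N :=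
    Sum.elim (fun o => Sum.inl ((α.symm (Sum.inr o)).getLeft (isLeft_symm α hα o))) Sum.inr
  Sum.elim
    (fun b => Sum.elim Sum.inl (fun i => back (γ.symm (Sum.inl i))) (α.symm (Sum.inl b)))
    (fun m => back (γ.symm (Sum.inr m)))

theorem compose_left_inv (α : A ⊕ I ≃ B ⊕ O) (γ : O ⊕ N ≃ I ⊕ M)
    (hα : ∀ i, (α (Sum.inr i)).isLeft) (x : A ⊕ N) :
    composeInv α γ hα (composeFun α γ hα x) = x := by
  have enter : ∀ (y : O ⊕ N) (z : I ⊕ M), γ y = z →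
      composeInv α γ hα (Sum.elim (fun i => Sum.inl ((α (Sum.inr i)).getLeft (hα i))) Sum.inr z)
        = Sum.elim (fun o => Sum.inl ((α.symm (Sum.inr o)).getLeft (isLeft_symm α hα o)))
            Sum.inr y := by
    intro y z hz
    have hy : y = γ.symm z := by rw [← hz]; simp
    subst hy
    rcases z with i | m
    · simp [composeInv]
    · simp [composeInv]
  rcases x with a | n
  · rcases h : α (Sum.inl a) with b | o
    · have : α.symm (Sum.inl b) = Sum.inl a := by rw [← h]; simp
      simp [composeFun, composeInv, h, this]
    · have h2 : α.symm (Sum.inr o) = Sum.inl a := by rw [← h]; simp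
      have := enter (Sum.inl o) _ rfl
      simp only [composeFun, Sum.elim_inl, h, Sum.elim_inr]
      rw [this]
      simp [h2]
  · have := enter (Sum.inr n) _ rfl
    simp only [composeFun, Sum.elim_inr]
    rw [this]
    simp

theorem compose_right_inv (α : A ⊕ I ≃ B ⊕ O) (γ : O ⊕ N ≃ I ⊕ M)
    (hα : ∀ i, (α (Sum.inr i)).isLeft) (x : B ⊕ M) :
    composeFun α γ hα (composeInv α γ hα x) = x := by
  have back : ∀ (z : I ⊕ M) (y : O ⊕ N), γ.symm z = y →
      composeFun α γ hα (Sum.elim (fun o => Sum.inl ((α.symm (Sum.inr o)).getLeft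
        (isLeft_symm α hα o))) Sum.inr y)
        = Sum.elim (fun i => Sum.inl ((α (Sum.inr i)).getLeft (hα i))) Sum.inr z := by
    intro z y hy
    have hz : z = γ y := by rw [← hy]; simp
    subst hz
    rcases y with o | n
    · simp [composeFun]
    · simp [composeFun]
  rcases x with b | m
  · rcases h : α.symm (Sum.inl b) with a | i
    · have : α (Sum.inl a) = Sum.inl b := by rw [← h]; simp
      simp [composeFun, composeInv, h, this]
    · have h2 : α (Sum.inr i) = Sum.inl b := by rw [← h]; simp
      have := back (Sum.inl i) _ rfl
      simp only [composeInv, Sum.elim_inl, h, Sum.elim_inr]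
      rw [this]
      simp [h2]
  · have := back (Sum.inr m) _ rfl
    simp only [composeInv, Sum.elim_inr]
    rw [this]
    simp

/-- Gluing the legs of the inner graphs (`α`, with legs `I`, `O`) along the outer one (`γ`). -/
def compose (α : A ⊕ I ≃ B ⊕ O) (γ : O ⊕ N ≃ I ⊕ M)
    (hα : ∀ i, (α (Sum.inr i)).isLeft) : A ⊕ N ≃ B ⊕ M where
  toFun := composeFun α γ hα
  invFun := composeInv α γ hα
  left_inv := compose_left_inv α γ hα
  right_inv := compose_right_inv α γ hα

end Compose

section Subst

variable {m n : ℕ} (G : Graph m n) (H : ∀ v, Graph (G.p v) (G.q v))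

/-- The disjoint union of the graphs inserted into the vertices of `G`. -/
def innerWire :
    (Σ x : (Σ v, Fin (H v).k), Fin ((H x.1).p x.2)) ⊕ (Σ v, Fin (G.q v)) ≃
      (Σ x : (Σ v, Fin (H v).k), Fin ((H x.1).q x.2)) ⊕ (Σ v, Fin (G.p v)) :=
  (Equiv.sumCongr (Equiv.sigmaAssoc (fun v w => Fin ((H v).p w))) (Equiv.refl _)).trans <|
  (Equiv.sigmaSumDistrib _ _).symm.trans <|
  (Equiv.sigmaCongrRight (fun v => (H v).wire)).trans <|
  (Equiv.sigmaSumDistrib _ _).trans <|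
  Equiv.sumCongr (Equiv.sigmaAssoc (fun v w => Fin ((H v).q w))).symm (Equiv.refl _)

theorem innerWire_inl_inl {v : Fin G.k} {w w' : Fin (H v).k} {i j}
    (h : (H v).wire (Sum.inl ⟨w, i⟩) = Sum.inl ⟨w', j⟩) :
    innerWire G H (Sum.inl ⟨⟨v, w⟩, i⟩) = Sum.inl ⟨⟨v, w'⟩, j⟩ := by
  simp only [innerWire, Equiv.sigmaAssoc, Equiv.sigmaSumDistrib, Equiv.trans_apply]
  simp [Sigma.map, h]

theorem innerWire_inl_inr {v : Fin G.k} {w : Fin (H v).k} {i j}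
    (h : (H v).wire (Sum.inl ⟨w, i⟩) = Sum.inr j) :
    innerWire G H (Sum.inl ⟨⟨v, w⟩, i⟩) = Sum.inr ⟨v, j⟩ := by
  simp only [innerWire, Equiv.sigmaAssoc, Equiv.sigmaSumDistrib, Equiv.trans_apply]
  simp [Sigma.map, h]

theorem innerWire_inr_inl {v : Fin G.k} {w' : Fin (H v).k} {i j}
    (h : (H v).wire (Sum.inr i) = Sum.inl ⟨w', j⟩) :
    innerWire G H (Sum.inr ⟨v, i⟩) = Sum.inl ⟨⟨v, w'⟩, j⟩ := by
  simp only [innerWire, Equiv.sigmaAssoc, Equiv.sigmaSumDistrib, Equiv.trans_apply]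
  simp [Sigma.map, h]

theorem innerWire_isLeft (x : Σ v, Fin (G.q v)) : (innerWire G H (Sum.inr x)).isLeft := by
  obtain ⟨v, i⟩ := x
  rcases h : (H v).wire (Sum.inr i) with ⟨w, j⟩ | j
  · rw [innerWire_inr_inl G H h]; rfl
  · exact absurd h ((H v).proper.legs i j)

/-- The gluing of the graph obtained by inserting the graphs `H v` into the vertices of `G`. -/
def substWire : Wiring (V := Σ v, Fin (H v).k) (fun x => (H x.1).p x.2)
    (fun x => (H x.1).q x.2) m n :=
  compose (innerWire G H) G.wire (innerWire_isLeft G H)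

theorem edge_substWire {x y : Σ v, Fin (H v).k} (h : Edge (substWire G H) x y) :
    (∃ e : x.1 = y.1, Edge (H y.1).wire (e ▸ x.2) y.2) ∨ Edge G.wire x.1 y.1 := by
  obtain ⟨v, w⟩ := x
  obtain ⟨v', w'⟩ := y
  obtain ⟨i, j, hij⟩ := h
  rcases h1 : (H v).wire (Sum.inl ⟨w, i⟩) with ⟨w1, j1⟩ | j1
  · left
    have : substWire G H (Sum.inl ⟨⟨v, w⟩, i⟩) = Sum.inl ⟨⟨v, w1⟩, j1⟩ := by
      simp [substWire, compose, composeFun, innerWire_inl_inl G H h1]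
    rw [this] at hij
    simp only [Sum.inl.injEq, Sigma.mk.injEq] at hij
    obtain ⟨⟨rfl, h3⟩, h2⟩ := hij
    obtain rfl := eq_of_heq h3
    exact ⟨rfl, i, j1, h1⟩
  · right
    rcases h2 : G.wire (Sum.inl ⟨v, j1⟩) with ⟨v2, j2⟩ | j2
    · rcases h3 : (H v2).wire (Sum.inr j2) with ⟨w3, j3⟩ | j3
      · have : substWire G H (Sum.inl ⟨⟨v, w⟩, i⟩) = Sum.inl ⟨⟨v2, w3⟩, j3⟩ := by
          simp [substWire, compose, composeFun, innerWire_inl_inr G H h1, h2,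
            innerWire_inr_inl G H h3]
        rw [this] at hij
        simp only [Sum.inl.injEq, Sigma.mk.injEq] at hij
        obtain ⟨⟨rfl, -⟩, -⟩ := hij
        exact ⟨j1, j2, h2⟩
      · exact absurd h3 ((H v2).proper.legs j2 j3)
    · have : substWire G H (Sum.inl ⟨⟨v, w⟩, i⟩) = Sum.inr j2 := by
        simp [substWire, compose, composeFun, innerWire_inl_inr G H h1, h2]
      rw [this] at hij
      simp at hij

theorem edge_substWire_inner {v : Fin G.k} {w w' : Fin (H v).k} (h : Edge (H v).wire w w') :
    Edge (substWire G H) ⟨v, w⟩ ⟨v, w'⟩ := by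
  obtain ⟨i, j, h1⟩ := h
  exact ⟨i, j, by simp [substWire, compose, composeFun, innerWire_inl_inl G H h1]⟩

theorem edge_substWire_outer {v v' : Fin G.k} (h : Edge G.wire v v') :
    ∃ w w', Edge (substWire G H) ⟨v, w⟩ ⟨v', w'⟩ := by
  obtain ⟨j1, j2, h2⟩ := h
  rcases h3 : (H v').wire (Sum.inr j2) with ⟨w3, j3⟩ | j3
  · rcases h1 : (H v).wire.symm (Sum.inr j1) with ⟨w, i⟩ | i
    · have h1' : (H v).wire (Sum.inl ⟨w, i⟩) = Sum.inr j1 := by rw [← h1]; simp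
      exact ⟨w, w3, i, j3, by
        simp [substWire, compose, composeFun, innerWire_inl_inr G H h1', h2,
          innerWire_inr_inl G H h3]⟩
    · have h1' : (H v).wire (Sum.inr i) = Sum.inr j1 := by rw [← h1]; simp
      exact absurd h1' ((H v).proper.legs i j1)
  · exact absurd h3 ((H v').proper.legs j2 j3)

theorem transGen_substWire {x y : Σ v, Fin (H v).k}
    (h : Relation.TransGen (Edge (substWire G H)) x y) :
    (∃ e : x.1 = y.1, Relation.TransGen (Edge (H y.1).wire) (e ▸ x.2) y.2) ∨
      Relation.TransGen (Edge G.wire) x.1 y.1 := by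
  induction h with
  | single h =>
    rcases edge_substWire G H h with ⟨e, h⟩ | h
    · exact .inl ⟨e, .single h⟩
    · exact .inr (.single h)
  | @tail y z _ hyz ih =>
    obtain ⟨x1, x2⟩ := x
    obtain ⟨y1, y2⟩ := y
    obtain ⟨z1, z2⟩ := z
    rcases edge_substWire G H hyz with ⟨e', h'⟩ | h' <;> rcases ih with ⟨e, h⟩ | h
    · left
      dsimp only at e e' h h'
      subst e'
      subst e
      exact ⟨rfl, h.tail h'⟩
    · right
      dsimp only at e'
      subst e'
      exact h
    · right
      dsimp only at e
      subst e
      exact .single h'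
    · exact .inr (h.tail h')

theorem substWire_proper : IsProper (substWire G H) := by
  have inner : ∀ (v : Fin G.k) (w w' : Fin (H v).k),
      Relation.EqvGen (Edge (substWire G H)) ⟨v, w⟩ ⟨v, w'⟩ := by
    intro v w w'
    induction (H v).proper.connected w w' with
    | rel x y h => exact .rel _ _ (edge_substWire_inner G H h)
    | refl x => exact .refl _
    | symm x y _ ih => exact .symm _ _ ih
    | trans x y z _ _ ih1 ih2 => exact .trans _ _ _ ih1 ih2
  refine ⟨?_, ?_, ?_, ?_⟩
  · obtain ⟨v⟩ := G.proper.nonempty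
    obtain ⟨w⟩ := (H v).proper.nonempty
    exact ⟨⟨v, w⟩⟩
  · rintro ⟨v, w⟩ ⟨v', w'⟩
    have key : ∀ a b, Relation.EqvGen (Edge G.wire) a b → ∀ (c : Fin (H a).k) (d : Fin (H b).k),
        Relation.EqvGen (Edge (substWire G H)) ⟨a, c⟩ ⟨b, d⟩ := by
      intro a b hab
      induction hab with
      | rel x y h =>
        intro c d
        obtain ⟨c', d', h'⟩ := edge_substWire_outer G H h
        exact .trans _ _ _ (inner x c c') (.trans _ _ _ (.rel _ _ h') (inner y d' d))
      | refl x => exact inner x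
      | symm x y _ ih => intro c d; exact .symm _ _ (ih d c)
      | trans x y z _ _ ih1 ih2 =>
        intro c d
        obtain ⟨e⟩ := (H y).proper.nonempty
        exact .trans _ _ _ (ih1 c e) (ih2 e d)
    exact key v v' (G.proper.connected v v') w w'
  · rintro ⟨v, w⟩ h
    rcases transGen_substWire G H h with ⟨_, h⟩ | h
    · exact (H v).proper.acyclic w h
    · exact G.proper.acyclic v h
  · intro i j h
    rcases h2 : G.wire (Sum.inr i) with ⟨v2, j2⟩ | j2
    · simp [substWire, compose, composeFun, h2] at h
    · exact G.proper.legs i j2 h2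

/-- The graph obtained by inserting the graph `H v` into the vertex `v` of `G`, for every `v`.
Its vertices are ordered lexicographically. -/
def Graph.subst : Graph m n where
  k := ∑ v, (H v).k
  p := fun u => (H (finSigmaFinEquiv.symm u).1).p (finSigmaFinEquiv.symm u).2
  q := fun u => (H (finSigmaFinEquiv.symm u).1).q (finSigmaFinEquiv.symm u).2
  wire := (substWire G H).reindex finSigmaFinEquiv.symm
  proper := (substWire_proper G H).reindex _

end Subst

/-! ## Decorated graphs and the free properad -/

variable {K : Type u} [Field K]

/-- A graph whose vertices are decorated by homogeneous elements of `E`, of total degree `i`. -/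
structure DecGraph (E : SBimodule K) (m n : ℕ) (i : ℤ) where
  G : Graph m n
  deg : Fin G.k → ℤ
  deg_sum : ∑ v, deg v = i
  dec : ∀ v, E.X (G.p v) (G.q v) (deg v)

namespace DecGraph

variable {E : SBimodule K} {m n : ℕ} {i : ℤ}

/-- Replace the decoration of the vertex `v`. -/
def set (D : DecGraph E m n i) (v : Fin D.G.k) (x : E.X (D.G.p v) (D.G.q v) (D.deg v)) :
    DecGraph E m n i :=
  { D with dec := Function.update D.dec v x }

/-- Reorder the flags of the graph, keeping the decorations. -/
def relabel (D : DecGraph E m n i) (s : ∀ v, Equiv.Perm (Fin (D.G.p v)))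
    (t : ∀ v, Equiv.Perm (Fin (D.G.q v))) : DecGraph E m n i where
  G := D.G.relabel s t
  deg := D.deg
  deg_sum := D.deg_sum
  dec := D.dec

/-- Act by permutations on the decorations, keeping the graph. -/
def act (D : DecGraph E m n i) (s : ∀ v, Equiv.Perm (Fin (D.G.p v)))
    (t : ∀ v, Equiv.Perm (Fin (D.G.q v))) : DecGraph E m n i :=
  { D with dec := fun v => E.out _ _ _ (s v) (E.inn _ _ _ (MulOpposite.op (t v)) (D.dec v)) }

/-- Reorder the vertices of the graph, together with their decorations. -/
def permute (D : DecGraph E m n i) (π : Equiv.Perm (Fin D.G.k)) : DecGraph E m n i where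
  G := D.G.permute π
  deg := fun v => D.deg (π v)
  deg_sum := by
    exact (Equiv.sum_comp π D.deg).trans D.deg_sum
  dec := fun v => D.dec (π v)

/-- The Koszul sign of a reordering of homogeneous factors of degrees `deg`. -/
def koszul {k : ℕ} (deg : Fin k → ℤ) (π : Equiv.Perm (Fin k)) : ℤˣ :=
  ∏ x : Fin k × Fin k,
    if x.1 < x.2 ∧ π x.2 < π x.1 then Int.negOnePow (deg (π x.1) * deg (π x.2)) else 1

/-- Permute the labels of the legs. -/
def legs (D : DecGraph E m n i) (s : Equiv.Perm (Fin m)) (t : Equiv.Perm (Fin n)) :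
    DecGraph E m n i where
  G := D.G.legs s t
  deg := D.deg
  deg_sum := D.deg_sum
  dec := D.dec

/-- The corolla decorated by `x`. -/
def corolla (x : E.X m n i) : DecGraph E m n i where
  G := Graph.corolla m n
  deg := fun _ => i
  deg_sum := Fin.sum_univ_one _
  dec := fun _ => x

/-- Insert decorated graphs into the vertices of a graph. -/
def subst (G : Graph m n) (deg : Fin G.k → ℤ) (deg_sum : ∑ v, deg v = i)
    (D : ∀ v, DecGraph E (G.p v) (G.q v) (deg v)) : DecGraph E m n i where
  G := G.subst (fun v => (D v).G)
  deg := fun u => (D (finSigmaFinEquiv.symm u).1).deg (finSigmaFinEquiv.symm u).2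
  deg_sum := by
    rw [← deg_sum]
    refine (Equiv.sum_comp (finSigmaFinEquiv (n := fun v => (D v).G.k)).symm
      (fun x => (D x.1).deg x.2)).trans ?_
    rw [Fintype.sum_sigma]
    exact Finset.sum_congr rfl (fun v _ => (D v).deg_sum)
  dec := fun u => (D (finSigmaFinEquiv.symm u).1).dec (finSigmaFinEquiv.symm u).2

/-- Apply a morphism of `S`-bimodules to all decorations. -/
def map {F : SBimodule K} (f : Hom E F) (D : DecGraph E m n i) : DecGraph F m n i where
  G := D.G
  deg := D.deg
  deg_sum := D.deg_sum
  dec := fun v => f.f _ _ _ (D.dec v)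

end DecGraph

/-- The relations between decorated graphs: linearity in every decoration, compatibility with
reordering the flags at the vertices, and with reordering the vertices (with the Koszul sign). -/
inductive DecRel (E : SBimodule K) (m n : ℕ) (i : ℤ) : (DecGraph E m n i →₀ K) → Prop
  | add (D : DecGraph E m n i) (v) (x y) : DecRel E m n i
      (Finsupp.single (D.set v (x + y)) 1 - Finsupp.single (D.set v x) 1
        - Finsupp.single (D.set v y) 1)
  | smul (D : DecGraph E m n i) (v) (c : K) (x) : DecRel E m n i
      (Finsupp.single (D.set v (c • x)) 1 - c • Finsupp.single (D.set v x) 1)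
  | flags (D : DecGraph E m n i) (s t) : DecRel E m n i
      (Finsupp.single (D.relabel s t) 1 - Finsupp.single (D.act s t) 1)
  | vertices (D : DecGraph E m n i) (π) : DecRel E m n i
      (Finsupp.single (D.permute π) 1
        - (((DecGraph.koszul D.deg π : ℤˣ) : ℤ) : K) • Finsupp.single D 1)

/-- The underlying graded vector space `⊕_G G⟨E⟩` of the free properad generated by `E`, the sum
being over isomorphism classes of connected graphs without directed cycles: linear combinations of
decorated graphs modulo the relations above. -/
noncomputable abbrev FreeMod (E : SBimodule K) (m n : ℕ) (i : ℤ) : Type u :=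
  (DecGraph E m n i →₀ K) ⧸ Submodule.span K {r | DecRel E m n i r}

/-- The class of a decorated graph. -/
noncomputable def cls {E : SBimodule K} {m n : ℕ} {i : ℤ} (D : DecGraph E m n i) : FreeMod E m n i :=
  Submodule.Quotient.mk (Finsupp.single D 1)

/-- Functoriality of `⊕_G G⟨E⟩` in `E`. -/
noncomputable def FreeMod.map {E F : SBimodule K} (f : Hom E F) (m n : ℕ) (i : ℤ) :
    FreeMod E m n i →ₗ[K] FreeMod F m n i :=
  Submodule.mapQ _ _ (Finsupp.lmapDomain K K (DecGraph.map f)) (by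
    rw [Submodule.span_le]
    have hset : ∀ (D : DecGraph E m n i) v x,
        (D.set v x).map f = (D.map f).set v (f.f _ _ _ x) := by
      intro D v x
      simp only [DecGraph.map, DecGraph.set]
      congr 1
      funext w
      exact Function.apply_update (fun u y => f.f (D.G.p u) (D.G.q u) (D.deg u) y) D.dec v x w
    rintro r hr
    refine Submodule.subset_span ?_
    rcases hr with ⟨D, v, x, y⟩ | ⟨D, v, c, x⟩ | ⟨D, s, t⟩ | ⟨D, π⟩
    · have := DecRel.add (D.map f) v (f.f _ _ _ x) (f.f _ _ _ y)
      have e := (hset D v (x + y)).trans (congrArg ((D.map f).set v) (map_add (f.f _ _ _) x y))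
      simp only [Set.mem_ofPred_eq, map_sub, Finsupp.lmapDomain_apply, Finsupp.mapDomain_single,
        e, hset]
      exact this
    · have := DecRel.smul (D.map f) v c (f.f _ _ _ x)
      have e := (hset D v (c • x)).trans (congrArg ((D.map f).set v) (map_smul (f.f _ _ _) c x))
      simp only [Set.mem_ofPred_eq, map_sub, map_smul, Finsupp.lmapDomain_apply,
        Finsupp.mapDomain_single, e, hset]
      exact this
    · have := DecRel.flags (D.map f) s t
      have h1 : (D.relabel s t).map f = (D.map f).relabel s t := rfl
      have h2 : (D.act s t).map f = (D.map f).act s t := by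
        simp only [DecGraph.map, DecGraph.act]
        congr 1
        funext w
        exact (f.map_out _ _ _ _ _).trans (congrArg _ (f.map_inn _ _ _ _ _))
      simpa [h1, h2, Finsupp.mapDomain_single, map_sub] using this
    · have := DecRel.vertices (D.map f) π
      have h1 : (D.permute π).map f = (D.map f).permute π := rfl
      simp only [Set.mem_ofPred_eq, map_sub, map_smul, Finsupp.lmapDomain_apply,
        Finsupp.mapDomain_single, h1]
      exact this)

/-! ## Properads -/

/-- A properad structure on an `S`-bimodule: contraction maps `μ_G : G⟨E⟩ → E` for all connected
graphs without directed cycles, the corollas acting identically, equivariant under relabelling of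
the legs, and associative: contracting inserted graphs first and the outer graph afterwards is the
same as contracting the whole graph at once. -/
structure ProperadStr (E : SBimodule K) where
  μ : ∀ m n i, FreeMod E m n i →ₗ[K] E.X m n i
  corolla : ∀ {m n i} (x : E.X m n i), μ m n i (cls (DecGraph.corolla x)) = x
  legs : ∀ {m n i} (D : DecGraph E m n i) (s t), μ m n i (cls (D.legs s t)) =
    E.out m n i s (E.inn m n i (MulOpposite.op t) (μ m n i (cls D)))
  assoc : ∀ {m n i} (G : Graph m n) (deg : Fin G.k → ℤ) (h : ∑ v, deg v = i)
    (D : ∀ v, DecGraph E (G.p v) (G.q v) (deg v)),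
    μ m n i (cls ⟨G, deg, h, fun v => μ _ _ _ (cls (D v))⟩) = μ m n i (cls (DecGraph.subst G deg h D))

/-- The properad `P` is free on the `S`-bimodule `E`, with generators embedded by `ι`: the
canonical map from the space `⊕_G G⟨E⟩` of graphs decorated by generators, given by contraction
in `P`, is an isomorphism. -/
def ProperadStr.IsFree {E P : SBimodule K} (S : ProperadStr P) (ι : Hom E P) : Prop :=
  ∀ m n i, Function.Bijective (fun x => S.μ m n i (FreeMod.map ι m n i x))

/-! ## Differentials and cohomology -/

/-- An equivariant differential of degree `+1` on an `S`-bimodule. -/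
structure Differential (E : SBimodule K) where
  d : ∀ m n i j, i + 1 = j → (E.X m n i →ₗ[K] E.X m n j)
  d_d : ∀ m n i j l (h : i + 1 = j) (h' : j + 1 = l) x, d m n j l h' (d m n i j h x) = 0
  d_out : ∀ m n i j h s x, d m n i j h (E.out m n i s x) = E.out m n j s (d m n i j h x)
  d_inn : ∀ m n i j h t x, d m n i j h (E.inn m n i t x) = E.inn m n j t (d m n i j h x)

/-- Apply the differential to the decoration of the vertex `v`, without sign. -/
def DecGraph.diffAt {E : SBimodule K} (d : Differential E) {m n : ℕ} {i j : ℤ} (hij : i + 1 = j)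
    (D : DecGraph E m n i) (v : Fin D.G.k) : DecGraph E m n j where
  G := D.G
  deg := fun w => if w = v then D.deg w + 1 else D.deg w
  deg_sum := by
    have : ∀ w, (if w = v then D.deg w + 1 else D.deg w) = D.deg w + if w = v then 1 else 0 := by
      intro w; split_ifs <;> simp
    simp [this, Finset.sum_add_distrib, D.deg_sum, hij]
  dec := fun w =>
    if h : w = v then d.d _ _ (D.deg w) _ (by simp [h]) (D.dec w)
    else cast (by simp [h]) (D.dec w)

/-- A differential graded properad: a properad with a differential satisfying
`δ ∘ μ_G = μ_G ∘ δ_G`, with `δ_G` the signed sum of the differentials of the decorations. -/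
structure DGProperad (K : Type u) [Field K] where
  mod : SBimodule K
  str : ProperadStr mod
  diff : Differential mod
  leibniz : ∀ {m n i j} (h : i + 1 = j) (D : DecGraph mod m n i),
    diff.d m n i j h (str.μ m n i (cls D)) =
      ∑ v, (((Int.negOnePow (∑ w ∈ Finset.univ.filter (· < v), D.deg w) : ℤˣ) : ℤ) : K) •
        str.μ m n j (cls (D.diffAt diff h v))

section Cohomology

variable {E : SBimodule K} (d : Differential E)

/-- Cocycles. -/
def cocycles (m n : ℕ) (i : ℤ) : Submodule K (E.X m n i) := LinearMap.ker (d.d m n i (i + 1) rfl)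

/-- Coboundaries. -/
def coboundaries (m n : ℕ) (i : ℤ) : Submodule K (E.X m n i) :=
  LinearMap.range (d.d m n (i - 1) i (by ring))

/-- Cohomology in degree `i`: cocycles modulo coboundaries. -/
abbrev CohomMod (m n : ℕ) (i : ℤ) : Type u :=
  (cocycles d m n i) ⧸ (coboundaries d m n i).submoduleOf (cocycles d m n i)

/-- The cohomology class of a cocycle. -/
def cohomClass {m n : ℕ} {i : ℤ} (x : E.X m n i) (hx : x ∈ cocycles d m n i) : CohomMod d m n i :=
  Submodule.Quotient.mk ⟨x, hx⟩

/-- The endomorphism of cohomology induced by an endomorphism which preserves cocycles and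
coboundaries. -/
def cohomEnd {m n : ℕ} {i : ℤ} (f : E.X m n i →ₗ[K] E.X m n i)
    (hf : ∀ x ∈ cocycles d m n i, f x ∈ cocycles d m n i)
    (hf' : ∀ x ∈ coboundaries d m n i, f x ∈ coboundaries d m n i) :
    CohomMod d m n i →ₗ[K] CohomMod d m n i :=
  Submodule.mapQ _ _ (f.restrict hf) (by
    rintro ⟨x, hx⟩ h
    exact hf' x h)

theorem out_cocycles {m n : ℕ} {i : ℤ} (s) (x) (hx : x ∈ cocycles d m n i) :
    E.out m n i s x ∈ cocycles d m n i := by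
  simp only [cocycles, LinearMap.mem_ker] at hx ⊢
  rw [d.d_out, hx, map_zero]

theorem out_coboundaries {m n : ℕ} {i : ℤ} (s) (x) (hx : x ∈ coboundaries d m n i) :
    E.out m n i s x ∈ coboundaries d m n i := by
  obtain ⟨y, rfl⟩ := hx
  exact ⟨E.out _ _ _ s y, d.d_out _ _ _ _ _ s y⟩

theorem inn_cocycles {m n : ℕ} {i : ℤ} (s) (x) (hx : x ∈ cocycles d m n i) :
    E.inn m n i s x ∈ cocycles d m n i := by
  simp only [cocycles, LinearMap.mem_ker] at hx ⊢
  rw [d.d_inn, hx, map_zero]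

theorem inn_coboundaries {m n : ℕ} {i : ℤ} (s) (x) (hx : x ∈ coboundaries d m n i) :
    E.inn m n i s x ∈ coboundaries d m n i := by
  obtain ⟨y, rfl⟩ := hx
  exact ⟨E.inn _ _ _ s y, d.d_inn _ _ _ _ _ s y⟩

/-- The cohomology of a dg `S`-bimodule, with the induced actions. -/
def cohomology : SBimodule K where
  X := CohomMod d
  out := fun m n i =>
    { toFun := fun s => cohomEnd d (E.out m n i s) (out_cocycles d s) (out_coboundaries d s)
      map_one' := by
        ext x
        simp [cohomEnd]
        rfl
      map_mul' := by
        intro s t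
        ext x
        simp [cohomEnd]
        rfl }
  inn := fun m n i =>
    { toFun := fun s => cohomEnd d (E.inn m n i s) (inn_cocycles d s) (inn_coboundaries d s)
      map_one' := by
        ext x
        simp [cohomEnd]
        rfl
      map_mul' := by
        intro s t
        ext x
        simp [cohomEnd]
        rfl }
  comm := by
    intro m n i s t x
    obtain ⟨⟨x, hx⟩, rfl⟩ := Submodule.Quotient.mk_surjective _ x
    simp only [MonoidHom.coe_mk, OneHom.coe_mk, cohomEnd, Submodule.mapQ_apply]
    congr 1
    exact Subtype.ext (E.comm m n i s t x)

/-- The graph decorated by the cohomology classes of the given decorations. -/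
def DecGraph.classes {m n : ℕ} {i : ℤ} (D : DecGraph E m n i)
    (h : ∀ v, D.dec v ∈ cocycles d _ _ _) : DecGraph (cohomology d) m n i where
  G := D.G
  deg := D.deg
  deg_sum := D.deg_sum
  dec := fun v => cohomClass d (D.dec v) (h v)

/-- The properad structure `T` on the cohomology of the dg properad `P` is the one induced from
`P`: the contraction of a graph decorated by classes is the class of its contraction in `P`. -/
def DGProperad.IsInduced (P : DGProperad K) (T : ProperadStr (cohomology P.diff)) : Prop :=
  ∀ {m n i} (D : DecGraph P.mod m n i) (h : ∀ v, D.dec v ∈ cocycles P.diff _ _ _),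
    ∃ h' : P.str.μ m n i (cls D) ∈ cocycles P.diff m n i,
      T.μ m n i (cls (D.classes P.diff h)) = cohomClass P.diff (P.str.μ m n i (cls D)) h'

end Cohomology

/-! ## The generators: ordered partitions -/

/-- The ordered partitions `[m] = I₁ ⊔ … ⊔ I_k` into `k ≥ 1` nonempty blocks which index a basis of
the degree `i = k - m` part of `W(m,0)`; there are none for `n ≠ 0`.  The partition is recorded by
the surjection `f` sending an element to the (zero-based) number of its block. -/
structure PermCell (m n : ℕ) (i : ℤ) where
  k : ℕ
  f : Fin m → Fin k
  surj : Function.Surjective f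
  one_le : 1 ≤ k
  no_input : n = 0
  deg_eq : (k : ℤ) - m = i

/-- The ordered partition `σ(I₁) ⊔ … ⊔ σ(I_k)`. -/
def PermCell.act {m n : ℕ} {i : ℤ} (s : Equiv.Perm (Fin m)) (c : PermCell m n i) :
    PermCell m n i :=
  { c with
    f := c.f ∘ s.symm
    surj := c.surj.comp s.symm.surjective }

/-- The product over the blocks `I_j` of the signs of the reorderings which `σ` induces on the
increasing enumerations `I_j → σ(I_j)`. -/
def blockSign {m k : ℕ} (s : Equiv.Perm (Fin m)) (f : Fin m → Fin k) : ℤˣ :=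
  ∏ x : Fin m × Fin m, if x.1 < x.2 ∧ f x.1 = f x.2 ∧ s x.2 < s x.1 then -1 else 1

theorem blockSign_one {m k : ℕ} (f : Fin m → Fin k) : blockSign 1 f = 1 := by
  refine Finset.prod_eq_one (fun x _ => ?_)
  rw [if_neg]
  rintro ⟨h1, -, h2⟩
  exact absurd h1 (not_lt.2 h2.le)

theorem blockSign_mul {m k : ℕ} (s t : Equiv.Perm (Fin m)) (f : Fin m → Fin k) :
    blockSign (s * t) f = blockSign s (f ∘ t.symm) * blockSign t f := by
  have h : blockSign s (f ∘ t.symm) = ∏ x : Fin m × Fin m,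
      if x.1 < x.2 ∧ f x.1 = f x.2 ∧
        ((t x.1 < t x.2 ∧ s (t x.2) < s (t x.1)) ∨ (t x.2 < t x.1 ∧ s (t x.1) < s (t x.2)))
      then (-1 : ℤˣ) else 1 := by
    unfold blockSign
    rw [← Finset.prod_filter, ← Finset.prod_filter]
    refine Finset.prod_bij'
      (fun x _ => (min (t.symm x.1) (t.symm x.2), max (t.symm x.1) (t.symm x.2)))
      (fun x _ => (min (t x.1) (t x.2), max (t x.1) (t x.2))) ?_ ?_ ?_ ?_ ?_
    · rintro ⟨a, b⟩ hx
      simp only [Finset.mem_filter, Finset.mem_univ, true_and, Function.comp_apply] at hx ⊢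
      obtain ⟨h1, h2, h3⟩ := hx
      have hne : t.symm a ≠ t.symm b := fun h => h1.ne (t.symm.injective h)
      rcases lt_or_gt_of_ne hne with h | h
      · simp [min_eq_left h.le, max_eq_right h.le, h, h1, h2, h3]
      · simp [min_eq_right h.le, max_eq_left h.le, h, h1, h2, h3]
    · rintro ⟨a, b⟩ hx
      simp only [Finset.mem_filter, Finset.mem_univ, true_and, Function.comp_apply] at hx ⊢
      obtain ⟨h1, h2, h3⟩ := hx
      rcases h3 with ⟨h, h3⟩ | ⟨h, h3⟩
      · simp [min_eq_left h.le, max_eq_right h.le, h, h2, h3]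
      · simp [min_eq_right h.le, max_eq_left h.le, h, h2, h3]
    · rintro ⟨a, b⟩ hx
      simp only [Finset.mem_filter, Finset.mem_univ, true_and, Function.comp_apply] at hx ⊢
      obtain ⟨h1, -, -⟩ := hx
      have hne : t.symm a ≠ t.symm b := fun h => h1.ne (t.symm.injective h)
      rcases lt_or_gt_of_ne hne with h | h
      · simp [min_eq_left h.le, max_eq_right h.le, h1.le]
      · simp [min_eq_right h.le, max_eq_left h.le, h1.le]
    · rintro ⟨a, b⟩ hx
      simp only [Finset.mem_filter, Finset.mem_univ, true_and] at hx ⊢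
      obtain ⟨h1, -, h3⟩ := hx
      rcases h3 with ⟨h, -⟩ | ⟨h, -⟩
      · simp [min_eq_left h.le, max_eq_right h.le, h1.le]
      · simp [min_eq_right h.le, max_eq_left h.le, h1.le]
    · intros; rfl
  rw [h]
  unfold blockSign
  rw [← Finset.prod_mul_distrib]
  refine Finset.prod_congr rfl (fun x _ => ?_)
  obtain ⟨a, b⟩ := x
  simp only [Equiv.Perm.coe_mul, Function.comp_apply]
  by_cases h1 : a < b
  swap
  · simp [h1]
  by_cases h2 : f a = f b
  swap
  · simp [h2]
  have hne : t a ≠ t b := fun h => h1.ne (t.injective h)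
  have hne' : s (t a) ≠ s (t b) := fun h => hne (s.injective h)
  rcases lt_or_gt_of_ne hne with h | h <;> rcases lt_or_gt_of_ne hne' with h' | h' <;>
    simp [h1, h2, h, h', h.not_gt, h'.not_gt]

variable (K)

/-- The `S`-bimodule `W`: `W(m,0)` is spanned by the corollas with `m` output legs, no inputs and
legs gathered in `k` bunches labelled by ordered partitions `I₁ ⊔ … ⊔ I_k` of `[m]`, each bunch
being labelled increasingly from the left to the right; the legs within each bunch are
skewsymmetric. -/
noncomputable def W : SBimodule K where
  X := fun m n i => PermCell m n i →₀ K
  out := fun m n i =>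
    { toFun := fun s => Finsupp.lift _ K _
        (fun c => Finsupp.single (c.act s) (((blockSign s c.f : ℤˣ) : ℤ) : K))
      map_one' := by
        ext1 c
        ext1
        simp [blockSign_one]
        rfl
      map_mul' := by
        intro s t
        have key : ∀ (s : Equiv.Perm (Fin m)) (c : PermCell m n i) (r : K),
            Finsupp.lift (PermCell m n i →₀ K) K (PermCell m n i) (fun c =>
              Finsupp.single (c.act s) (((blockSign s c.f : ℤˣ) : ℤ) : K)) (Finsupp.single c r) =
              Finsupp.single (c.act s) (r * (((blockSign s c.f : ℤˣ) : ℤ) : K)) := by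
          intro s c r
          rw [Finsupp.lift_apply, Finsupp.sum_single_index (by simp), Finsupp.smul_single,
            smul_eq_mul]
        refine Finsupp.lhom_ext (fun c r => ?_)
        have h : c.act (s * t) = (c.act t).act s := rfl
        have h' : (c.act t).f = c.f ∘ t.symm := rfl
        rw [Module.End.mul_apply, key, key, key, h, h', blockSign_mul]
        congr 1
        rw [Units.val_mul, Int.cast_mul, ← mul_assoc]
        exact mul_right_comm _ _ _ }
  inn := fun m n i => 1
  comm := by
    intro m n i s t x
    rfl

/-- The corolla `I₁ | … | I_k` as an element of `W(m,0)`. -/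
noncomputable def corollaW {m : ℕ} {i : ℤ} (c : PermCell m 0 i) : (W K).X m 0 i :=
  (Finsupp.single c 1 : PermCell m 0 i →₀ K)

variable {K}

/-- The ordered partitions into `k + 1` blocks which arise from the given one by splitting its
block number `a` into two consecutive nonempty blocks (`predAbove a` merges the blocks number `a`
and `a + 1`). -/
abbrev PermCell.Splitting {m : ℕ} {i : ℤ} (c : PermCell m 0 i) (a : Fin c.k) : Type :=
  {g : Fin m → Fin (c.k + 1) // Function.Surjective g ∧ ∀ x, a.predAbove (g x) = c.f x}

noncomputable instance {m : ℕ} {i : ℤ} (c : PermCell m 0 i) (a : Fin c.k) :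
    Fintype (c.Splitting a) := Fintype.ofFinite _

/-- The ordered partition given by a splitting. -/
def PermCell.split {m : ℕ} {i j : ℤ} (h : i + 1 = j) (c : PermCell m 0 i) {a : Fin c.k}
    (g : c.Splitting a) : PermCell m 0 j where
  k := c.k + 1
  f := g.1
  surj := g.2.1
  one_le := by omega
  no_input := rfl
  deg_eq := by have := c.deg_eq; push_cast; omega

/-- The exponent of the sign: for the splitting `I_i = I_i' ⊔ I_i''` of the block number `i = a + 1`
it is `i + 1 + |I₁| + … + |I_{i-1}| + |I_i'|` plus the number of inversions of the permutation
`I_i → I_i' ⊔ I_i''`. -/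
def splitExponent {m k : ℕ} (a : Fin k) (g : Fin m → Fin (k + 1)) : ℕ :=
  ((a : ℕ) + 1) + 1 + (Finset.univ.filter (fun x => g x ≤ a.castSucc)).card +
    (Finset.univ.filter
      (fun x : Fin m × Fin m => g x.1 = a.castSucc ∧ g x.2 = a.succ ∧ x.2 < x.1)).card

variable (K)

/-- The right hand side of the formula for the differential of a corolla. -/
noncomputable def permBoundary {m : ℕ} {i j : ℤ} (h : i + 1 = j) (c : PermCell m 0 i) :
    (W K).X m 0 j :=
  ∑ a : Fin c.k, ∑ g : c.Splitting a,
    (-1 : K) ^ splitExponent a g.1 • corollaW K (c.split h g)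

variable {K}

/-- The differential of `P` is given on the generators by the formula
`δ (I₁|…|I_k) = ∑ᵢ ∑ ± (I₁|…|I_i'|I_i''|…|I_k)`. -/
def DGProperad.HasPermDifferential (P : DGProperad K) (ι : Hom (W K) P.mod) : Prop :=
  ∀ (m : ℕ) (i j : ℤ) (h : i + 1 = j) (c : PermCell m 0 i),
    P.diff.d m 0 i j h (ι.f m 0 i (corollaW K c)) = ι.f m 0 j (permBoundary K h c)

variable (K)

/-- The `S`-bimodule spanned by one `(m,0)`-corolla of degree zero with symmetric legs for every
`m ≥ 1`. -/
noncomputable def SymCorollas : SBimodule K where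
  X := fun m n i => PLift (1 ≤ m ∧ n = 0 ∧ i = 0) →₀ K
  out := fun m n i => 1
  inn := fun m n i => 1
  comm := by
    intro m n i s t x
    rfl

/-- The symmetric `(m,0)`-corolla. -/
noncomputable def symCorolla (m : ℕ) (hm : 1 ≤ m) : (SymCorollas K).X m 0 0 :=
  (Finsupp.single ⟨hm, rfl, rfl⟩ 1 : PLift (1 ≤ m ∧ (0 : ℕ) = 0 ∧ (0 : ℤ) = 0) →₀ K)

variable {K}

/-- The ordered partition `σ(1) | σ(2) | … | σ(m)` into one-element blocks. -/
def vertexCell (m : ℕ) (hm : 1 ≤ m) (s : Equiv.Perm (Fin m)) : PermCell m 0 0 where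
  k := m
  f := s.symm
  surj := s.symm.surjective
  one_le := hm
  no_input := rfl
  deg_eq := by simp

variable (K)

/-- The sum of all vertices. -/
noncomputable def vertexSum (m : ℕ) (hm : 1 ≤ m) : (W K).X m 0 0 :=
  ∑ s : Equiv.Perm (Fin m), corollaW K (vertexCell m hm s)

variable {K}

/-- The ordered partition of `[m]` with a single block. -/
def topCell (m : ℕ) : PermCell (m + 1) 0 (-(m : ℤ)) where
  k := 1
  f := fun _ => 0
  surj := fun y => ⟨0, Subsingleton.elim _ _⟩
  one_le := le_refl 1
  no_input := rfl
  deg_eq := by push_cast; ring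

/-! ## The permutahedra and their complexes of oriented cells -/

/-- The vertices `(w(1), …, w(m))` of the permutahedron for which all values of `w` on an earlier
block of `f` are smaller than all values on a later block. -/
def permVertices {m k : ℕ} (f : Fin m → Fin k) : Set (Fin m → ℝ) :=
  {x | ∃ w : Equiv.Perm (Fin m), (∀ a b, f a < f b → w a < w b) ∧ ∀ a, x a = ((w a : ℕ) : ℝ) + 1}

/-- The permutahedron `P_{m-1} ⊂ ℝ^m`: the convex hull of the points `(w(1), …, w(m))`. -/
def permutahedron (m : ℕ) : Set (Fin m → ℝ) :=
  convexHull ℝ {x | ∃ w : Equiv.Perm (Fin m), ∀ a, x a = ((w a : ℕ) : ℝ) + 1}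

/-- The cell `P_{m-1}^{I₁,…,I_k}` of the permutahedron: the convex hull of the vertices
`(w(1), …, w(m))` with the smallest values on `I₁`, the next ones on `I₂`, and so on. -/
def permFace {m k : ℕ} (f : Fin m → Fin k) : Set (Fin m → ℝ) :=
  convexHull ℝ (permVertices f)

/-- The cells of a polytope `P`: its nonempty (exposed) faces, including `P`. -/
def IsCell {m : ℕ} (P F : Set (Fin m → ℝ)) : Prop := F.Nonempty ∧ IsExposed ℝ P F

theorem finite_cells (m : ℕ) : {F | IsCell (permutahedron m) F}.Finite := by
  have hfin : {x : Fin m → ℝ |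
      ∃ w : Equiv.Perm (Fin m), ∀ a, x a = ((w a : ℕ) : ℝ) + 1}.Finite := by
    refine (Set.finite_range
      (fun w : Equiv.Perm (Fin m) => fun a => ((w a : ℕ) : ℝ) + 1)).subset ?_
    rintro x ⟨w, hw⟩
    exact ⟨w, (funext hw).symm⟩
  have hcomp : IsCompact (permutahedron m) := hfin.isCompact_convexHull ℝ
  refine Set.Finite.of_finite_image (f := fun F => F.extremePoints ℝ)
    (hfin.finite_subsets.subset ?_) ?_
  · rintro _ ⟨F, hF, rfl⟩ x hx
    exact extremePoints_convexHull_subset (𝕜 := ℝ)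
      (hF.2.isExtreme.extremePoints_subset_extremePoints hx)
  · intro F hF F' hF' h
    have h1 := closure_convexHull_extremePoints (hF.2.isCompact hcomp)
      (hF.2.convex (convex_convexHull ℝ _))
    have h2 := closure_convexHull_extremePoints (hF'.2.isCompact hcomp)
      (hF'.2.convex (convex_convexHull ℝ _))
    rw [← h1, ← h2]
    exact congrArg _ (congrArg _ h)

/-- The finite set of all cells of the permutahedron. -/
noncomputable def cells (m : ℕ) : Finset (Set (Fin m → ℝ)) := (finite_cells m).toFinset

/-- `b` is a basis of the vector space of directions in the affine span of `F`; in particular `F`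
is of dimension `d`. -/
def IsFrame {m d : ℕ} (F : Set (Fin m → ℝ)) (b : Fin d → Fin m → ℝ) : Prop :=
  LinearIndependent ℝ b ∧ Submodule.span ℝ (Set.range b) = vectorSpan ℝ F

/-- The change of frames by a matrix. -/
def changeFrame {m d : ℕ} (A : Matrix (Fin d) (Fin d) ℝ) (b : Fin d → Fin m → ℝ) :
    Fin d → Fin m → ℝ :=
  fun i => ∑ j, A i j • b j

theorem span_changeFrame_le {m d : ℕ} (A : Matrix (Fin d) (Fin d) ℝ) (b : Fin d → Fin m → ℝ) :
    Submodule.span ℝ (Set.range (changeFrame A b)) ≤ Submodule.span ℝ (Set.range b) := by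
  rw [Submodule.span_le]
  rintro _ ⟨i, rfl⟩
  exact Submodule.sum_mem _ fun j _ => Submodule.smul_mem _ _ (Submodule.subset_span ⟨j, rfl⟩)

theorem changeFrame_mul {m d : ℕ} (A B : Matrix (Fin d) (Fin d) ℝ) (b : Fin d → Fin m → ℝ) :
    changeFrame (A * B) b = changeFrame A (changeFrame B b) := by
  funext i
  simp only [changeFrame, Matrix.mul_apply, Finset.sum_smul, Finset.smul_sum, smul_smul]
  exact Finset.sum_comm

theorem changeFrame_one {m d : ℕ} (b : Fin d → Fin m → ℝ) : changeFrame 1 b = b := by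
  funext i
  simp [changeFrame, Matrix.one_apply]

theorem isFrame_changeFrame {m d : ℕ} {A : Matrix (Fin d) (Fin d) ℝ} (hA : A.det ≠ 0)
    (F : Set (Fin m → ℝ)) (b : Fin d → Fin m → ℝ) :
    IsFrame F (changeFrame A b) ↔ IsFrame F b := by
  have h : Submodule.span ℝ (Set.range (changeFrame A b)) = Submodule.span ℝ (Set.range b) := by
    refine le_antisymm (span_changeFrame_le A b) ?_
    have := span_changeFrame_le A⁻¹ (changeFrame A b)
    rwa [← changeFrame_mul, Matrix.nonsing_inv_mul _ (Ne.isUnit hA), changeFrame_one] at this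
  have hf : Set.finrank ℝ (Set.range (changeFrame A b)) = Set.finrank ℝ (Set.range b) := by
    unfold Set.finrank
    rw [h]
  simp only [IsFrame, linearIndependent_iff_card_eq_finrank_span, hf, h]

variable (K)

/-- The space of cellular chains of dimension `d` of the permutahedron `P_{m-1}`, spanned by its
oriented `d`-dimensional cells, a change of the orientation changing the sign.  A chain is recorded
by its coefficients `c F b` at the cells `F` with the orientation given by the frame `b`. -/
def cellChains (m d : ℕ) : Submodule K (Set (Fin m → ℝ) → (Fin d → Fin m → ℝ) → K) where
  carrier := {c | (∀ F b, c F b ≠ 0 → IsCell (permutahedron m) F ∧ IsFrame F b) ∧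
    ∀ F b (A : Matrix (Fin d) (Fin d) ℝ), A.det ≠ 0 →
      c F (changeFrame A b) = ((SignType.sign A.det : SignType) : K) * c F b}
  add_mem' := by
    rintro c c' ⟨h1, h2⟩ ⟨h1', h2'⟩
    refine ⟨fun F b h => ?_, fun F b A hA => ?_⟩
    · by_cases h0 : c F b = 0
      · refine h1' F b (fun h0' => h ?_)
        simp [h0, h0']
      · exact h1 F b h0
    · simp [h2 F b A hA, h2' F b A hA, mul_add]
  zero_mem' := ⟨fun F b h => absurd rfl h, fun F b A hA => by simp⟩
  smul_mem' := by
    rintro r c ⟨h1, h2⟩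
    refine ⟨fun F b h => h1 F b (fun h0 => h ?_), fun F b A hA => ?_⟩
    · simp [h0]
    · simp only [Pi.smul_apply, smul_eq_mul, h2 F b A hA]
      ring

variable {K}

/-- A vector pointing from the cell `F` outwards across its facet `G`: a difference `x - y` with
`x ∈ G` and `y ∈ F \ G`. -/
noncomputable def outward {m : ℕ} (F G : Set (Fin m → ℝ)) : Fin m → ℝ :=
  Classical.epsilon (fun v => ∃ x ∈ G, ∃ y ∈ F \ G, v = x - y)

open Classical in
/-- The cellular boundary: the coefficient of `∂c` at the cell `G` with the orientation `b` is the
sum of the coefficients of `c` at the cells `F` of which `G` is a facet, with the orientation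
inducing `b` on `G` by the rule "outward normal first". -/
noncomputable def boundaryFun {m d : ℕ} (c : Set (Fin m → ℝ) → (Fin (d + 1) → Fin m → ℝ) → K) :
    Set (Fin m → ℝ) → (Fin d → Fin m → ℝ) → K :=
  fun G b =>
    if IsCell (permutahedron m) G ∧ IsFrame G b then
      ∑ F ∈ (cells m).filter (G ⊆ ·), c F (Fin.cons (outward F G) b)
    else 0

theorem cons_changeFrame {m d : ℕ} (A : Matrix (Fin d) (Fin d) ℝ) (v : Fin m → ℝ)
    (b : Fin d → Fin m → ℝ) :
    ∃ B : Matrix (Fin (d + 1)) (Fin (d + 1)) ℝ, B.det = A.det ∧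
      (Fin.cons v (changeFrame A b) : Fin (d + 1) → Fin m → ℝ) =
        changeFrame B (Fin.cons v b) := by
  refine ⟨Matrix.of (Fin.cons (Fin.cons 1 0) (fun i => Fin.cons 0 (A i))), ?_, ?_⟩
  · rw [Matrix.det_succ_row_zero, Fin.sum_univ_succ]
    simp
    congr 1
  · funext i
    refine Fin.cases ?_ (fun i => ?_) i
    · simp [changeFrame, Fin.sum_univ_succ]
    · simp [changeFrame, Fin.sum_univ_succ]

variable (K)

/-- The boundary operator of the complex of oriented cells of the permutahedron. -/
noncomputable def cellBoundary (m d : ℕ) : cellChains K m (d + 1) →ₗ[K] cellChains K m d where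
  toFun := fun c => ⟨boundaryFun c.1, by
    refine ⟨fun G b h => ?_, fun G b A hA => ?_⟩
    · by_contra h'
      exact h (if_neg h')
    · unfold boundaryFun
      rw [isFrame_changeFrame hA]
      split_ifs
      · rw [Finset.mul_sum]
        refine Finset.sum_congr rfl fun F _ => ?_
        obtain ⟨B, hB, h⟩ := cons_changeFrame A (outward F G) b
        rw [h, ← hB]
        exact c.2.2 F _ B (by rwa [hB])
      · simp⟩
  map_add' := by
    intro c c'
    ext G b
    simp only [boundaryFun, Submodule.coe_add, Pi.add_apply]
    split_ifs
    · exact Finset.sum_add_distrib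
    · simp
  map_smul' := by
    intro r c
    ext G b
    simp only [boundaryFun, Submodule.coe_smul, Pi.smul_apply, RingHom.id_apply, smul_eq_mul]
    split_ifs
    · exact (Finset.mul_sum _ _ _).symm
    · simp

variable {K}

/-- The canonical identification of the complex of oriented cells of the permutahedron
`P_m ⊂ ℝ^{m+1}` (a cell of dimension `d` having degree `-d`) with the complex `P(m+1, 0)`: it
commutes with the boundary operators and with the actions of the symmetric group, which acts on
`ℝ^{m+1}` by permutations of the coordinates; the corolla `I₁|…|I_k` corresponds to the cell
`P_m^{I₁,…,I_k}` with one of its two orientations; and the corolla with a single bunch of legs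
corresponds to `P_m` with the orientation as a part of the boundary of the half space
`∑ xⁱ ≤ const`, whose outward normal is `(1,…,1)`. -/
structure IsCanonical (P : DGProperad K) (ι : Hom (W K) P.mod) (m : ℕ)
    (φ : ∀ d : ℕ, P.mod.X (m + 1) 0 (-(d : ℤ)) ≃ₗ[K] cellChains K (m + 1) d) : Prop where
  boundary : ∀ (d : ℕ) x, cellBoundary K (m + 1) d (φ (d + 1) x) =
    φ d (P.diff.d (m + 1) 0 _ _ (by push_cast; ring) x)
  equivariant : ∀ (d : ℕ) (s : Equiv.Perm (Fin (m + 1))) x F b,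
    (φ d (P.mod.out _ _ _ s x)).1 F b =
      (φ d x).1 ((fun y => y ∘ s) '' F) (fun j => b j ∘ s)
  cell : ∀ (d : ℕ) (c : PermCell (m + 1) 0 (-(d : ℤ))) F b,
    (φ d (ι.f _ _ _ (corollaW K c))).1 F b ≠ 0 → F = permFace c.f
  orientation : ∀ (d : ℕ) (c : PermCell (m + 1) 0 (-(d : ℤ))) b, IsFrame (permFace c.f) b →
    (φ d (ι.f _ _ _ (corollaW K c))).1 (permFace c.f) b = 1 ∨
      (φ d (ι.f _ _ _ (corollaW K c))).1 (permFace c.f) b = -1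
  top : ∀ b : Fin m → Fin (m + 1) → ℝ, IsFrame (permutahedron (m + 1)) b →
    0 < (Matrix.of (Fin.cons (fun _ => 1) b : Fin (m + 1) → Fin (m + 1) → ℝ)).det →
    (φ m (ι.f _ _ _ (corollaW K (topCell m)))).1 (permutahedron (m + 1)) b = 1

end PermProp

/-! An edge has to end at an incoming flag. The generators have no inputs, so a connected graph
decorated by them has no edges and a single vertex, and modulo the relations it is a corolla. Hence
a bimodule without inputs carries exactly one properad structure, being free on it means being
isomorphic to it (`ProperadStr.isFree_iff`), and the Leibniz rule reduces to equivariance of the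
differential (`DecGraph.d_val`). The cohomology has no inputs either, so everything reduces to the
complexes `W(m,0)` of representations.

The signs are removed by one change of basis. Multiply each corolla by `PermCell.theta`. In the
resulting coordinates a permutation acts by its signature times relabelling (`coords_out`), and the
differential at a partition `g` with `k` blocks is the sum over `a` of `(-1)^(k+a)` times the value
at `g` with its blocks `a` and `a + 1` merged (`coords_permDiff`). The square of the differential
then vanishes by the identity for two successive merges, as in a simplicial complex.

For the cohomology, match partitions in which the last element is a singleton block, not in final
position, with partitions in which it shares a block, by merging that singleton with the next block.
This matching is triangular for the position of the last element. It leaves the partitions that end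
with the last element as a singleton, which form the same complex for one element fewer. By
induction only the partition into singletons in natural order survives (`exists_cobound`). The sum
of the coefficients of the vertices kills boundaries and equals `m!` on the sum of all vertices, so
in characteristic zero that invariant sum generates the cohomology.

For the geometry, the rearrangement inequality shows that the points of the permutahedron maximizing
a linear form `c` form the face of the ordered partition that ranks the coordinates of `c`
(`permFace_eq_maximizers`). The directions of this face are the vectors with zero sum over each
block. A frame is therefore oriented by the determinant of the block indicators followed by the
frame. For a facet with an outward vector in front, a determinant computation gives exactly the sign
`(-1)^(k+a)` (`exists_det_stack_outward`), so the coordinates above are the coefficients of the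
cellular chain. Uniqueness follows by descending from the top cell: the boundary of a cell
determines the orientation of each of its facets (`IsCanonical.corolla_eq`). -/

namespace PermProp

universe u

/-! ## Bimodules without inputs -/

section NoInputs

variable {K : Type u} [Field K]

/-- All elements of the bimodule have no inputs. -/
def SBimodule.NoInputs (E : SBimodule K) : Prop := ∀ m n i, n ≠ 0 → Subsingleton (E.X m n i)

/-- Transport along equalities of the numbers of legs and of the degree. -/
def SBimodule.transport (E : SBimodule K) {a b m n : ℕ} {j i : ℤ} (ha : a = m) (hb : b = n)
    (hj : j = i) : E.X a b j →ₗ[K] E.X m n i := by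
  subst ha hb hj
  exact LinearMap.id

theorem SBimodule.transport_transport (E : SBimodule K) {a b a' b' m n : ℕ} {j j' i : ℤ}
    (ha : a = a') (hb : b = b') (hj : j = j') (ha' : a' = m) (hb' : b' = n) (hj' : j' = i)
    (x : E.X a b j) : E.transport ha' hb' hj' (E.transport ha hb hj x) =
      E.transport (ha.trans ha') (hb.trans hb') (hj.trans hj') x := by
  subst ha hb hj ha' hb' hj'
  rfl

theorem SBimodule.transport_out (E : SBimodule K) {a b m n : ℕ} {j i : ℤ} (ha : a = m)
    (hb : b = n) (hj : j = i) (s : Equiv.Perm (Fin a)) (x : E.X a b j) :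
    E.transport ha hb hj (E.out _ _ _ s x) =
      E.out _ _ _ ((finCongr ha).permCongr s) (E.transport ha hb hj x) := by
  subst ha hb hj
  rfl

theorem SBimodule.inn_eq_self (E : SBimodule K) {m n : ℕ} {i : ℤ} (hn : n = 0)
    (t : (Equiv.Perm (Fin n))ᵐᵒᵖ) (x : E.X m n i) : E.inn m n i t x = x := by
  subst hn
  rw [Subsingleton.elim t 1, map_one]
  rfl

theorem Differential.d_transport {E : SBimodule K} (d : Differential E) {a b m n : ℕ}
    {j j' i i' : ℤ} (ha : a = m) (hb : b = n) (hj : j = i) (hj' : j' = i') (h : j + 1 = j')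
    (h' : i + 1 = i') (x : E.X a b j) : d.d m n i i' h' (E.transport ha hb hj x) =
      E.transport ha hb hj' (d.d a b j j' h x) := by
  subst ha hb hj hj'
  rfl

/-- Without incoming flags there are no edges, and the equivalence relation generated by the empty
relation is equality. -/
theorem Graph.eq_of_no_inputs {m n : ℕ} (G : Graph m n) (hq : ∀ v, G.q v = 0)
    (v w : Fin G.k) : v = w := by
  have hE : ∀ v w, ¬ Edge G.wire v w := by
    rintro v w ⟨i, j, -⟩
    rw [hq] at j
    exact j.elim0
  have := G.proper.connected v w
  induction this with
  | rel x y h => exact absurd h (hE _ _)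
  | refl x => rfl
  | symm x y _ ih => exact ih.symm
  | trans x y z _ _ ih1 ih2 => exact ih1.trans ih2

/-- The wiring restricts to a bijection from the outgoing flags of the only vertex to the output
legs, so a labelling of the legs is all that the graph retains. -/
theorem Graph.exists_perm {m n : ℕ} (G : Graph m n) (hn : n = 0) (hq : ∀ v, G.q v = 0)
    (v : Fin G.k) : ∃ (hp : G.p v = m) (s : Equiv.Perm (Fin m)),
      ∀ j, G.wire (Sum.inl ⟨v, j⟩) = Sum.inr (s (Fin.cast hp j)) := by
  have h1 : ∀ j, ∃ l, G.wire (Sum.inl ⟨v, j⟩) = Sum.inr l := by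
    intro j
    rcases h : G.wire (Sum.inl ⟨v, j⟩) with ⟨w, l⟩ | l
    · rw [hq] at l
      exact l.elim0
    · exact ⟨l, rfl⟩
  choose e he using h1
  have hbij : Function.Bijective e := by
    constructor
    · intro a b hab
      have := (he a).trans ((congrArg Sum.inr hab).trans (he b).symm)
      simpa using this
    · intro l
      rcases h : G.wire.symm (Sum.inr l) with ⟨w, j⟩ | j
      · obtain rfl := G.eq_of_no_inputs hq v w
        refine ⟨j, ?_⟩
        have := he j
        rw [← h, Equiv.apply_symm_apply] at this
        exact (Sum.inr.inj this).symm
      · subst hn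
        exact j.elim0
  have hp : G.p v = m := by simpa using Fintype.card_of_bijective hbij
  refine ⟨hp, (finCongr hp).symm.trans (Equiv.ofBijective e hbij), fun j => ?_⟩
  rw [he]
  rfl

variable {E : SBimodule K} {m n : ℕ} {i : ℤ}

/-- A decorated graph without inputs at the vertices and without input legs. -/
def DecGraph.Inputless (D : DecGraph E m n i) : Prop := n = 0 ∧ ∀ v, D.G.q v = 0

theorem DecGraph.Inputless.deg_eq {D : DecGraph E m n i} (h : D.Inputless) (v : Fin D.G.k) :
    D.deg v = i := by
  have := D.deg_sum
  rwa [Finset.sum_eq_single v (fun w _ hw => absurd (D.G.eq_of_no_inputs h.2 w v) hw)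
    (fun hv => absurd (Finset.mem_univ v) hv)] at this

theorem DecGraph.Inputless.q_eq {D : DecGraph E m n i} (h : D.Inputless) (v : Fin D.G.k) :
    D.G.q v = n := (h.2 v).trans h.1.symm

open Classical in
/-- The contraction of a decorated graph in a bimodule without inputs. -/
noncomputable def DecGraph.val (D : DecGraph E m n i) : E.X m n i :=
  if h : D.Inputless then
    E.out m n i (D.G.exists_perm h.1 h.2 D.G.proper.nonempty.some).choose_spec.choose
      (E.transport (D.G.exists_perm h.1 h.2 D.G.proper.nonempty.some).choose
        (h.q_eq _) (h.deg_eq _) (D.dec D.G.proper.nonempty.some))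
  -- The default is the right value when `E` has no inputs: either an input leg makes the target
  -- zero, or some vertex has an incoming flag and a zero decoration.
  else 0

theorem DecGraph.val_of_not {D : DecGraph E m n i} (h : ¬ D.Inputless) : D.val = 0 := dif_neg h

/-- The choices made in `DecGraph.val` are immaterial: the vertex is unique and the wiring
determines the permutation. -/
theorem DecGraph.Inputless.out_transport_eq {D : DecGraph E m n i} (h : D.Inputless)
    {v v' : Fin D.G.k} (hp : D.G.p v = m) (hp' : D.G.p v' = m) {s s' : Equiv.Perm (Fin m)}
    (hs : ∀ j, D.G.wire (Sum.inl ⟨v, j⟩) = Sum.inr (s (Fin.cast hp j)))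
    (hs' : ∀ j, D.G.wire (Sum.inl ⟨v', j⟩) = Sum.inr (s' (Fin.cast hp' j))) :
    E.out m n i s (E.transport hp (h.q_eq v) (h.deg_eq v) (D.dec v)) =
      E.out m n i s' (E.transport hp' (h.q_eq v') (h.deg_eq v') (D.dec v')) := by
  obtain rfl := D.G.eq_of_no_inputs h.2 v v'
  have : s = s' := by
    ext1 j
    have := (hs (Fin.cast hp.symm j)).symm.trans (hs' (Fin.cast hp.symm j))
    simpa using this
  rw [this]

theorem DecGraph.val_eq {D : DecGraph E m n i} (h : D.Inputless) (v : Fin D.G.k)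
    (hp : D.G.p v = m) (s : Equiv.Perm (Fin m))
    (hs : ∀ j, D.G.wire (Sum.inl ⟨v, j⟩) = Sum.inr (s (Fin.cast hp j))) :
    D.val = E.out m n i s (E.transport hp (h.q_eq v) (h.deg_eq v) (D.dec v)) := by
  rw [DecGraph.val, dif_pos h]
  exact h.out_transport_eq _ hp
    (D.G.exists_perm h.1 h.2 D.G.proper.nonempty.some).choose_spec.choose_spec hs

theorem uniqueSigma_apply (m : ℕ) (w : Fin 1) (j : Fin m) :
    Equiv.uniqueSigma (fun _ : Fin 1 => Fin m) ⟨w, j⟩ = j := by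
  obtain rfl := Subsingleton.elim w default
  rfl

theorem corollaWire_inl (m n : ℕ) (w : Fin 1) (j : Fin m) :
    corollaWire m n (Sum.inl ⟨w, j⟩) = Sum.inr j := by
  simp [corollaWire, uniqueSigma_apply]

theorem Wiring.reindex_eq_inr {V V' : Type} {p q : V → ℕ} {m n : ℕ} (e : Wiring p q m n)
    (f : V' ≃ V) (v : V') (j : Fin (p (f v))) (l : Fin m) :
    e.reindex f (Sum.inl ⟨v, j⟩) = Sum.inr l ↔ e (Sum.inl ⟨f v, j⟩) = Sum.inr l := by
  simp only [Wiring.reindex, Equiv.trans_apply, Equiv.symm_apply_eq]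
  exact Iff.rfl

theorem DecGraph.val_corolla (hE : E.NoInputs) (x : E.X m n i) :
    (DecGraph.corolla x).val = x := by
  rcases eq_or_ne n 0 with hn | hn
  · have h : (DecGraph.corolla x).Inputless := ⟨hn, fun _ => hn⟩
    refine (DecGraph.val_eq h (0 : Fin 1) rfl 1 (fun j => ?_)).trans ?_
    · exact corollaWire_inl m n 0 j
    · rw [map_one]
      rfl
  · have := hE m n i hn
    exact Subsingleton.elim _ _

theorem DecGraph.val_legs (hE : E.NoInputs) (D : DecGraph E m n i) (s : Equiv.Perm (Fin m))
    (t : Equiv.Perm (Fin n)) :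
    (D.legs s t).val = E.out m n i s (E.inn m n i (MulOpposite.op t) D.val) := by
  rcases eq_or_ne n 0 with hn | hn
  · rw [E.inn_eq_self hn]
    by_cases h : D.Inputless
    · have h' : (D.legs s t).Inputless := h
      obtain ⟨v⟩ := D.G.proper.nonempty
      obtain ⟨hp, s', hs'⟩ := D.G.exists_perm h.1 h.2 v
      rw [DecGraph.val_eq h v hp s' hs']
      refine (DecGraph.val_eq h' v hp (s * s') (fun j => ?_)).trans ?_
      · exact (congrArg (Equiv.sumCongr (Equiv.refl _) s) (hs' j)).trans rfl
      · rw [map_mul]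
        rfl
    · have h' : ¬ (D.legs s t).Inputless := h
      rw [DecGraph.val_of_not h, DecGraph.val_of_not h', map_zero]
  · have := hE m n i hn
    exact Subsingleton.elim _ _

theorem DecGraph.val_set_add (D : DecGraph E m n i) (v) (x y) :
    (D.set v (x + y)).val = (D.set v x).val + (D.set v y).val := by
  by_cases h : D.Inputless
  · obtain ⟨hp, s, hs⟩ := D.G.exists_perm h.1 h.2 v
    have key : ∀ x, (D.set v x).val =
        E.out m n i s (E.transport hp (h.q_eq v) (h.deg_eq v) x) := by
      intro x
      refine (DecGraph.val_eq (D := D.set v x) h v hp s hs).trans ?_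
      change E.out m n i s (E.transport hp _ _ (Function.update D.dec v x v)) = _
      rw [Function.update_self]
    simp only [key, map_add]
  · have h' : ∀ x, ¬ (D.set v x).Inputless := fun _ => h
    simp only [DecGraph.val_of_not (h' _), add_zero]

theorem DecGraph.val_set_smul (D : DecGraph E m n i) (v) (c : K) (x) :
    (D.set v (c • x)).val = c • (D.set v x).val := by
  by_cases h : D.Inputless
  · obtain ⟨hp, s, hs⟩ := D.G.exists_perm h.1 h.2 v
    have key : ∀ x, (D.set v x).val =
        E.out m n i s (E.transport hp (h.q_eq v) (h.deg_eq v) x) := by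
      intro x
      refine (DecGraph.val_eq (D := D.set v x) h v hp s hs).trans ?_
      change E.out m n i s (E.transport hp _ _ (Function.update D.dec v x v)) = _
      rw [Function.update_self]
    simp only [key, map_smul]
  · have h' : ∀ x, ¬ (D.set v x).Inputless := fun _ => h
    simp only [DecGraph.val_of_not (h' _), smul_zero]

theorem DecGraph.val_relabel (D : DecGraph E m n i) (s : ∀ v, Equiv.Perm (Fin (D.G.p v)))
    (t : ∀ v, Equiv.Perm (Fin (D.G.q v))) : (D.relabel s t).val = (D.act s t).val := by
  by_cases h : D.Inputless
  · obtain ⟨v⟩ := D.G.proper.nonempty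
    obtain ⟨hp, s', hs'⟩ := D.G.exists_perm h.1 h.2 v
    rw [DecGraph.val_eq (D := D.act s t) h v hp s' hs']
    refine (DecGraph.val_eq (D := D.relabel s t) h v hp (s' * (finCongr hp).permCongr (s v))
      (fun j => ?_)).trans ?_
    · exact (congrArg (Equiv.sumCongr (Equiv.sigmaCongrRight t) (Equiv.refl _))
        (hs' (s v j))).trans rfl
    · have : (D.act s t).dec v = E.out _ _ _ (s v) (D.dec v) :=
        congrArg _ (E.inn_eq_self (h.2 v) _ _)
      rw [this, map_mul]
      exact congrArg _ (E.transport_out hp _ _ (s v) (D.dec v)).symm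
  · have h1 : ¬ (D.relabel s t).Inputless := h
    have h2 : ¬ (D.act s t).Inputless := h
    rw [DecGraph.val_of_not h1, DecGraph.val_of_not h2]

theorem DecGraph.val_permute (D : DecGraph E m n i) (π : Equiv.Perm (Fin D.G.k)) :
    (D.permute π).val = (((DecGraph.koszul D.deg π : ℤˣ) : ℤ) : K) • D.val := by
  by_cases h : D.Inputless
  · obtain ⟨v⟩ := D.G.proper.nonempty
    obtain ⟨hp, s, hs⟩ := D.G.exists_perm h.1 h.2 (π v)
    -- With a single vertex there is no pair of factors to exchange.
    have hk : DecGraph.koszul D.deg π = 1 := by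
      refine Finset.prod_eq_one (fun x _ => if_neg ?_)
      rintro ⟨h1, -⟩
      exact h1.ne (D.G.eq_of_no_inputs h.2 _ _)
    rw [hk, DecGraph.val_eq h (π v) hp s hs]
    refine (DecGraph.val_eq (D := D.permute π) ⟨h.1, fun v => h.2 (π v)⟩ v hp s
      (fun j => ?_)).trans ?_
    · exact (Wiring.reindex_eq_inr D.G.wire π v j _).2 (hs j)
    · simp
      rfl
  · have h' : ¬ (D.permute π).Inputless := fun h' => h ⟨h'.1, fun v => by
      have := h'.2 (π.symm v)
      simpa [DecGraph.permute, Graph.permute] using this⟩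
    rw [DecGraph.val_of_not h, DecGraph.val_of_not h', smul_zero]

/-- Associativity of contraction. One-vertex graphs compose by multiplying their leg permutations,
so the essential case is multiplicativity of the action; in the other cases both sides vanish. -/
theorem DecGraph.val_subst (hE : E.NoInputs) (G : Graph m n) (deg : Fin G.k → ℤ)
    (hdeg : ∑ v, deg v = i) (D : ∀ v, DecGraph E (G.p v) (G.q v) (deg v)) :
    (⟨G, deg, hdeg, fun v => (D v).val⟩ : DecGraph E m n i).val =
      (DecGraph.subst G deg hdeg D).val := by
  rcases eq_or_ne n 0 with hn | hn
  swap
  · have := hE m n i hn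
    exact Subsingleton.elim _ _
  by_cases hS : (DecGraph.subst G deg hdeg D).Inputless
  · have hD0 : ∀ v w, (D v).G.q w = 0 := by
      have key : ∀ σ : Σ v, Fin (D v).G.k, (D σ.1).G.q σ.2 = 0 := by
        intro σ
        have := hS.2 (finSigmaFinEquiv (n := fun v => (D v).G.k) σ)
        change (D (finSigmaFinEquiv.symm (finSigmaFinEquiv σ)).1).G.q
          (finSigmaFinEquiv.symm (finSigmaFinEquiv σ)).2 = 0 at this
        rwa [Equiv.symm_apply_apply] at this
      exact fun v w => key ⟨v, w⟩
    -- An incoming flag of `G` at `v` would be an input leg of the inserted graph, which has to run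
    -- into an incoming flag of one of its vertices.
    have hG : ∀ v, G.q v = 0 := by
      intro v
      by_contra hv
      rcases h : (D v).G.wire (Sum.inr ⟨0, Nat.pos_of_ne_zero hv⟩) with ⟨w, j⟩ | j
      · rw [hD0] at j
        exact j.elim0
      · exact (D v).G.proper.legs _ _ h
    have hD : ∀ v, (D v).Inputless := fun v => ⟨hG v, hD0 v⟩
    obtain ⟨u⟩ := (DecGraph.subst G deg hdeg D).G.proper.nonempty
    set σ := (finSigmaFinEquiv (n := fun v => (D v).G.k)).symm u with hσ
    obtain ⟨hp1, s1, hs1⟩ := (D σ.1).G.exists_perm (hG _) (hD0 _) σ.2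
    obtain ⟨hp2, s2, hs2⟩ := G.exists_perm hn hG σ.1
    have hO : (⟨G, deg, hdeg, fun v => (D v).val⟩ : DecGraph E m n i).Inputless := ⟨hn, hG⟩
    rw [DecGraph.val_eq hO σ.1 hp2 s2 hs2]
    dsimp only
    rw [DecGraph.val_eq (hD _) σ.2 hp1 s1 hs1, E.transport_out, E.transport_transport]
    refine Eq.symm ((DecGraph.val_eq hS u (hp1.trans hp2)
      (s2 * (finCongr hp2).permCongr s1) (fun j => ?_)).trans ?_)
    · have h1 : substWire G (fun v => (D v).G) (Sum.inl ⟨σ, j⟩) =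
          Sum.inr (s2 (Fin.cast hp2 (s1 (Fin.cast hp1 j)))) := by
        simp [substWire, compose, composeFun,
          innerWire_inl_inr G (fun v => (D v).G) (hs1 j), hs2]
      exact (Wiring.reindex_eq_inr (substWire G (fun v => (D v).G)) finSigmaFinEquiv.symm
        u j _).2 h1
    · rw [map_mul]
      rfl
  · rw [DecGraph.val_of_not hS]
    by_cases hO : (⟨G, deg, hdeg, fun v => (D v).val⟩ : DecGraph E m n i).Inputless
    · have : ¬ ∀ v, (D v).Inputless := fun h => hS ⟨hn, fun u => (h _).2 _⟩
      push Not at this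
      obtain ⟨v, hv⟩ := this
      obtain ⟨hp, s, hs⟩ := G.exists_perm hO.1 hO.2 v
      rw [DecGraph.val_eq hO v hp s hs]
      dsimp only
      rw [DecGraph.val_of_not hv, map_zero, map_zero]
    · exact DecGraph.val_of_not hO

variable (E) in
/-- The contraction of linear combinations of decorated graphs in a bimodule without inputs. -/
noncomputable def contract (m n : ℕ) (i : ℤ) : FreeMod E m n i →ₗ[K] E.X m n i :=
  Submodule.liftQ _ (Finsupp.linearCombination K DecGraph.val) (by
    rw [Submodule.span_le]
    rintro r (⟨D, v, x, y⟩ | ⟨D, v, c, x⟩ | ⟨D, s, t⟩ | ⟨D, π⟩)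
    · simp [DecGraph.val_set_add]
    · simp [DecGraph.val_set_smul]
    · simp [DecGraph.val_relabel]
    · simp [DecGraph.val_permute])

theorem contract_cls (D : DecGraph E m n i) : contract E m n i (cls D) = D.val := by
  simp [contract, cls]

/-- The unique properad structure on a bimodule without inputs. -/
noncomputable def SBimodule.NoInputs.str (hE : E.NoInputs) : ProperadStr E where
  μ := contract E
  corolla := fun x => by rw [contract_cls, DecGraph.val_corolla hE]
  legs := fun D s t => by rw [contract_cls, contract_cls, DecGraph.val_legs hE]
  assoc := fun G deg h D => by
    simp only [contract_cls]
    exact DecGraph.val_subst hE G deg h D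

/-! ### Reduction of decorated graphs without inputs to corollas -/

theorem cls_relabel (D : DecGraph E m n i) (s t) : cls (D.relabel s t) = cls (D.act s t) := by
  rw [← sub_eq_zero]
  have h : (Submodule.Quotient.mk (Finsupp.single (D.relabel s t) 1 -
      Finsupp.single (D.act s t) 1) : FreeMod E m n i) = 0 :=
    (Submodule.Quotient.mk_eq_zero _).2 (Submodule.subset_span (DecRel.flags D s t))
  rwa [Submodule.Quotient.mk_sub] at h

theorem cls_set_add (D : DecGraph E m n i) (v) (x y) :
    cls (D.set v (x + y)) = cls (D.set v x) + cls (D.set v y) := by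
  have h := (Submodule.Quotient.mk_eq_zero _).2 (Submodule.subset_span (R := K)
    (s := {r | DecRel E m n i r}) (DecRel.add D v x y))
  rw [Submodule.Quotient.mk_sub, Submodule.Quotient.mk_sub, sub_sub] at h
  exact sub_eq_zero.1 h

theorem cls_set_smul (D : DecGraph E m n i) (v) (c : K) (x) :
    cls (D.set v (c • x)) = c • cls (D.set v x) := by
  have h := (Submodule.Quotient.mk_eq_zero _).2 (Submodule.subset_span (R := K)
    (s := {r | DecRel E m n i r}) (DecRel.smul D v c x))
  rw [Submodule.Quotient.mk_sub, Submodule.Quotient.mk_smul] at h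
  exact sub_eq_zero.1 h

theorem cls_eq_zero (D : DecGraph E m n i) (v) (hv : D.dec v = 0) : cls D = 0 := by
  have h := cls_set_smul D v 0 (D.dec v)
  have h' : D.set v 0 = D := by
    rw [← hv]
    simp [DecGraph.set]
  rwa [zero_smul, zero_smul, h'] at h

theorem corolla_set (x y : E.X m n i) :
    (DecGraph.corolla x).set (0 : Fin 1) y = DecGraph.corolla y := by
  have h : Function.update (fun _ : Fin 1 => x) 0 y = fun _ => y := by
    funext w
    obtain rfl := Subsingleton.elim w 0
    simp
  exact congrArg (fun z => (⟨Graph.corolla m n, fun _ => i, Fin.sum_univ_one _, z⟩ :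
    DecGraph E m n i)) h

theorem cls_corolla_add (x y : E.X m n i) : cls (DecGraph.corolla (x + y)) =
    cls (DecGraph.corolla x) + cls (DecGraph.corolla y) := by
  rw [← corolla_set x (x + y), ← corolla_set x y]
  refine (cls_set_add (DecGraph.corolla x) (0 : Fin 1) x y).trans ?_
  rw [corolla_set x x]

theorem cls_corolla_smul (c : K) (x : E.X m n i) : cls (DecGraph.corolla (c • x)) =
    c • cls (DecGraph.corolla x) := by
  rw [← corolla_set x (c • x)]
  refine (cls_set_smul (DecGraph.corolla x) (0 : Fin 1) c x).trans ?_
  rw [corolla_set x x]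

theorem cls_corolla_zero : cls (DecGraph.corolla (0 : E.X m n i)) = 0 :=
  cls_eq_zero _ (0 : Fin 1) rfl

theorem DecGraph.Inputless.eq_legs {D : DecGraph E m n i} (h : D.Inputless) :
    ∃ x : E.X m n i, ∃ s, D = (DecGraph.corolla x).legs s 1 := by
  obtain ⟨v⟩ := D.G.proper.nonempty
  obtain ⟨hp, s, hs⟩ := D.G.exists_perm h.1 h.2 v
  have hq := h.q_eq
  have hd := h.deg_eq
  have hv := D.G.eq_of_no_inputs h.2
  obtain ⟨⟨k, p, q, wire, proper⟩, deg, deg_sum, dec⟩ := D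
  dsimp only at *
  obtain rfl : k = 1 := by
    have : Fintype.card (Fin k) = 1 := Fintype.card_eq_one_iff.2 ⟨v, fun w => hv w v⟩
    simpa using this
  obtain rfl : p = fun _ => m := funext fun w => by rw [hv w v]; exact hp
  obtain rfl : q = fun _ => n := funext hq
  obtain rfl : deg = fun _ => i := funext hd
  obtain rfl := h.1
  refine ⟨dec 0, s, ?_⟩
  have hw : wire = ((Graph.corolla m 0).legs s 1).wire := by
    ext1 x
    rcases x with ⟨w, j⟩ | j
    · obtain rfl := hv v w
      rw [hs]
      exact (congrArg (Equiv.sumCongr (Equiv.refl _) s) (corollaWire_inl m 0 v j)).symm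
    · exact j.elim0
  subst hw
  have hdec : dec = fun _ => dec (0 : Fin 1) := by
    funext w
    obtain rfl := Subsingleton.elim (α := Fin 1) w 0
    rfl
  exact (congrArg (fun z => (⟨⟨1, _, _, _, proper⟩, _, deg_sum, z⟩ : DecGraph E m 0 i))
    hdec).trans rfl

/-- Relabelling the output legs of a corolla gives the same graph as reordering its outgoing flags,
so the relation for flags moves the permutation into the decoration. -/
theorem cls_legs_corolla (x : E.X m n i) (s : Equiv.Perm (Fin m)) :
    cls ((DecGraph.corolla x).legs s 1) = cls (DecGraph.corolla (E.out m n i s x)) := by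
  have hw : ((Graph.corolla m n).legs s 1).wire =
      ((Graph.corolla m n).relabel (fun _ => s) (fun _ => 1)).wire := by
    ext1 a
    rcases a with ⟨w, j⟩ | j
    · exact (congrArg (Equiv.sumCongr (Equiv.refl _) s) (corollaWire_inl m n w j)).trans
        (congrArg (Equiv.sumCongr (Equiv.sigmaCongrRight (fun _ => 1)) (Equiv.refl _))
          (corollaWire_inl m n w (s j))).symm
    · rfl
  have key : ∀ (w w' : Wiring (fun _ : Fin 1 => m) (fun _ => n) m n) (hp : IsProper w)
      (hp' : IsProper w'), w = w' →
      (⟨⟨1, _, _, w, hp⟩, fun _ => i, Fin.sum_univ_one _, fun _ => x⟩ : DecGraph E m n i) =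
        ⟨⟨1, _, _, w', hp'⟩, fun _ => i, Fin.sum_univ_one _, fun _ => x⟩ := by
    rintro _ _ _ _ rfl
    rfl
  have h : (DecGraph.corolla x).legs s 1 =
      (DecGraph.corolla x).relabel (fun _ => s) (fun _ => 1) :=
    key _ _ ((Graph.corolla m n).legs s 1).proper
      ((Graph.corolla m n).relabel (fun _ => s) (fun _ => 1)).proper hw
  refine (congrArg cls h).trans ((cls_relabel _ _ _).trans (congrArg cls ?_))
  have : E.inn m n i (MulOpposite.op 1) x = x := by
    rw [MulOpposite.op_one, map_one]
    rfl
  exact congrArg (fun z => (⟨Graph.corolla m n, fun _ => i, Fin.sum_univ_one _,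
    fun _ => E.out m n i s z⟩ : DecGraph E m n i)) this

/-- The normal form behind uniqueness and freeness. When the graph is not inputless, it has a vertex
with an incoming flag, whose decoration is zero: an input leg must run into such a flag. -/
theorem cls_eq_corolla_val (hE : E.NoInputs) (D : DecGraph E m n i) :
    cls D = cls (DecGraph.corolla D.val) := by
  by_cases h : D.Inputless
  · obtain ⟨x, s, rfl⟩ := h.eq_legs
    rw [cls_legs_corolla, DecGraph.val_legs hE, DecGraph.val_corolla hE, E.inn_eq_self h.1]
  · rw [DecGraph.val_of_not h, cls_corolla_zero]
    by_cases hq : ∀ v, D.G.q v = 0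
    · have hn : n ≠ 0 := fun hn => h ⟨hn, hq⟩
      rcases h : D.G.wire (Sum.inr ⟨0, Nat.pos_of_ne_zero hn⟩) with ⟨w, j⟩ | j
      · rw [hq] at j
        exact j.elim0
      · exact absurd h (D.G.proper.legs _ _)
    · push Not at hq
      obtain ⟨v, hv⟩ := hq
      have := hE (D.G.p v) _ (D.deg v) hv
      exact cls_eq_zero D v (Subsingleton.elim _ _)

theorem ProperadStr.μ_cls (hE : E.NoInputs) (S : ProperadStr E) (D : DecGraph E m n i) :
    S.μ m n i (cls D) = D.val := by
  rw [cls_eq_corolla_val hE, S.corolla]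

/-- The inverse sends an element to the corolla decorated by it. -/
theorem contract_bijective (hE : E.NoInputs) (m n : ℕ) (i : ℤ) :
    Function.Bijective (contract E m n i) := by
  constructor
  · rw [← LinearMap.ker_eq_bot, Submodule.eq_bot_iff]
    have key : ∀ z : FreeMod E m n i, z = cls (DecGraph.corolla (contract E m n i z)) := by
      intro z
      obtain ⟨r, rfl⟩ := Submodule.Quotient.mk_surjective _ z
      induction r using Finsupp.induction_linear with
      | zero =>
        rw [Submodule.Quotient.mk_zero, map_zero, cls_corolla_zero]
      | add f g hf hg =>
        rw [Submodule.Quotient.mk_add, map_add, cls_corolla_add, ← hf, ← hg]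
      | single D c =>
        have h : (Submodule.Quotient.mk (Finsupp.single D c) : FreeMod E m n i) = c • cls D := by
          rw [cls, ← Submodule.Quotient.mk_smul, Finsupp.smul_single, smul_eq_mul, mul_one]
        rw [h, map_smul, cls_corolla_smul, contract_cls, ← cls_eq_corolla_val hE]
    intro z hz
    rw [key z, LinearMap.mem_ker.1 hz, cls_corolla_zero]
  · intro x
    exact ⟨cls (DecGraph.corolla x), by rw [contract_cls, DecGraph.val_corolla hE]⟩

theorem DecGraph.map_corolla {F : SBimodule K} (f : Hom E F) (x : E.X m n i) :
    (DecGraph.corolla x).map f = DecGraph.corolla (f.f m n i x) := rfl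

theorem FreeMod.map_cls {F : SBimodule K} (f : Hom E F) (D : DecGraph E m n i) :
    FreeMod.map f m n i (cls D) = cls (D.map f) := by
  simp [FreeMod.map, cls]

/-- A properad is free on a bimodule without inputs if and only if it coincides with it. -/
theorem ProperadStr.isFree_iff {P : SBimodule K} (hE : E.NoInputs) (S : ProperadStr P)
    (ι : Hom E P) : S.IsFree ι ↔ ∀ m n i, Function.Bijective (ι.f m n i) := by
  have key : ∀ m n i (z : FreeMod E m n i),
      S.μ m n i (FreeMod.map ι m n i z) = ι.f m n i (contract E m n i z) := by
    intro m n i z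
    obtain ⟨r, rfl⟩ := Submodule.Quotient.mk_surjective _ z
    induction r using Finsupp.induction_linear with
    | zero => simp
    | add f g hf hg => simp only [Submodule.Quotient.mk_add, map_add, hf, hg]
    | single D c =>
      have h : (Submodule.Quotient.mk (Finsupp.single D c) : FreeMod E m n i) = c • cls D := by
        rw [cls, ← Submodule.Quotient.mk_smul, Finsupp.smul_single, smul_eq_mul, mul_one]
      rw [h]
      simp only [map_smul]
      rw [cls_eq_corolla_val hE, FreeMod.map_cls, DecGraph.map_corolla, S.corolla, contract_cls,
        DecGraph.val_corolla hE]
  unfold ProperadStr.IsFree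
  refine forall_congr' fun m => forall_congr' fun n => forall_congr' fun i => ?_
  have h2 : (fun z => S.μ m n i (FreeMod.map ι m n i z)) =
      ι.f m n i ∘ contract E m n i := funext (key m n i)
  rw [h2]
  exact Function.Bijective.of_comp_iff _ (contract_bijective hE m n i)

/-- The signed sum has one term, with sign `1` because no vertex precedes the only one; the identity
is then the equivariance of the differential. -/
theorem DecGraph.d_val {d : Differential E} {j : ℤ} (h : i + 1 = j) (D : DecGraph E m n i) :
    d.d m n i j h D.val =
      ∑ v, (((Int.negOnePow (∑ w ∈ Finset.univ.filter (· < v), D.deg w) : ℤˣ) : ℤ) : K) •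
        (D.diffAt d h v).val := by
  by_cases hD : D.Inputless
  · obtain ⟨v⟩ := D.G.proper.nonempty
    obtain ⟨hp, s, hs⟩ := D.G.exists_perm hD.1 hD.2 v
    have hv := D.G.eq_of_no_inputs hD.2
    rw [Finset.sum_eq_single v (fun w _ hw => absurd (hv w v) hw)
      (fun h => absurd (Finset.mem_univ v) h)]
    have h1 : Finset.univ.filter (· < v) = ∅ := by
      ext w
      simp [hv w v]
    have hD' : (D.diffAt d h v).Inputless := hD
    rw [h1, DecGraph.val_eq hD v hp s hs, d.d_out]
    simp only [Finset.sum_empty, Int.negOnePow_zero, Units.val_one, Int.cast_one, one_smul]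
    rw [DecGraph.val_eq hD' v hp s hs]
    congr 1
    have h2 : (D.diffAt d h v).dec v = d.d _ _ (D.deg v) _ (by simp [DecGraph.diffAt])
        (D.dec v) := by
      exact dif_pos rfl
    rw [h2]
    exact d.d_transport _ _ _ _ _ _ _
  · have h' : ∀ v, ¬ (D.diffAt d h v).Inputless := fun _ => hD
    simp [DecGraph.val_of_not hD, DecGraph.val_of_not (h' _)]

/-- A differential on a bimodule without inputs makes it a dg properad. -/
noncomputable def SBimodule.NoInputs.dgProperad (hE : E.NoInputs) (d : Differential E) :
    DGProperad K where
  mod := E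
  str := hE.str
  diff := d
  leibniz := fun h D => by
    simp only [ProperadStr.μ_cls hE]
    exact D.d_val h

theorem cohomology_noInputs (hE : E.NoInputs) (d : Differential E) :
    (cohomology d).NoInputs := by
  intro m n i hn
  have := hE m n i hn
  exact (Submodule.Quotient.mk_surjective _ : Function.Surjective
    (Submodule.Quotient.mk : cocycles d m n i → CohomMod d m n i)).subsingleton

/-- Contraction is a transport followed by a permutation, and both commute with passing to
cohomology classes. -/
theorem DGProperad.isInduced_str (P : DGProperad K) (hP : P.mod.NoInputs) :
    P.IsInduced (cohomology_noInputs hP P.diff).str := by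
  intro m n i D hD
  rw [ProperadStr.μ_cls (cohomology_noInputs hP P.diff), ProperadStr.μ_cls hP]
  by_cases h : D.Inputless
  · obtain ⟨v⟩ := D.G.proper.nonempty
    obtain ⟨hp, s, hs⟩ := D.G.exists_perm h.1 h.2 v
    have key : ∀ {a b : ℕ} {j : ℤ} (ha : a = m) (hb : b = n) (hj : j = i) (x : P.mod.X a b j)
        (hx : x ∈ cocycles P.diff a b j),
        ∃ h' : P.mod.transport ha hb hj x ∈ cocycles P.diff m n i,
          (cohomology P.diff).transport ha hb hj (cohomClass P.diff x hx) =
            cohomClass P.diff _ h' := by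
      intro a b j ha hb hj x hx
      subst ha hb hj
      exact ⟨hx, rfl⟩
    obtain ⟨h', e⟩ := key hp (h.q_eq v) (h.deg_eq v) (D.dec v) (hD v)
    rw [DecGraph.val_eq h v hp s hs]
    refine ⟨out_cocycles _ _ _ h', ?_⟩
    refine (DecGraph.val_eq (D := D.classes P.diff hD) h v hp s hs).trans ?_
    refine (congrArg _ e).trans ?_
    rfl
  · have h' : ¬ (D.classes P.diff hD).Inputless := h
    rw [DecGraph.val_of_not h, DecGraph.val_of_not h']
    exact ⟨Submodule.zero_mem _, rfl⟩

end NoInputs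

/-! ## Signs of ordered partitions -/

section Signs

/-- Folding a product onto the pairs with `x < y` allows sign products indexed by different
orderings to be compared factor by factor. -/
theorem prod_pairs {m : ℕ} {M : Type*} [CommMonoid M] (F : Fin m × Fin m → M) :
    ∏ p, F p = ∏ p : Fin m × Fin m,
      if p.1 < p.2 then F p * F p.swap else if p.1 = p.2 then F p else 1 := by
  have h1 : ∀ p : Fin m × Fin m, F p = (if p.1 < p.2 then F p else 1) *
      (if p.2 < p.1 then F p else 1) * (if p.1 = p.2 then F p else 1) := by
    rintro ⟨x, y⟩
    rcases lt_trichotomy x y with h | h | h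
    · simp [h, h.not_gt, h.ne]
    · simp [h]
    · simp [h, h.not_gt, h.ne']
  have h2 : ∏ p : Fin m × Fin m, (if p.2 < p.1 then F p else 1) =
      ∏ p : Fin m × Fin m, if p.1 < p.2 then F p.swap else 1 :=
    (Equiv.prod_comp (Equiv.prodComm _ _) _).symm
  rw [Finset.prod_congr rfl (fun p _ => h1 p), Finset.prod_mul_distrib, Finset.prod_mul_distrib,
    h2, ← Finset.prod_mul_distrib, ← Finset.prod_mul_distrib]
  refine Finset.prod_congr rfl fun p _ => ?_
  rcases lt_trichotomy p.1 p.2 with h | h | h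
  · simp [h, h.ne]
  · simp [h]
  · simp [h.not_gt, h.ne']

/-- The number of inversions of a function. -/
def inversions {m : ℕ} (f : Fin m → ℕ) : ℕ :=
  (Finset.univ.filter (fun p : Fin m × Fin m => p.1 < p.2 ∧ f p.2 < f p.1)).card

theorem neg_one_pow_inversions {m : ℕ} (f : Fin m → ℕ) : (-1 : ℤˣ) ^ inversions f =
    ∏ p : Fin m × Fin m, if p.1 < p.2 ∧ f p.2 < f p.1 then -1 else 1 := by
  rw [← Finset.prod_filter, Finset.prod_const]
  rfl

theorem sign_eq_prod_pairs {m : ℕ} (s : Equiv.Perm (Fin m)) : Equiv.Perm.sign s =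
    ∏ p : Fin m × Fin m, if p.1 < p.2 ∧ s p.2 < s p.1 then -1 else 1 := by
  rw [Equiv.Perm.sign_eq_prod_prod_Ioi, Fintype.prod_prod_type]
  refine Finset.prod_congr rfl fun x _ => ?_
  have : Finset.Ioi x = Finset.univ.filter (x < ·) := by
    ext
    simp
  rw [this, Finset.prod_filter]
  refine Finset.prod_congr rfl fun y _ => ?_
  by_cases h : x < y
  · have hne : s x ≠ s y := fun h' => h.ne (s.injective h')
    rcases lt_or_gt_of_ne hne with h' | h'
    · simp [h, h', h'.not_gt]
    · simp [h, h', h'.not_gt]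
  · simp [h]

/-- A pair in two different blocks changes its status as an inversion exactly when `s` reverses it.
The left side thus counts the reversed pairs in different blocks; the right side counts all reversed
pairs and removes those within a block. -/
theorem inversions_comp_symm {m : ℕ} {k : ℕ} (s : Equiv.Perm (Fin m)) (f : Fin m → Fin k) :
    (-1 : ℤˣ) ^ inversions (fun x => (f (s.symm x) : ℕ)) * (-1) ^ inversions (fun x => (f x : ℕ)) =
      Equiv.Perm.sign s * blockSign s f := by
  have h1 : (-1 : ℤˣ) ^ inversions (fun x => (f (s.symm x) : ℕ)) =
      ∏ p : Fin m × Fin m, if s p.1 < s p.2 ∧ f p.2 < f p.1 then -1 else 1 := by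
    rw [neg_one_pow_inversions, ← Equiv.prod_comp (Equiv.prodCongr s s)]
    simp
  rw [h1, prod_pairs, neg_one_pow_inversions, sign_eq_prod_pairs, blockSign,
    ← Finset.prod_mul_distrib, ← Finset.prod_mul_distrib]
  refine Finset.prod_congr rfl fun ⟨x, y⟩ _ => ?_
  dsimp only [Prod.swap]
  rcases lt_trichotomy x y with h | h | h
  · have hne : s x ≠ s y := fun h' => h.ne (s.injective h')
    rcases lt_or_gt_of_ne hne with h' | h' <;> rcases lt_trichotomy (f x) (f y) with h2 | h2 | h2 <;>
      first
      | simp [h, h', h'.not_gt, h2, h2.not_gt, h2.ne, h2.ne']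
      | simp [h, h', h'.not_gt, h2]
  · simp [h]
  · simp [h.not_gt, h.ne']

/-- Merging the blocks number `a` and `a + 1`. -/
def mergeNat (a n : ℕ) : ℕ := if n ≤ a then n else n - 1

/-- The codegeneracy identity, from which the vanishing of the squared differential comes. -/
theorem mergeNat_comm {a b : ℕ} (h : a ≤ b) (n : ℕ) :
    mergeNat b (mergeNat a n) = mergeNat a (mergeNat (b + 1) n) := by
  unfold mergeNat
  grind

theorem predAbove_val {k : ℕ} (a : Fin k) (y : Fin (k + 1)) :
    ((a.predAbove y : Fin k) : ℕ) = mergeNat a y := by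
  unfold mergeNat
  split_ifs with h
  · rw [Fin.predAbove_of_le_castSucc _ _ (by simpa [Fin.le_def] using h)]
    rfl
  · rw [Fin.predAbove_of_castSucc_lt _ _ (by simpa [Fin.lt_def] using h)]
    rfl

/-- The exponent of the sign comparing a corolla with the orientation of the corresponding cell by
the characteristic vectors of its blocks. -/
def orientExponent {m : ℕ} (k : ℕ) (f : Fin m → ℕ) : ℕ :=
  (∑ x, (k + 1 + f x)) + (∑ j ∈ Finset.range (k - 1), j) + inversions f

/-- Merging two consecutive blocks destroys precisely the inversions between them; these are the
inversions of the shuffle in the boundary formula. -/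
theorem inversions_mergeNat {m : ℕ} (a : ℕ) (g : Fin m → ℕ) : inversions g =
    inversions (fun x => mergeNat a (g x)) + (Finset.univ.filter
      (fun x : Fin m × Fin m => g x.1 = a ∧ g x.2 = a + 1 ∧ x.2 < x.1)).card := by
  have h1 : (Finset.univ.filter
      (fun x : Fin m × Fin m => g x.1 = a ∧ g x.2 = a + 1 ∧ x.2 < x.1)).card =
      (Finset.univ.filter
      (fun x : Fin m × Fin m => g x.2 = a ∧ g x.1 = a + 1 ∧ x.1 < x.2)).card := by
    refine Finset.card_equiv (Equiv.prodComm _ _) ?_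
    simp
  rw [h1, inversions, inversions, ← Finset.card_union_of_disjoint]
  · congr 1
    ext ⟨x, y⟩
    simp only [Finset.mem_filter, Finset.mem_univ, true_and, Finset.mem_union, mergeNat]
    grind
  · rw [Finset.disjoint_left]
    rintro ⟨x, y⟩
    simp only [Finset.mem_filter, Finset.mem_univ, true_and, mergeNat]
    grind

/-- This parity dictates the form of `orientExponent`. Under the merge, its first sum changes by the
number of elements in blocks up to `a`, its triangular sum by `k - 1`, and its inversions by those
of the split. Together they turn the exponent of the boundary formula into `k + 1 + a`. -/
theorem even_orientExponent {m k : ℕ} (a : Fin k) (g : Fin m → Fin (k + 1)) :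
    Even (orientExponent (k + 1) (fun x => (g x : ℕ)) + splitExponent a g + (k + 1 + a) +
      orientExponent k (fun x => mergeNat a (g x))) := by
  have h1 := inversions_mergeNat (a : ℕ) (fun x => (g x : ℕ))
  have h2 : Even ((∑ x, (k + 1 + 1 + (g x : ℕ))) + (∑ x, (k + 1 + mergeNat a (g x))) +
      (Finset.univ.filter (fun x => g x ≤ a.castSucc)).card) := by
    rw [Finset.card_filter, ← Finset.sum_add_distrib, ← Finset.sum_add_distrib]
    refine Finset.even_sum _ fun x _ => ?_
    simp only [Fin.le_def, Fin.val_castSucc, mergeNat, Nat.even_iff]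
    split_ifs <;> omega
  obtain ⟨k, rfl⟩ : ∃ l, k = l + 1 := ⟨k - 1, by have := a.pos; omega⟩
  have h3 : ∑ j ∈ Finset.range (k + 1 + 1 - 1), j = (∑ j ∈ Finset.range (k + 1 - 1), j) + k :=
    Finset.sum_range_succ _ _
  have h4 : (Finset.univ.filter (fun x : Fin m × Fin m =>
      g x.1 = a.castSucc ∧ g x.2 = a.succ ∧ x.2 < x.1)).card = (Finset.univ.filter
      (fun x : Fin m × Fin m => (g x.1 : ℕ) = a ∧ (g x.2 : ℕ) = a + 1 ∧ x.2 < x.1)).card := by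
    simp [Fin.ext_iff]
  unfold orientExponent splitExponent
  rw [h4]
  beta_reduce at h1 ⊢
  rw [Nat.even_iff] at h2 ⊢
  omega

end Signs

/-! ### Ordered partitions as functions to the natural numbers -/

namespace PermCell

/-- The function sending an element to the number of its block. -/
def nat {m n : ℕ} {i : ℤ} (c : PermCell m n i) (x : Fin m) : ℕ := c.f x

theorem k_eq {m n : ℕ} {i : ℤ} (c c' : PermCell m n i) : c.k = c'.k := by
  have := c.deg_eq
  have := c'.deg_eq
  omega

theorem nat_injective {m n : ℕ} {i : ℤ} : Function.Injective (nat : PermCell m n i → _) := by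
  intro c c' h
  have hk := c.k_eq c'
  obtain ⟨k, f, _, _, _, _⟩ := c
  obtain ⟨k', f', _, _, _, _⟩ := c'
  dsimp only at hk
  subst hk
  congr
  funext x
  exact Fin.ext (congrFun h x)

instance {m n : ℕ} {i : ℤ} : Finite (PermCell m n i) := by
  refine Finite.of_injective (β := Fin m → Fin (i + m).toNat)
    (fun c x => ⟨c.nat x, ?_⟩) fun c c' h => nat_injective (funext fun x => ?_)
  · have := c.deg_eq
    have := (c.f x).2
    unfold nat
    omega
  · exact congrArg Fin.val (congrFun h x)

noncomputable instance {m n : ℕ} {i : ℤ} : Fintype (PermCell m n i) := Fintype.ofFinite _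

theorem nat_act {m n : ℕ} {i : ℤ} (c : PermCell m n i) (s : Equiv.Perm (Fin m)) :
    (c.act s).nat = c.nat ∘ s.symm := rfl

/-- Merging two consecutive blocks of an ordered partition. -/
def merge {m : ℕ} {i j : ℤ} (h : i + 1 = j) (c : PermCell m 0 j) {a : ℕ} (ha : a < c.k - 1) :
    PermCell m 0 i where
  k := c.k - 1
  f := fun x => ⟨mergeNat a (c.f x), by
    have := (c.f x).2
    unfold mergeNat
    split_ifs <;> omega⟩
  surj := by
    rintro ⟨y, hy⟩
    obtain ⟨x, hx⟩ := c.surj ⟨if y ≤ a then y else y + 1, by split_ifs <;> omega⟩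
    refine ⟨x, ?_⟩
    ext
    simp only [hx, mergeNat]
    split_ifs <;> omega
  one_le := by omega
  no_input := rfl
  deg_eq := by
    have := c.deg_eq
    omega

theorem nat_merge {m : ℕ} {i j : ℤ} (h : i + 1 = j) (c : PermCell m 0 j) {a : ℕ}
    (ha : a < c.k - 1) : (c.merge h ha).nat = mergeNat a ∘ c.nat := rfl

variable {K : Type u} [Field K]

variable (K) in
/-- The sign comparing a corolla with the orientation of the corresponding cell by the
characteristic vectors of its blocks. -/
def theta {m n : ℕ} {i : ℤ} (c : PermCell m n i) : K := (-1) ^ orientExponent c.k c.nat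

theorem theta_mul_self {m n : ℕ} {i : ℤ} (c : PermCell m n i) : c.theta K * c.theta K = 1 := by
  rw [theta, ← mul_pow]
  simp

theorem theta_ne_zero {m n : ℕ} {i : ℤ} (c : PermCell m n i) : c.theta K ≠ 0 :=
  left_ne_zero_of_mul_eq_one c.theta_mul_self

/-- Only the inversions in the exponent change under relabelling, so `inversions_comp_symm` trades
the sign inside the blocks for the signature of `s`. -/
theorem theta_act {m n : ℕ} {i : ℤ} (c : PermCell m n i) (s : Equiv.Perm (Fin m)) :
    (c.act s).theta K * ((blockSign s c.f : ℤˣ) : ℤ) =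
      ((Equiv.Perm.sign s : ℤˣ) : ℤ) * c.theta K := by
  have h1 : ∑ x, ((c.act s).k + 1 + (c.act s).nat x) = ∑ x, (c.k + 1 + c.nat x) :=
    Equiv.sum_comp s.symm (fun x => c.k + 1 + c.nat x)
  have h2 : (c.act s).theta K * c.theta K =
      (((-1 : ℤˣ) ^ inversions (c.act s).nat * (-1) ^ inversions c.nat : ℤˣ) : ℤ) := by
    have e1 : ∀ a b c : ℕ, (-1 : K) ^ (a + b + c) = (-1) ^ (a + b) * (-1) ^ c :=
      fun a b c => pow_add _ _ _
    have e2 : ∀ a : ℕ, (-1 : K) ^ a * (-1) ^ a = 1 := fun a => by rw [← mul_pow]; simp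
    rw [theta, theta, orientExponent, orientExponent, h1, e1, e1, mul_mul_mul_comm]
    have e3 : (c.act s).k = c.k := rfl
    rw [e3, e2]
    push_cast
    rw [one_mul]
  have h3 := inversions_comp_symm s c.f
  have h4 : ((blockSign s c.f : ℤˣ) : K) * ((blockSign s c.f : ℤˣ) : ℤ) = 1 := by
    rw [← Int.cast_mul, ← Units.val_mul, Int.units_mul_self]
    simp
  have h5 : (c.act s).theta K * c.theta K =
      ((Equiv.Perm.sign s : ℤˣ) : ℤ) * ((blockSign s c.f : ℤˣ) : ℤ) := by
    rw [h2, ← Int.cast_mul, ← Units.val_mul, ← h3]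
    rfl
  -- All factors are square roots of `1`, so `h5` can be solved for the required product.
  linear_combination ((blockSign s c.f : ℤˣ) : ℤ) * c.theta K * h5 +
    ((Equiv.Perm.sign s : ℤˣ) : ℤ) * c.theta K * h4 -
    (c.act s).theta K * ((blockSign s c.f : ℤˣ) : ℤ) * c.theta_mul_self (K := K)

end PermCell

/-! ## The differential in the orientation basis -/

section Coordinates

variable {K : Type u} [Field K] {m : ℕ} {i j : ℤ}

theorem W_noInputs : (W K).NoInputs := by
  intro m n i hn
  have : IsEmpty (PermCell m n i) := ⟨fun c => hn c.no_input⟩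
  exact inferInstanceAs (Subsingleton (PermCell m n i →₀ K))

/-- The elements of `W(m,n)` as linear combinations of corollas. -/
def wCoeff {n : ℕ} (x : (W K).X m n i) : PermCell m n i →₀ K := x

/-- The coefficients of the elements of `W(m,0)` with respect to the corollas with the signs
`PermCell.theta`, as functions of the block numbers, extended by zero. -/
noncomputable def coords : (W K).X m 0 i →ₗ[K] ((Fin m → ℕ) → K) where
  toFun x := Function.extend PermCell.nat
    (fun c => c.theta K * wCoeff x c) 0
  map_add' x y := by
    funext f
    by_cases hf : ∃ c : PermCell m 0 i, c.nat = f
    · obtain ⟨c, rfl⟩ := hf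
      rw [Pi.add_apply, PermCell.nat_injective.extend_apply,
        PermCell.nat_injective.extend_apply, PermCell.nat_injective.extend_apply]
      exact mul_add _ _ _
    · rw [Pi.add_apply, Function.extend_apply' _ _ _ hf, Function.extend_apply' _ _ _ hf,
        Function.extend_apply' _ _ _ hf]
      simp
  map_smul' r x := by
    funext f
    by_cases hf : ∃ c : PermCell m 0 i, c.nat = f
    · obtain ⟨c, rfl⟩ := hf
      rw [RingHom.id_apply, Pi.smul_apply, PermCell.nat_injective.extend_apply,
        PermCell.nat_injective.extend_apply]
      exact mul_left_comm _ _ _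
    · rw [RingHom.id_apply, Pi.smul_apply, Function.extend_apply' _ _ _ hf,
        Function.extend_apply' _ _ _ hf]
      simp

theorem coords_nat (x : (W K).X m 0 i) (c : PermCell m 0 i) :
    coords x c.nat = c.theta K * wCoeff x c :=
  PermCell.nat_injective.extend_apply (fun c => c.theta K * wCoeff x c) 0 c

theorem coords_of_not (x : (W K).X m 0 i) {f : Fin m → ℕ}
    (hf : ¬ ∃ c : PermCell m 0 i, c.nat = f) : coords x f = 0 :=
  Function.extend_apply' (fun c : PermCell m 0 i => c.theta K * wCoeff x c)
    (0 : (Fin m → ℕ) → K) f hf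

theorem coords_ext {x y : (W K).X m 0 i} (h : ∀ c : PermCell m 0 i,
    coords x c.nat = coords y c.nat) : x = y := by
  refine Finsupp.ext fun c => ?_
  have := h c
  rw [coords_nat, coords_nat] at this
  exact mul_left_cancel₀ c.theta_ne_zero this

open Classical in
theorem coords_corollaW (c : PermCell m 0 i) (f : Fin m → ℕ) :
    coords (corollaW K c) f = if f = c.nat then c.theta K else 0 := by
  by_cases hf : ∃ c : PermCell m 0 i, c.nat = f
  · obtain ⟨c', rfl⟩ := hf
    rw [coords_nat]
    change c'.theta K * (Finsupp.single c 1 : PermCell m 0 i →₀ K) c' = _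
    rw [Finsupp.single_apply]
    by_cases h : c = c'
    · simp [h]
    · simp [h, PermCell.nat_injective.eq_iff, Ne.symm h]
  · rw [coords_of_not _ hf, if_neg]
    rintro rfl
    exact hf ⟨c, rfl⟩

theorem corollaW_induction {p : (W K).X m 0 i → Prop} (h0 : p 0)
    (hadd : ∀ x y, p x → p y → p (x + y)) (hc : ∀ (r : K) c, p (r • corollaW K c)) (x) : p x := by
  refine Finsupp.induction_linear (motive := p) x h0 hadd fun c r => ?_
  have h : (Finsupp.single c r : PermCell m 0 i →₀ K) = r • Finsupp.single c 1 := by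
    rw [Finsupp.smul_single, smul_eq_mul, mul_one]
  exact h ▸ hc r c

theorem out_corollaW (s : Equiv.Perm (Fin m)) (c : PermCell m 0 i) :
    (W K).out m 0 i s (corollaW K c) =
      (((blockSign s c.f : ℤˣ) : ℤ) : K) • corollaW K (c.act s) := by
  change Finsupp.lift (PermCell m 0 i →₀ K) K (PermCell m 0 i) (fun c =>
    Finsupp.single (c.act s) (((blockSign s c.f : ℤˣ) : ℤ) : K)) (Finsupp.single c 1) =
      _ • Finsupp.single (c.act s) 1
  rw [Finsupp.lift_apply, Finsupp.sum_single_index (by simp), one_smul]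
  have h : ∀ (c : PermCell m 0 i) (r : K), Finsupp.single c r = r • Finsupp.single c (1 : K) := by
    intro c r
    rw [Finsupp.smul_single, smul_eq_mul, mul_one]
  exact h _ _

theorem coords_out (s : Equiv.Perm (Fin m)) (x : (W K).X m 0 i) (f : Fin m → ℕ) :
    coords ((W K).out m 0 i s x) f = ((Equiv.Perm.sign s : ℤˣ) : ℤ) * coords x (f ∘ s) := by
  induction x using corollaW_induction with
  | h0 => simp
  | hadd x y hx hy => simp only [map_add, Pi.add_apply, hx, hy, mul_add]
  | hc r c =>
    simp only [map_smul, Pi.smul_apply, out_corollaW, coords_corollaW, PermCell.nat_act,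
      smul_eq_mul]
    have h : f = c.nat ∘ s.symm ↔ f ∘ s = c.nat := (Equiv.eq_comp_symm s _ _)
    simp only [h]
    split_ifs
    · have := c.theta_act (K := K) s
      linear_combination r * this
    · simp

-- A splitting of block `a` of `c` that yields `g` exists exactly when merging the blocks `a` and `a
-- + 1` of `g` yields `c`, and it is then unique. The inner sum therefore has at most one term,
-- whose sign is given by `even_orientExponent`.
open Classical in
theorem coords_permBoundary (h : i + 1 = j) (c : PermCell m 0 i) (g : PermCell m 0 j) :
    coords (permBoundary K h c) g.nat = ∑ a ∈ Finset.range (g.k - 1),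
      (-1) ^ (g.k + a) * coords (corollaW K c) (mergeNat a ∘ g.nat) := by
  have hk : g.k = c.k + 1 := by
    have := g.deg_eq
    have := c.deg_eq
    omega
  have hk' : g.k - 1 = c.k := by omega
  rw [hk', Finset.sum_range, permBoundary]
  simp only [map_sum, map_smul, Finset.sum_apply, Pi.smul_apply, coords_corollaW, smul_eq_mul]
  refine Finset.sum_congr rfl fun a _ => ?_
  by_cases ha : mergeNat a ∘ g.nat = c.nat
  · rw [if_pos ha]
    obtain ⟨g0, hg0⟩ : ∃ g0 : c.Splitting a, (c.split h g0).nat = g.nat := by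
      refine ⟨⟨fun x => Fin.cast hk (g.f x), ?_, fun x => Fin.ext ?_⟩, rfl⟩
      · intro y
        obtain ⟨x, hx⟩ := g.surj (Fin.cast hk.symm y)
        exact ⟨x, congrArg (Fin.cast hk) hx⟩
      · rw [predAbove_val]
        exact congrFun ha x
    rw [Finset.sum_eq_single g0]
    · rw [if_pos hg0.symm]
      have h1 := even_orientExponent a g0.1
      have h2 : orientExponent (c.k + 1) (fun x => (g0.1 x : ℕ)) =
          orientExponent g.k g.nat := by
        rw [hk, ← hg0]
        rfl
      have h3 : (fun x => mergeNat a (g0.1 x)) = c.nat := by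
        rw [← ha, ← hg0]
        rfl
      have h4 : (c.split h g0).theta K = (-1) ^ orientExponent g.k g.nat := by
        rw [← h2]
        rfl
      rw [h4, PermCell.theta, ← pow_add, ← pow_add]
      rw [h2, h3] at h1
      apply neg_one_pow_congr
      rw [Nat.even_iff] at h1
      rw [Nat.even_iff, Nat.even_iff]
      omega
    · intro b _ hb
      rw [if_neg, mul_zero]
      intro hb'
      refine hb (Subtype.ext (funext fun x => Fin.ext ?_))
      exact (congrFun (hb'.symm.trans hg0.symm) x)
    · exact fun h => absurd (Finset.mem_univ _) h
  · rw [if_neg ha, mul_zero]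
    refine Finset.sum_eq_zero fun b _ => ?_
    rw [if_neg, mul_zero]
    intro hb
    refine ha ?_
    rw [hb]
    funext x
    exact (predAbove_val a (b.1 x)).symm.trans (congrArg Fin.val (b.2.2 x))

variable (K) in
/-- The linear extension of the boundary of corollas. -/
noncomputable def permDiff : ∀ (m n : ℕ) (i j : ℤ), i + 1 = j →
    ((W K).X m n i →ₗ[K] (W K).X m n j)
  | m, 0, i, _, h =>
    (Finsupp.linearCombination K (permBoundary K h) : (PermCell m 0 i →₀ K) →ₗ[K] _)
  | _, _ + 1, _, _, _ => 0

theorem permDiff_corollaW (h : i + 1 = j) (c : PermCell m 0 i) :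
    permDiff K m 0 i j h (corollaW K c) = permBoundary K h c :=
  (Finsupp.linearCombination_single K 1 c).trans (one_smul _ _)

theorem coords_permDiff (h : i + 1 = j) (x : (W K).X m 0 i) (g : PermCell m 0 j) :
    coords (permDiff K m 0 i j h x) g.nat = ∑ a ∈ Finset.range (g.k - 1),
      (-1) ^ (g.k + a) * coords x (mergeNat a ∘ g.nat) := by
  induction x using corollaW_induction with
  | h0 => simp
  | hadd x y hx hy =>
    simp only [map_add, Pi.add_apply, hx, hy, mul_add, Finset.sum_add_distrib]
  | hc r c =>
    simp only [map_smul, Pi.smul_apply, permDiff_corollaW, coords_permBoundary,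
      smul_eq_mul, Finset.mul_sum]
    exact Finset.sum_congr rfl fun a _ => mul_left_comm _ _ _

/-- The pair `(a, b)` with `a ≤ b` cancels against `(b + 1, a)`: the double merges agree by
`mergeNat_comm` and the signs are opposite. -/
theorem alternating_merge_eq_zero (k : ℕ) (X : (Fin m → ℕ) → K) (g : Fin m → ℕ) :
    ∑ a ∈ Finset.range (k + 1), ∑ b ∈ Finset.range k,
      (-1) ^ (a + b) * X (mergeNat b ∘ mergeNat a ∘ g) = 0 := by
  rw [← Finset.sum_product']
  refine Finset.sum_involution
    (fun p _ => if p.1 ≤ p.2 then (p.2 + 1, p.1) else (p.2, p.1 - 1)) ?_ ?_ ?_ ?_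
  · rintro ⟨a, b⟩ -
    dsimp only
    split_ifs with h
    · have : mergeNat a ∘ mergeNat (b + 1) ∘ g = mergeNat b ∘ mergeNat a ∘ g :=
        funext fun x => (mergeNat_comm h _).symm
      rw [this]
      ring
    · obtain ⟨a, rfl⟩ : ∃ a', a = a' + 1 := ⟨a - 1, by omega⟩
      have : mergeNat (a + 1 - 1) ∘ mergeNat b ∘ g = mergeNat b ∘ mergeNat (a + 1) ∘ g :=
        funext fun x => mergeNat_comm (by omega) _
      rw [this, Nat.add_sub_cancel]
      ring
  · rintro ⟨a, b⟩ _ _ h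
    dsimp only at h
    split_ifs at h with h'
    · simp only [Prod.mk.injEq] at h
      omega
    · simp only [Prod.mk.injEq] at h
      omega
  · rintro ⟨a, b⟩ h
    simp only [Finset.mem_product, Finset.mem_range] at h
    dsimp only
    split_ifs with h'
    · simp only [Finset.mem_product, Finset.mem_range]
      omega
    · simp only [Finset.mem_product, Finset.mem_range]
      omega
  · rintro ⟨a, b⟩ _
    dsimp only
    by_cases h : a ≤ b
    · simp only [if_pos h, if_neg (show ¬ b + 1 ≤ a by omega), Nat.add_sub_cancel]
    · simp only [if_neg h, if_pos (show b ≤ a - 1 by omega)]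
      rw [Nat.sub_add_cancel (by omega)]

theorem permDiff_permDiff {l : ℤ} (h : i + 1 = j) (h' : j + 1 = l) (x : (W K).X m 0 i) :
    permDiff K m 0 j l h' (permDiff K m 0 i j h x) = 0 := by
  refine coords_ext fun g => ?_
  rw [coords_permDiff]
  have h1 : ∀ a ∈ Finset.range (g.k - 1), (-1) ^ (g.k + a) *
      coords (permDiff K m 0 i j h x) (mergeNat a ∘ g.nat) =
      ∑ b ∈ Finset.range (g.k - 2), - ((-1) ^ (a + b) *
        coords x (mergeNat b ∘ mergeNat a ∘ g.nat)) := by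
    intro a ha
    rw [← PermCell.nat_merge h' g (Finset.mem_range.1 ha), coords_permDiff, Finset.mul_sum]
    have hk : (g.merge h' (Finset.mem_range.1 ha)).k = g.k - 1 := rfl
    rw [hk, Nat.sub_sub]
    refine Finset.sum_congr rfl fun b _ => ?_
    obtain ⟨k, hk⟩ : ∃ k, g.k = k + 1 := ⟨g.k - 1, by have := g.one_le; omega⟩
    rw [PermCell.nat_merge, ← mul_assoc, ← pow_add, hk, ← neg_mul]
    congr 1
    -- The numbers of blocks in the two steps differ by one, so they contribute a global sign `-1`.
    rw [Nat.add_sub_cancel, show k + 1 + a + (k + b) = 2 * k + 1 + (a + b) by ring, pow_add,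
      pow_succ, pow_mul]
    simp
  rw [Finset.sum_congr rfl h1]
  simp only [Finset.sum_neg_distrib, map_zero, Pi.zero_apply, neg_eq_zero]
  -- For a single block the subtraction `g.k - 2` truncates and there is nothing to merge, so this
  -- case is separate.
  rcases Nat.lt_or_ge g.k 2 with hk | hk
  · rw [show g.k - 2 = 0 by omega]
    simp
  · rw [show g.k - 1 = g.k - 2 + 1 by omega]
    exact alternating_merge_eq_zero _ _ _

theorem permDiff_out (h : i + 1 = j) (s : Equiv.Perm (Fin m)) (x : (W K).X m 0 i) :
    permDiff K m 0 i j h ((W K).out m 0 i s x) = (W K).out m 0 j s (permDiff K m 0 i j h x) := by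
  refine coords_ext fun g => ?_
  have h1 : g.nat ∘ s = (g.act s.symm).nat := rfl
  rw [coords_permDiff, coords_out, h1, coords_permDiff, Finset.mul_sum]
  refine Finset.sum_congr rfl fun a _ => ?_
  rw [coords_out, mul_left_comm]
  rfl

variable (K) in
/-- The differential on the corollas. -/
noncomputable def permDifferential : Differential (W K) where
  d := permDiff K
  d_d := by
    intro m n i j l h h' x
    cases n with
    | zero => exact permDiff_permDiff h h' x
    | succ n => rfl
  d_out := by
    intro m n i j h s x
    cases n with
    | zero => exact permDiff_out h s x
    | succ n => exact (map_zero _).symm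
  d_inn := by
    intro m n i j h t x
    cases n with
    | zero => rfl
    | succ n => rfl

/-- The identity of a bimodule. -/
def Hom.id (E : SBimodule K) : Hom E E where
  f := fun _ _ _ => LinearMap.id
  map_out := fun _ _ _ _ _ => rfl
  map_inn := fun _ _ _ _ _ => rfl

theorem exists_permProperad :
    ∃ (P : DGProperad K) (ι : Hom (W K) P.mod), P.str.IsFree ι ∧ P.HasPermDifferential ι := by
  refine ⟨W_noInputs.dgProperad (permDifferential K), Hom.id (W K), ?_, ?_⟩
  · exact (ProperadStr.isFree_iff W_noInputs _ _).2 fun m n i => Function.bijective_id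
  · intro m i j h c
    exact permDiff_corollaW h c

theorem DGProperad.HasPermDifferential.d_eq {P : DGProperad K} {ι : Hom (W K) P.mod}
    (hd : P.HasPermDifferential ι) (h : i + 1 = j) (x : (W K).X m 0 i) :
    P.diff.d m 0 i j h (ι.f m 0 i x) = ι.f m 0 j (permDiff K m 0 i j h x) := by
  induction x using corollaW_induction with
  | h0 => simp
  | hadd x y hx hy => simp only [map_add, hx, hy]
  | hc r c => simp only [map_smul, hd m i j h c, permDiff_corollaW]

end Coordinates

/-! ## Acyclicity of the complex of ordered partitions -/

section Acyclicity

variable {K : Type u} [Field K] {m : ℕ}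

/-- The function `f` takes precisely the values `0, …, k - 1`. -/
def IsSur (k : ℕ) (f : Fin m → ℕ) : Prop := ∀ j, j < k ↔ ∃ x, f x = j

theorem IsSur.lt {k : ℕ} {f : Fin m → ℕ} (h : IsSur k f) (x : Fin m) : f x < k :=
  (h _).2 ⟨x, rfl⟩

theorem IsSur.merge {k a : ℕ} {f : Fin m → ℕ} (h : IsSur (k + 1) f) (ha : a < k) :
    IsSur k (mergeNat a ∘ f) := by
  intro j
  constructor
  · intro hj
    obtain ⟨x, hx⟩ := (h (if j ≤ a then j else j + 1)).1 (by split_ifs <;> omega)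
    refine ⟨x, ?_⟩
    simp only [Function.comp_apply, hx, mergeNat]
    split_ifs <;> omega
  · rintro ⟨x, rfl⟩
    have := h.lt x
    simp only [Function.comp_apply, mergeNat]
    split_ifs <;> omega

/-- The coboundary operator on functions of ordered partitions, evaluated at an ordered partition
with `k + 1` blocks. -/
def cobound (k : ℕ) (y : (Fin m → ℕ) → K) (f : Fin m → ℕ) : K :=
  ∑ a ∈ Finset.range k, (-1) ^ a * y (mergeNat a ∘ f)

theorem cobound_add (k : ℕ) (y z : (Fin m → ℕ) → K) (f : Fin m → ℕ) :
    cobound k (y + z) f = cobound k y f + cobound k z f := by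
  simp [cobound, mul_add, Finset.sum_add_distrib]

theorem cobound_sub (k : ℕ) (y z : (Fin m → ℕ) → K) (f : Fin m → ℕ) :
    cobound k (y - z) f = cobound k y f - cobound k z f := by
  simp [cobound, mul_sub, Finset.sum_sub_distrib]

theorem cobound_cobound (k : ℕ) (y : (Fin m → ℕ) → K) (f : Fin m → ℕ) :
    cobound (k + 1) (cobound k y) f = 0 := by
  refine Eq.trans ?_ (alternating_merge_eq_zero k y f)
  simp only [cobound, Finset.mul_sum, pow_add, mul_assoc]

/-- The last element forms a block of its own. -/
def Alone (f : Fin (m + 1) → ℕ) : Prop := ∀ x, f x = f (Fin.last m) → x = Fin.last m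

/-- Only the two merges that involve the singleton block of the last element can give it company. -/
theorem Alone.merge {f : Fin (m + 1) → ℕ} (h : Alone f) {a : ℕ} (h1 : a ≠ f (Fin.last m))
    (h2 : a + 1 ≠ f (Fin.last m)) : Alone (mergeNat a ∘ f) := by
  intro x hx
  refine h x ?_
  simp only [Function.comp_apply, mergeNat] at hx
  split_ifs at hx <;> omega

theorem not_alone_merge {f : Fin (m + 1) → ℕ} (h : ¬ Alone f) (a : ℕ) :
    ¬ Alone (mergeNat a ∘ f) :=
  fun h' => h fun x hx => h' x (congrArg (mergeNat a) hx)

theorem IsSur.not_alone_merge_last {k : ℕ} {f : Fin (m + 1) → ℕ} (hf : IsSur k f)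
    (h : f (Fin.last m) + 1 < k) : ¬ Alone (mergeNat (f (Fin.last m)) ∘ f) := by
  intro h'
  obtain ⟨x, hx⟩ := (hf _).1 h
  have := h' x (by simp [mergeNat, hx])
  subst this
  omega

theorem IsSur.not_alone_merge_pred {k a : ℕ} {f : Fin (m + 1) → ℕ} (hf : IsSur k f)
    (h : f (Fin.last m) = a + 1) : ¬ Alone (mergeNat a ∘ f) := by
  intro h'
  obtain ⟨x, hx⟩ := (hf a).1 (by have := hf.lt (Fin.last m); omega)
  have := h' x (by simp [mergeNat, hx, h])
  subst this
  omega

/-- Making the last element a block of its own, just before the remaining elements of its block. -/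
def isolate (f : Fin (m + 1) → ℕ) (x : Fin (m + 1)) : ℕ :=
  if f x < f (Fin.last m) ∨ x = Fin.last m then f x else f x + 1

theorem isolate_last (f : Fin (m + 1) → ℕ) : isolate f (Fin.last m) = f (Fin.last m) := by
  simp [isolate]

theorem alone_isolate (f : Fin (m + 1) → ℕ) : Alone (isolate f) := by
  intro x hx
  by_contra h
  rw [isolate_last] at hx
  simp only [isolate, h, or_false] at hx
  split_ifs at hx <;> omega

/-- With `Alone.isolate_merge` this gives the matching behind acyclicity: isolating the last element
undoes the merge of its singleton block with the next block, and conversely. -/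
theorem merge_isolate (f : Fin (m + 1) → ℕ) :
    mergeNat (f (Fin.last m)) ∘ isolate f = f := by
  funext x
  by_cases h : x = Fin.last m
  · simp [isolate, mergeNat, h]
  · simp only [Function.comp_apply, isolate, h, or_false, mergeNat]
    rcases lt_or_ge (f x) (f (Fin.last m)) with h1 | h1
    · rw [if_pos h1, if_pos h1.le]
    · rw [if_neg h1.not_gt, if_neg (by omega), Nat.add_sub_cancel]

theorem Alone.isolate_merge {f : Fin (m + 1) → ℕ} (h : Alone f) :
    isolate (mergeNat (f (Fin.last m)) ∘ f) = f := by
  funext x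
  by_cases hx : x = Fin.last m
  · simp [isolate, mergeNat, hx]
  · have : f x ≠ f (Fin.last m) := fun h' => hx (h x h')
    simp only [Function.comp_apply, isolate, hx, or_false, mergeNat, le_refl, if_true]
    split_ifs <;> omega

theorem IsSur.isolate {k : ℕ} {f : Fin (m + 1) → ℕ} (hf : IsSur k f) (h : ¬ Alone f) :
    IsSur (k + 1) (isolate f) := by
  intro j
  constructor
  · intro hj
    rcases lt_trichotomy j (f (Fin.last m)) with h1 | h1 | h1
    · obtain ⟨x, hx⟩ := (hf j).1 (h1.trans (hf.lt _))
      exact ⟨x, by simp [PermProp.isolate, hx, h1]⟩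
    · exact ⟨Fin.last m, by rw [isolate_last, h1]⟩
    · obtain ⟨x, hx, hx'⟩ : ∃ x, f x = j - 1 ∧ x ≠ Fin.last m := by
        -- The block just after the isolated element is nonempty because that element was not alone.
        by_cases h2 : j = f (Fin.last m) + 1
        · unfold Alone at h
          push Not at h
          obtain ⟨x, hx, hx'⟩ := h
          exact ⟨x, by omega, hx'⟩
        · obtain ⟨x, hx⟩ := (hf (j - 1)).1 (by omega)
          refine ⟨x, hx, ?_⟩
          rintro rfl
          omega
      refine ⟨x, ?_⟩
      simp only [PermProp.isolate, hx', or_false]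
      split_ifs <;> omega
  · rintro ⟨x, rfl⟩
    have := hf.lt x
    unfold PermProp.isolate
    split_ifs <;> omega

/-- The equations for `y` are triangular. At a partition where the last element is a singleton in
position `p`, the only merge that keeps this element in position `p` and gives it company joins it
to the next block. The values are thus prescribed by induction on the position. -/
theorem exists_cobound_of_alone (k : ℕ) (x : (Fin (m + 1) → ℕ) → K) (j : ℕ) :
    ∃ y : (Fin (m + 1) → ℕ) → K, ∀ f, IsSur (k + 1) f → Alone f → f (Fin.last m) < j →
      f (Fin.last m) < k → x f = cobound k y f := by
  classical
  induction j with
  | zero => exact ⟨0, fun f _ _ h => absurd h (Nat.not_lt_zero _)⟩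
  | succ j ih =>
    obtain ⟨y0, hy0⟩ := ih
    -- The correction is the defect of `y0` at the matched partition; the factor `(-1) ^ j` cancels
    -- the sign of the merge number `j`. Its coboundary does not disturb smaller positions.
    let y1 : (Fin (m + 1) → ℕ) → K := fun g => if ¬ Alone g ∧ g (Fin.last m) = j then
      (-1) ^ j * (x (isolate g) - cobound k y0 (isolate g)) else 0
    refine ⟨y0 + y1, fun f hf ha hj hk => ?_⟩
    rw [cobound_add, ← sub_eq_iff_eq_add']
    have h1 : cobound k y1 f = (-1) ^ f (Fin.last m) *
        y1 (mergeNat (f (Fin.last m)) ∘ f) := by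
      refine Finset.sum_eq_single _ (fun a _ hne => ?_)
        (fun h => absurd (Finset.mem_range.2 hk) h)
      have : ¬ (¬ Alone (mergeNat a ∘ f) ∧ (mergeNat a ∘ f) (Fin.last m) = j) := by
        rintro ⟨h1, h2⟩
        by_cases h : a + 1 = f (Fin.last m)
        · simp only [Function.comp_apply, mergeNat] at h2
          split_ifs at h2 <;> omega
        · exact h1 (ha.merge hne h)
      simp only [y1, if_neg this, mul_zero]
    have h2 : (mergeNat (f (Fin.last m)) ∘ f) (Fin.last m) = f (Fin.last m) := by
      simp [mergeNat]
    have h3 := hf.not_alone_merge_last (by omega)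
    rw [h1]
    by_cases h : f (Fin.last m) = j
    · have h4 : y1 (mergeNat (f (Fin.last m)) ∘ f) = (-1) ^ j * (x f - cobound k y0 f) := by
        simp only [y1]
        rw [if_pos ⟨h3, h2.trans h⟩, ha.isolate_merge]
      rw [h4, h, ← mul_assoc, ← mul_pow]
      simp
    · simp only [y1, h2, h, and_false, if_false, mul_zero]
      rw [hy0 f hf ha (by omega) hk, sub_self]

/-- The cocycle condition is evaluated at `isolate f`. One merge returns `f`, the merge with the
preceding block lowers the position of the last element, and all others leave it a nonfinal
singleton, where `x` vanishes. Induction on the position leaves `x f = 0`. -/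
theorem eq_zero_of_not_alone (k : ℕ) (x : (Fin (m + 1) → ℕ) → K)
    (hx : ∀ g, IsSur (k + 2) g → cobound (k + 1) x g = 0)
    (hx' : ∀ f, IsSur (k + 1) f → Alone f → f (Fin.last m) < k → x f = 0) (j : ℕ) :
    ∀ f, IsSur (k + 1) f → ¬ Alone f → f (Fin.last m) = j → x f = 0 := by
  induction j with
  | zero =>
    intro f hf hn h0
    have h := hx _ (hf.isolate hn)
    have h1 : cobound (k + 1) x (isolate f) = (-1) ^ 0 * x (mergeNat 0 ∘ isolate f) := by
      refine Finset.sum_eq_single _ (fun a ha hne => ?_) (fun h => absurd (by simp) h)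
      rw [Finset.mem_range] at ha
      rw [hx' _ ((hf.isolate hn).merge ha), mul_zero]
      · exact (alone_isolate f).merge (by rw [isolate_last, h0]; exact hne)
          (by rw [isolate_last, h0]; omega)
      · simp only [Function.comp_apply, isolate_last, h0, mergeNat]
        split_ifs <;> omega
    have h2 := merge_isolate f
    rw [h0] at h2
    rw [h1, h2] at h
    simpa using h
  | succ j ih =>
    intro f hf hn h0
    have h := hx _ (hf.isolate hn)
    have hk := hf.lt (Fin.last m)
    have h1 : cobound (k + 1) x (isolate f) =
        (-1) ^ (j + 1) * x (mergeNat (j + 1) ∘ isolate f) := by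
      refine Finset.sum_eq_single _ (fun a ha hne => ?_)
        (fun h => absurd (Finset.mem_range.2 (by omega)) h)
      rw [Finset.mem_range] at ha
      have hs := (hf.isolate hn).merge ha
      -- Merging with the preceding block `j` puts the last element into block `j` in company, which
      -- the induction hypothesis covers.
      by_cases haj : a = j
      · have h3 : (mergeNat a ∘ isolate f) (Fin.last m) = j := by
          simp only [Function.comp_apply, isolate_last, h0, mergeNat]
          split_ifs <;> omega
        rw [ih _ hs ((hf.isolate hn).not_alone_merge_pred (by rw [isolate_last, h0, haj])) h3,
          mul_zero]
      · rw [hx' _ hs, mul_zero]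
        · exact (alone_isolate f).merge (by rw [isolate_last, h0]; exact hne)
            (by rw [isolate_last, h0]; omega)
        · simp only [Function.comp_apply, isolate_last, h0, mergeNat]
          split_ifs <;> omega
    have h2 := merge_isolate f
    rw [h0] at h2
    rw [h1, h2] at h
    simpa using h

theorem isSur_snoc {k : ℕ} {g : Fin m → ℕ} (hg : IsSur k g) :
    IsSur (k + 1) (Fin.snoc (α := fun _ => ℕ) g k : Fin (m + 1) → ℕ) := by
  intro j
  constructor
  · intro hj
    rcases Nat.lt_succ_iff_lt_or_eq.1 hj with h | h
    · obtain ⟨x, hx⟩ := (hg j).1 h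
      exact ⟨x.castSucc, by simp [hx]⟩
    · exact ⟨Fin.last m, by simp [h]⟩
  · rintro ⟨x, rfl⟩
    refine Fin.lastCases ?_ (fun x => ?_) x
    · simp
    · have := hg.lt x
      simp only [Fin.snoc_castSucc]
      omega

theorem merge_snoc (a n : ℕ) (g : Fin m → ℕ) :
    mergeNat a ∘ (Fin.snoc (α := fun _ => ℕ) g n : Fin (m + 1) → ℕ) =
      Fin.snoc (α := fun _ => ℕ) (mergeNat a ∘ g) (mergeNat a n) := by
  funext x
  refine Fin.lastCases ?_ (fun x => ?_) x <;> simp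

/-- A cocycle on ordered partitions is a coboundary away from the ordered partition into the
one-element blocks in their natural order. -/
theorem exists_cobound : ∀ (m k : ℕ) (x : (Fin m → ℕ) → K),
    (∀ g, IsSur (k + 1) g → cobound k x g = 0) →
    ∃ y : (Fin m → ℕ) → K, ∀ f, IsSur k f → (∃ a, f a ≠ a) → x f = cobound (k - 1) y f := by
  classical
  intro m
  induction m with
  | zero => exact fun k x _ => ⟨0, fun f _ ⟨a, _⟩ => a.elim0⟩
  | succ m ih =>
    intro k x hx
    rcases k with _ | k
    · exact ⟨0, fun f hf => absurd (hf.lt (Fin.last m)) (Nat.not_lt_zero _)⟩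
    rw [Nat.add_sub_cancel]
    -- Subtracting this coboundary clears all partitions whose last element is a nonfinal singleton;
    -- the cocycle condition then clears those where it has company.
    obtain ⟨y1, hy1⟩ := exists_cobound_of_alone k x k
    set x2 := x - cobound k y1 with hx2
    have hc : ∀ g, IsSur (k + 2) g → cobound (k + 1) x2 g = 0 := by
      intro g hg
      rw [hx2, cobound_sub, hx g hg, cobound_cobound, sub_zero]
    have ha : ∀ f, IsSur (k + 1) f → Alone f → f (Fin.last m) < k → x2 f = 0 := by
      intro f hf h1 h2
      rw [hx2, Pi.sub_apply, hy1 f hf h1 h2 h2, sub_self]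
    have hna : ∀ f, IsSur (k + 1) f → ¬ Alone f → x2 f = 0 :=
      fun f hf hn => eq_zero_of_not_alone k x2 hc ha _ f hf hn rfl
    -- What remains is supported where the last element is the final block. Deleting it leaves a
    -- cocycle on `m` elements, since the one extra merge, with the final singleton, gives an
    -- element with company and contributes zero.
    obtain ⟨y', hy'⟩ := ih k (fun h => x2 (Fin.snoc (α := fun _ => ℕ) h k)) (by
      intro g hg
      have h := hc _ (isSur_snoc hg)
      rw [cobound, Finset.sum_range_succ, hna, mul_zero, add_zero] at h
      · rw [← h]
        refine Finset.sum_congr rfl fun a ha => ?_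
        rw [Finset.mem_range] at ha
        have h1 : mergeNat a (k + 1) = k := by
          simp only [mergeNat]
          split_ifs <;> omega
        rw [merge_snoc, h1]
      · exact (isSur_snoc hg).merge (by omega)
      · exact (isSur_snoc hg).not_alone_merge_pred (by simp))
    -- The cochain `y'` is extended to partitions into `k` blocks whose final block, number `k - 1`,
    -- is the last element alone.
    let y3 : (Fin (m + 1) → ℕ) → K := fun f =>
      if Alone f ∧ f (Fin.last m) + 1 = k then y' (f ∘ Fin.castSucc) else 0
    refine ⟨y1 + y3, fun f hf hid => ?_⟩
    rw [cobound_add, ← sub_eq_iff_eq_add']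
    change x2 f = _
    by_cases hal : Alone f ∧ f (Fin.last m) = k
    · obtain ⟨hal, hl⟩ := hal
      have hne : ∀ x : Fin m, f x.castSucc ≠ k := by
        intro x hx
        exact (Fin.castSucc_lt_last x).ne (hal _ (hx.trans hl.symm))
      have hs : IsSur k (f ∘ Fin.castSucc) := by
        intro j
        constructor
        · intro hj
          obtain ⟨x, hx⟩ := (hf j).1 (by omega)
          revert hx
          refine Fin.lastCases (fun hx => ?_) (fun x hx => ⟨x, hx⟩) x
          omega
        · rintro ⟨x, rfl⟩
          have h1 := hf.lt x.castSucc
          have h2 := hne x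
          simp only [Function.comp_apply]
          omega
      -- If the restriction were the natural order, surjectivity would force `k = m`, and `f` itself
      -- would be the excluded partition.
      have hid' : ∃ a, (f ∘ Fin.castSucc) a ≠ a := by
        by_contra! h
        obtain ⟨a, ha⟩ := hid
        have hkm : k = m := by
          refine le_antisymm ?_ ?_
          · by_contra hlt
            obtain ⟨x, hx⟩ := (hs m).1 (by omega)
            have := h x
            have := x.2
            omega
          · by_contra hlt
            have h1 := h ⟨k, by omega⟩
            exact hne _ h1
        revert ha
        refine Fin.lastCases ?_ (fun a => ?_) a
        · rw [hl, hkm]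
          simp
        · exact fun ha => ha (h a)
      have h1 := hy' _ hs hid'
      have h2 : (Fin.snoc (α := fun _ => ℕ) (f ∘ Fin.castSucc) k : Fin (m + 1) → ℕ) = f := by
        funext x
        refine Fin.lastCases ?_ (fun x => ?_) x <;> simp [hl]
      rw [h2] at h1
      rw [h1]
      -- For `k = 0` both coboundaries are empty sums, consistently with the truncated `k - 1`.
      rcases k with _ | k
      · rfl
      · rw [Nat.add_sub_cancel, cobound, cobound, Finset.sum_range_succ]
        have h3 : y3 (mergeNat k ∘ f) = 0 :=
          if_neg fun h => hf.not_alone_merge_pred hl h.1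
        rw [h3, mul_zero, add_zero]
        refine Finset.sum_congr rfl fun a ha => ?_
        rw [Finset.mem_range] at ha
        congr 1
        refine (if_pos ⟨hal.merge (by omega) (by omega), ?_⟩).symm
        simp only [Function.comp_apply, mergeNat, hl]
        split_ifs <;> omega
    -- Here both sides vanish: a merge can have the last element as its final singleton, without
    -- involving that block, only if `f` already does.
    · have h1 : x2 f = 0 := by
        by_cases h : Alone f
        · refine ha f hf h ?_
          have h2 := hf.lt (Fin.last m)
          have h3 : f (Fin.last m) ≠ k := fun h' => hal ⟨h, h'⟩
          omega
        · exact hna f hf h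
      rw [h1]
      refine (Finset.sum_eq_zero fun a hak => ?_).symm
      rw [Finset.mem_range] at hak
      refine mul_eq_zero_of_right _ (if_neg ?_)
      rintro ⟨h2, h3⟩
      by_cases h : Alone f
      · have h4 : f (Fin.last m) ≠ k := fun h' => hal ⟨h, h'⟩
        have h5 := hf.lt (Fin.last m)
        by_cases h6 : a = f (Fin.last m)
        · subst h6
          exact hf.not_alone_merge_last (by omega) h2
        · by_cases h7 : a + 1 = f (Fin.last m)
          · exact hf.not_alone_merge_pred h7.symm h2
          · simp only [Function.comp_apply, mergeNat] at h3
            split_ifs at h3 <;> omega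
      · exact not_alone_merge h a h2

end Acyclicity

/-! ## The cohomology of the properad of ordered partitions -/

section Cohomology

variable {K : Type u} [Field K] {m : ℕ} {i j : ℤ}

theorem PermCell.isSur (c : PermCell m 0 i) : IsSur c.k c.nat := by
  intro j
  constructor
  · intro hj
    obtain ⟨x, hx⟩ := c.surj ⟨j, hj⟩
    exact ⟨x, congrArg Fin.val hx⟩
  · rintro ⟨x, rfl⟩
    exact (c.f x).2

theorem IsSur.exists_cell {k : ℕ} {f : Fin m → ℕ} (hf : IsSur k f) (hk : 1 ≤ k)
    (hi : (k : ℤ) - m = i) : ∃ c : PermCell m 0 i, c.nat = f :=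
  ⟨⟨k, fun x => ⟨f x, hf.lt x⟩, fun y => by
    obtain ⟨x, hx⟩ := (hf y).1 y.2
    exact ⟨x, Fin.ext hx⟩, hk, rfl, hi⟩, rfl⟩

theorem PermCell.k_le (c : PermCell m 0 i) : c.k ≤ m := by
  simpa using Fintype.card_le_of_surjective _ c.surj

theorem PermCell.deg_le (c : PermCell m 0 i) : i ≤ 0 := by
  have := c.deg_eq
  have := c.k_le
  omega

theorem W_subsingleton {n : ℕ} (h : m = 0 ∨ n ≠ 0 ∨ 0 < i) : Subsingleton ((W K).X m n i) := by
  have : IsEmpty (PermCell m n i) := by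
    refine ⟨fun c => ?_⟩
    obtain rfl := c.no_input
    have h1 := c.deg_le
    have h2 := c.k_le
    have h3 := c.one_le
    rcases h with h | h | h
    · omega
    · exact h rfl
    · omega
  exact inferInstanceAs (Subsingleton (PermCell m n i →₀ K))

/-- The element of `W(m,0)` with given coefficients. -/
noncomputable def ofCoords (y : (Fin m → ℕ) → K) : (W K).X m 0 i :=
  (Finsupp.equivFunOnFinite.symm (fun c => c.theta K * y c.nat) : PermCell m 0 i →₀ K)

theorem coords_ofCoords (y : (Fin m → ℕ) → K) (c : PermCell m 0 i) :
    coords (ofCoords y : (W K).X m 0 i) c.nat = y c.nat := by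
  rw [coords_nat]
  have : wCoeff (ofCoords y : (W K).X m 0 i) c = c.theta K * y c.nat := rfl
  rw [this, ← mul_assoc, c.theta_mul_self, one_mul]

theorem exists_permDiff_eq (h : i + 1 = j) (x : (W K).X m 0 j)
    (hx : permDiff K m 0 j (j + 1) rfl x = 0) : ∃ y : (W K).X m 0 i,
      ∀ c : PermCell m 0 j, (∃ a, c.nat a ≠ a) →
        coords x c.nat = coords (permDiff K m 0 i j h y) c.nat := by
  rcases isEmpty_or_nonempty (PermCell m 0 j) with he | ⟨⟨c0⟩⟩
  · exact ⟨0, fun c => he.elim c⟩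
  obtain ⟨y, hy⟩ := exists_cobound m c0.k (coords x) (by
    intro g hg
    obtain ⟨c, rfl⟩ := hg.exists_cell (i := j + 1) (by omega)
      (by have := c0.deg_eq; push_cast; omega)
    have hk : c.k = c0.k + 1 := by
      have := c.deg_eq
      have := c0.deg_eq
      omega
    have h1 := coords_permDiff (rfl : j + 1 = j + 1) x c
    rw [hx, hk] at h1
    simp only [map_zero, Pi.zero_apply, Nat.add_sub_cancel, pow_add _ (c0.k + 1), mul_assoc,
      ← Finset.mul_sum] at h1
    exact (mul_eq_zero.1 h1.symm).resolve_left (pow_ne_zero _ (by simp)))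
  -- The differential carries `(-1) ^ (k + a)` where `cobound` has `(-1) ^ a`; the constant factor
  -- compensates, as the degree fixes the number of blocks.
  refine ⟨ofCoords (fun f => (-1) ^ c0.k * y f), fun c hc => ?_⟩
  have hk : c.k = c0.k := c.k_eq c0
  rw [hy c.nat (hk ▸ c.isSur) hc, coords_permDiff, hk]
  refine Finset.sum_congr rfl fun a ha => ?_
  rw [← hk, Finset.mem_range] at ha
  rw [← PermCell.nat_merge h c ha, coords_ofCoords, pow_add, ← mul_assoc,
    mul_right_comm _ ((-1) ^ a), ← mul_pow]
  simp

/-- The partition excepted in `exists_permDiff_eq` has `m` blocks, hence occurs only in degree zero.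
-/
theorem exists_eq_permDiff (h : i + 1 = j) (hj : j ≠ 0) (x : (W K).X m 0 j)
    (hx : permDiff K m 0 j (j + 1) rfl x = 0) :
    ∃ y : (W K).X m 0 i, x = permDiff K m 0 i j h y := by
  obtain ⟨y, hy⟩ := exists_permDiff_eq h x hx
  refine ⟨y, coords_ext fun c => hy c ?_⟩
  by_contra! hc
  have h1 := c.deg_eq
  have h2 := c.k_le
  have h3 : m ≤ c.k := by
    by_contra hlt
    have h4 := c.isSur.lt ⟨c.k, by omega⟩
    rw [hc] at h4
    exact lt_irrefl _ h4
  omega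

/-! ### Vertices and the augmentation -/

theorem vertexCell_act (hm : 1 ≤ m) (s t : Equiv.Perm (Fin m)) :
    (vertexCell m hm t).act s = vertexCell m hm (s * t) := rfl

theorem blockSign_vertexCell (hm : 1 ≤ m) (s t : Equiv.Perm (Fin m)) :
    blockSign s (vertexCell m hm t).f = 1 := by
  refine Finset.prod_eq_one fun p _ => if_neg ?_
  rintro ⟨h1, h2, -⟩
  exact h1.ne (t.symm.injective h2)

theorem theta_vertexCell (hm : 1 ≤ m) (s : Equiv.Perm (Fin m)) : (vertexCell m hm s).theta K =
    ((Equiv.Perm.sign s : ℤˣ) : ℤ) * (vertexCell m hm 1).theta K := by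
  have h := (vertexCell m hm 1).theta_act (K := K) s
  rwa [blockSign_vertexCell, vertexCell_act, mul_one, Units.val_one, Int.cast_one, mul_one] at h

theorem vertexCell_injective (hm : 1 ≤ m) : Function.Injective (vertexCell m hm) := by
  intro s t h
  have h1 : (vertexCell m hm s).nat = (vertexCell m hm t).nat := congrArg _ h
  have h2 : s.symm = t.symm := Equiv.ext fun x => Fin.ext (congrFun h1 x)
  exact Equiv.symm_bijective.injective h2

/-- The sum of the coefficients of the vertices. -/
noncomputable def augmentation (hm : 1 ≤ m) (x : (W K).X m 0 0) : K :=
  ∑ s, (vertexCell m hm s).theta K * coords x (vertexCell m hm s).nat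

theorem augmentation_corollaW (hm : 1 ≤ m) (s : Equiv.Perm (Fin m)) :
    augmentation hm (corollaW K (vertexCell m hm s)) = 1 := by
  classical
  simp only [augmentation, coords_corollaW, PermCell.nat_injective.eq_iff,
    (vertexCell_injective hm).eq_iff]
  simp [PermCell.theta_mul_self]

theorem augmentation_add (hm : 1 ≤ m) (x y : (W K).X m 0 0) :
    augmentation hm (x + y) = augmentation hm x + augmentation hm y := by
  simp only [augmentation, map_add, Pi.add_apply, mul_add, Finset.sum_add_distrib]

theorem augmentation_smul (hm : 1 ≤ m) (r : K) (x : (W K).X m 0 0) :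
    augmentation hm (r • x) = r * augmentation hm x := by
  simp only [augmentation, map_smul, Pi.smul_apply, smul_eq_mul, Finset.mul_sum, mul_left_comm]

theorem augmentation_sum (hm : 1 ≤ m) {ι : Type*} (s : Finset ι) (x : ι → (W K).X m 0 0) :
    augmentation hm (∑ a ∈ s, x a) = ∑ a ∈ s, augmentation hm (x a) := by
  simp only [augmentation, map_sum, Finset.sum_apply, Finset.mul_sum]
  exact Finset.sum_comm

/-- Merging the blocks `a` and `a + 1` of a vertex does not see whether their two elements have been
exchanged, while `theta` changes sign under the exchange. These are the two ends of an edge. -/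
theorem augmentation_permDiff [CharZero K] (hm : 1 ≤ m) (h : i + 1 = 0) (y : (W K).X m 0 i) :
    augmentation hm (permDiff K m 0 i 0 h y) = 0 := by
  unfold augmentation
  simp only [coords_permDiff, Finset.mul_sum]
  have hk : ∀ s, (vertexCell m hm s).k - 1 = m - 1 := fun s => rfl
  simp only [hk]
  rw [Finset.sum_comm]
  refine Finset.sum_eq_zero fun a ha => ?_
  rw [Finset.mem_range] at ha
  let b : Fin m := ⟨a, by omega⟩
  let b' : Fin m := ⟨a + 1, by omega⟩
  have hne : b ≠ b' := fun h => by simp [b, b'] at h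
  have h1 := Equiv.sum_comp (Equiv.mulRight (Equiv.swap b b')) (fun s =>
    (vertexCell m hm s).theta K * ((-1) ^ ((vertexCell m hm s).k + a) *
      coords y (mergeNat a ∘ (vertexCell m hm s).nat)))
  -- Reindexing by the transposition shows that the sum equals its negative, which in characteristic
  -- zero makes it vanish.
  rw [← self_eq_neg (G := K)]
  nth_rw 1 [← h1]
  rw [← Finset.sum_neg_distrib]
  refine Finset.sum_congr rfl fun s _ => ?_
  have h2 : mergeNat a ∘ (vertexCell m hm (s * Equiv.swap b b')).nat =
      mergeNat a ∘ (vertexCell m hm s).nat := by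
    funext x
    change mergeNat a (Equiv.swap b b' (s.symm x)) = mergeNat a (s.symm x)
    rw [Equiv.swap_apply_def]
    split_ifs with h3 h3
    · rw [h3]
      simp [b, b', mergeNat]
    · rw [h3]
      simp [b, b', mergeNat]
    · rfl
  rw [Equiv.coe_mulRight, h2, theta_vertexCell hm (s * _), theta_vertexCell hm s,
    Equiv.Perm.sign_mul, Equiv.Perm.sign_swap hne]
  have h3 : (vertexCell m hm (s * Equiv.swap b b')).k = (vertexCell m hm s).k := rfl
  rw [h3]
  push_cast
  ring

theorem exists_permDiff_add_corolla (hm : 1 ≤ m) (h : i + 1 = 0) (x : (W K).X m 0 0) :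
    ∃ (y : (W K).X m 0 i) (r : K),
      x = permDiff K m 0 i 0 h y + r • corollaW K (vertexCell m hm 1) := by
  have hx : permDiff K m 0 0 (0 + 1) rfl x = 0 := by
    have := W_subsingleton (K := K) (m := m) (n := 0) (i := 0 + 1) (.inr (.inr (by norm_num)))
    exact Subsingleton.elim _ _
  obtain ⟨y, hy⟩ := exists_permDiff_eq h x hx
  classical
  -- The multiple corrects the single coordinate left open by `exists_permDiff_eq`; the factor
  -- `theta` is its own inverse.
  refine ⟨y, (vertexCell m hm 1).theta K * (coords x (vertexCell m hm 1).nat -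
    coords (permDiff K m 0 i 0 h y) (vertexCell m hm 1).nat), coords_ext fun c => ?_⟩
  rw [map_add, map_smul, Pi.add_apply, Pi.smul_apply, coords_corollaW, smul_eq_mul]
  by_cases hc : c.nat = (vertexCell m hm 1).nat
  · rw [if_pos hc, hc, mul_right_comm, PermCell.theta_mul_self]
    ring
  · rw [if_neg hc, mul_zero, add_zero]
    refine hy c ?_
    by_contra! h'
    exact hc (funext h')

theorem augmentation_vertexSum (hm : 1 ≤ m) :
    augmentation hm (vertexSum K m hm) = (m.factorial : K) := by
  rw [vertexSum, augmentation_sum]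
  simp [augmentation_corollaW, Fintype.card_perm]

/-- The single vertex may be replaced by the sum of all vertices, which is cohomologous to `m!`
times it, and `m!` is invertible. -/
theorem exists_permDiff_add_vertexSum [CharZero K] (hm : 1 ≤ m) (h : i + 1 = 0)
    (x : (W K).X m 0 0) : ∃ (y : (W K).X m 0 i) (r : K),
      x = permDiff K m 0 i 0 h y + r • vertexSum K m hm := by
  obtain ⟨y, r, hx⟩ := exists_permDiff_add_corolla hm h x
  obtain ⟨y0, r0, h0⟩ := exists_permDiff_add_corolla hm h (vertexSum K m hm)
  have hr0 : r0 ≠ 0 := by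
    have h1 := augmentation_vertexSum (K := K) hm
    rw [h0, augmentation_add, augmentation_permDiff, augmentation_smul, augmentation_corollaW,
      zero_add, mul_one] at h1
    rw [h1]
    exact_mod_cast m.factorial_ne_zero
  refine ⟨y - (r / r0) • y0, r / r0, ?_⟩
  rw [map_sub, map_smul, hx]
  rw [h0]
  rw [smul_add, smul_smul, div_mul_cancel₀ _ hr0]
  abel

theorem out_vertexSum (hm : 1 ≤ m) (s : Equiv.Perm (Fin m)) :
    (W K).out m 0 0 s (vertexSum K m hm) = vertexSum K m hm := by
  simp only [vertexSum, map_sum, out_corollaW, blockSign_vertexCell, vertexCell_act]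
  simp only [Units.val_one, Int.cast_one, one_smul]
  exact Equiv.sum_comp (Equiv.mulLeft s) (fun t => corollaW K (vertexCell m hm t))

/-! ### Cohomology of a properad that is free on `W` -/

section Properad

variable {P : DGProperad K} {ι : Hom (W K) P.mod}

theorem noInputs_of_bijective (hι : ∀ m n i, Function.Bijective (ι.f m n i)) :
    P.mod.NoInputs := by
  intro m n i hn
  have := W_noInputs (K := K) m n i hn
  exact (hι m n i).2.subsingleton

theorem subsingleton_of_bijective (hι : ∀ m n i, Function.Bijective (ι.f m n i)) {n : ℕ}
    (h : m = 0 ∨ n ≠ 0 ∨ 0 < i) : Subsingleton (P.mod.X m n i) := by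
  have := W_subsingleton (K := K) h
  exact (hι m n i).2.subsingleton

theorem cohomMod_subsingleton_of {E : SBimodule K} (d : Differential E) {n : ℕ}
    (h : ∀ x ∈ cocycles d m n i, x ∈ coboundaries d m n i) : Subsingleton (CohomMod d m n i) := by
  rw [Submodule.Quotient.subsingleton_iff, Submodule.eq_top_iff']
  rintro ⟨x, hx⟩
  exact h x hx

theorem cohomology_subsingleton (hι : ∀ m n i, Function.Bijective (ι.f m n i))
    (hd : P.HasPermDifferential ι) (m n : ℕ) (i : ℤ) (hi : i ≠ 0) :
    Subsingleton ((cohomology P.diff).X m n i) := by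
  rcases eq_or_ne n 0 with rfl | hn
  · refine cohomMod_subsingleton_of P.diff fun z hz => ?_
    obtain ⟨x, rfl⟩ := (hι m 0 i).2 z
    have hx : permDiff K m 0 i (i + 1) rfl x = 0 := by
      refine (hι m 0 (i + 1)).1 ?_
      rw [← hd.d_eq, map_zero]
      exact hz
    obtain ⟨y, hy⟩ := exists_eq_permDiff (i := i - 1) (by ring) hi x hx
    exact ⟨ι.f m 0 (i - 1) y, by rw [hd.d_eq, ← hy]⟩
  · exact cohomology_noInputs (noInputs_of_bijective hι) P.diff m n i hn

theorem vertexSum_mem_cocycles (hι : ∀ m n i, Function.Bijective (ι.f m n i)) (hm : 1 ≤ m) :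
    ι.f m 0 0 (vertexSum K m hm) ∈ cocycles P.diff m 0 0 := by
  have := subsingleton_of_bijective hι (m := m) (n := 0) (i := 0 + 1)
    (.inr (.inr (by norm_num)))
  exact Subsingleton.elim _ _

/-- The class of the sum of all vertices. -/
noncomputable def vertexClass (hι : ∀ m n i, Function.Bijective (ι.f m n i)) (hm : 1 ≤ m) :
    (cohomology P.diff).X m 0 0 :=
  cohomClass P.diff (ι.f m 0 0 (vertexSum K m hm)) (vertexSum_mem_cocycles hι hm)

theorem out_vertexClass (hι : ∀ m n i, Function.Bijective (ι.f m n i)) (hm : 1 ≤ m)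
    (s : Equiv.Perm (Fin m)) :
    (cohomology P.diff).out m 0 0 s (vertexClass hι hm) = vertexClass hι hm := by
  have h : P.mod.out m 0 0 s (ι.f m 0 0 (vertexSum K m hm)) =
      ι.f m 0 0 (vertexSum K m hm) := by
    rw [← ι.map_out, out_vertexSum]
  refine Eq.trans (b := cohomClass P.diff (P.mod.out m 0 0 s (ι.f m 0 0 (vertexSum K m hm)))
    (out_cocycles _ _ _ (vertexSum_mem_cocycles hι hm))) rfl ?_
  unfold vertexClass
  congr 1

theorem vertexClass_spans [CharZero K] (hι : ∀ m n i, Function.Bijective (ι.f m n i))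
    (hd : P.HasPermDifferential ι) (hm : 1 ≤ m) (z : (cohomology P.diff).X m 0 0) :
    ∃ r : K, z = r • vertexClass hι hm := by
  obtain ⟨⟨z, hz⟩, rfl⟩ := Submodule.Quotient.mk_surjective _ z
  obtain ⟨x, rfl⟩ := (hι m 0 0).2 z
  obtain ⟨y, r, hx⟩ := exists_permDiff_add_vertexSum hm (show (0 - 1 : ℤ) + 1 = 0 by ring) x
  refine ⟨r, (Submodule.Quotient.eq _).2 ?_⟩
  refine ⟨ι.f m 0 (0 - 1) y, ?_⟩
  rw [hd.d_eq]
  change _ = ι.f m 0 0 x - r • ι.f m 0 0 (vertexSum K m hm)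
  rw [hx, map_add, map_smul, add_sub_cancel_right]

/-- The augmentation vanishes on boundaries and equals `m!` on the sum of all vertices, so it
detects the class. -/
theorem smul_vertexClass_eq_zero [CharZero K] (hι : ∀ m n i, Function.Bijective (ι.f m n i))
    (hd : P.HasPermDifferential ι) (hm : 1 ≤ m) (r : K) (h : r • vertexClass hι hm = 0) :
    r = 0 := by
  have h0 : (Submodule.Quotient.mk (⟨r • ι.f m 0 0 (vertexSum K m hm),
      Submodule.smul_mem _ r (vertexSum_mem_cocycles hι hm)⟩ : cocycles P.diff m 0 0) :
      CohomMod P.diff m 0 0) = 0 := h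
  have h' := (Submodule.Quotient.mk_eq_zero _).1 h0
  obtain ⟨z, hz⟩ := h'
  obtain ⟨y, rfl⟩ := (hι m 0 (0 - 1)).2 z
  change _ = r • ι.f m 0 0 (vertexSum K m hm) at hz
  rw [hd.d_eq, ← map_smul] at hz
  have h1 := congrArg (augmentation hm) ((hι m 0 0).1 hz)
  rw [augmentation_permDiff, augmentation_smul, augmentation_vertexSum] at h1
  refine (mul_eq_zero.1 h1.symm).resolve_right ?_
  exact_mod_cast m.factorial_ne_zero

theorem symCorollas_noInputs : (SymCorollas K).NoInputs := by
  intro m n i hn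
  have : IsEmpty (PLift (1 ≤ m ∧ n = 0 ∧ i = 0)) := ⟨fun h => hn h.down.2.1⟩
  exact inferInstanceAs (Subsingleton (PLift (1 ≤ m ∧ n = 0 ∧ i = 0) →₀ K))

/-- The symmetric corollas are sent to the classes of the sums of all vertices. -/
noncomputable def symHom (hι : ∀ m n i, Function.Bijective (ι.f m n i)) :
    Hom (SymCorollas K) (cohomology P.diff) where
  f := fun m n i => (Finsupp.linearCombination K (fun h : PLift (1 ≤ m ∧ n = 0 ∧ i = 0) =>
    (cohomology P.diff).transport rfl h.down.2.1.symm h.down.2.2.symm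
      (vertexClass hι h.down.1)) :
      (PLift (1 ≤ m ∧ n = 0 ∧ i = 0) →₀ K) →ₗ[K] (cohomology P.diff).X m n i)
  map_out := by
    intro m n i s x
    refine Finsupp.induction_linear (motive := fun x => Finsupp.linearCombination K _ x =
      (cohomology P.diff).out m n i s (Finsupp.linearCombination K _ x)) x ?_ ?_ ?_
    · simp
    · intro x y hx hy
      rw [map_add, map_add, ← hx, ← hy]
    · rintro ⟨hm, rfl, rfl⟩ r
      rw [Finsupp.linearCombination_single, map_smul]
      exact congrArg (r • ·) (out_vertexClass hι hm s).symm
  map_inn := by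
    intro m n i t x
    rcases eq_or_ne n 0 with hn | hn
    · rw [SBimodule.inn_eq_self _ hn, SBimodule.inn_eq_self _ hn]
    · have := cohomology_noInputs (noInputs_of_bijective hι) P.diff m n i hn
      exact Subsingleton.elim _ _

theorem symHom_symCorolla (hι : ∀ m n i, Function.Bijective (ι.f m n i)) (hm : 1 ≤ m) :
    (symHom hι).f m 0 0 (symCorolla K m hm) = vertexClass hι hm :=
  (Finsupp.linearCombination_single K 1 _).trans (one_smul _ _)

/-- In arity `(m, 0)` and degree zero, with `1 ≤ m`, both sides are lines with matching generators;
everywhere else both vanish. -/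
theorem symHom_bijective [CharZero K] (hι : ∀ m n i, Function.Bijective (ι.f m n i))
    (hd : P.HasPermDifferential ι) (m n : ℕ) (i : ℤ) :
    Function.Bijective ((symHom hι).f m n i) := by
  by_cases h : 1 ≤ m ∧ n = 0 ∧ i = 0
  · obtain ⟨hm, rfl, rfl⟩ := h
    have key : ∀ x : (SymCorollas K).X m 0 0, ∃ r : K, x = r • symCorolla K m hm := by
      intro x
      refine ⟨(show PLift (1 ≤ m ∧ (0 : ℕ) = 0 ∧ (0 : ℤ) = 0) →₀ K from x) ⟨hm, rfl, rfl⟩,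
        Finsupp.ext fun a => ?_⟩
      exact ((mul_one _).symm.trans (congrArg _ Finsupp.single_eq_same.symm))
    constructor
    · rw [injective_iff_map_eq_zero]
      intro x hx
      obtain ⟨r, rfl⟩ := key x
      rw [map_smul, symHom_symCorolla] at hx
      rw [smul_vertexClass_eq_zero hι hd hm r hx, zero_smul]
    · intro z
      obtain ⟨r, rfl⟩ := vertexClass_spans hι hd hm z
      exact ⟨r • symCorolla K m hm, by rw [map_smul, symHom_symCorolla]⟩
  · have h1 : IsEmpty (PLift (1 ≤ m ∧ n = 0 ∧ i = 0)) := ⟨fun h' => h h'.down⟩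
    have h2 : Subsingleton ((SymCorollas K).X m n i) :=
      inferInstanceAs (Subsingleton (PLift (1 ≤ m ∧ n = 0 ∧ i = 0) →₀ K))
    have h3 : Subsingleton ((cohomology P.diff).X m n i) := by
      by_cases hi : i = 0
      · have : m = 0 ∨ n ≠ 0 ∨ 0 < i := by omega
        have := subsingleton_of_bijective hι this
        exact cohomMod_subsingleton_of P.diff fun z _ => by
          rw [Subsingleton.elim z 0]
          exact Submodule.zero_mem _
      · exact cohomology_subsingleton hι hd m n i hi
    exact ⟨Function.injective_of_subsingleton _, fun z => ⟨0, Subsingleton.elim _ _⟩⟩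

theorem exists_induced_free [CharZero K] (hι : ∀ m n i, Function.Bijective (ι.f m n i))
    (hd : P.HasPermDifferential ι) : ∃ T : ProperadStr (cohomology P.diff), P.IsInduced T ∧
      ∃ j : Hom (SymCorollas K) (cohomology P.diff), T.IsFree j ∧ ∀ (m : ℕ) (hm : 1 ≤ m),
        ∃ h : ι.f m 0 0 (vertexSum K m hm) ∈ cocycles P.diff m 0 0,
          j.f m 0 0 (symCorolla K m hm) =
            cohomClass P.diff (ι.f m 0 0 (vertexSum K m hm)) h :=
  ⟨_, P.isInduced_str (noInputs_of_bijective hι), symHom hι,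
    (ProperadStr.isFree_iff symCorollas_noInputs _ _).2 (symHom_bijective hι hd),
    fun _ hm => ⟨vertexSum_mem_cocycles hι hm, symHom_symCorolla hι hm⟩⟩

end Properad

end Cohomology

/-! ## The faces of the permutahedron -/

section Faces

open Matrix

variable {m : ℕ}

/-- Sorting breaks ties. Applied to block numbers it supplies a vertex of each face, and with
lexicographic keys a vertex with a prescribed order inside a block. -/
theorem exists_perm_lt {α : Type*} [LinearOrder α] (c : Fin m → α) :
    ∃ w : Equiv.Perm (Fin m), ∀ a b, c a < c b → w a < w b := by
  refine ⟨(Tuple.sort c).symm, fun a b hab => ?_⟩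
  by_contra h
  have := Tuple.monotone_sort c (not_lt.1 h)
  simp only [Function.comp_apply, Equiv.apply_symm_apply] at this
  exact this.not_gt hab

/-- The vertex of the permutahedron given by a permutation. -/
def permVertex (w : Equiv.Perm (Fin m)) (a : Fin m) : ℝ := ((w a : ℕ) : ℝ) + 1

theorem permVertex_lt {w : Equiv.Perm (Fin m)} {a b : Fin m} :
    permVertex w a < permVertex w b ↔ w a < w b := by
  simp [permVertex]

theorem permVertices_eq {k : ℕ} (f : Fin m → Fin k) :
    permVertices f = permVertex '' {w | ∀ a b, f a < f b → w a < w b} := by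
  ext x
  constructor
  · rintro ⟨w, hw, hx⟩
    exact ⟨w, hw, (funext hx).symm⟩
  · rintro ⟨w, hw, rfl⟩
    exact ⟨w, hw, fun _ => rfl⟩

theorem permutahedron_eq : permutahedron m = convexHull ℝ (Set.range permVertex) := by
  unfold permutahedron
  congr 1
  ext x
  constructor
  · rintro ⟨w, hx⟩
    exact ⟨w, (funext hx).symm⟩
  · rintro ⟨w, rfl⟩
    exact ⟨w, fun _ => rfl⟩

/-- Puts the order condition into the form needed for the rearrangement inequality and its equality
case. -/
theorem monovary_permVertex_iff {c : Fin m → ℝ} {w : Equiv.Perm (Fin m)} :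
    Monovary c (permVertex w) ↔ ∀ a b, c a < c b → w a < w b := by
  constructor
  · intro h a b hab
    rcases lt_trichotomy (w a) (w b) with h' | h' | h'
    · exact h'
    · rw [w.injective h'] at hab
      exact absurd hab (lt_irrefl _)
    · exact absurd (h (permVertex_lt.2 h')) hab.not_ge
  · intro h a b hab
    by_contra h'
    exact (permVertex_lt.1 hab).not_gt (h _ _ (not_le.1 h'))

theorem permVertex_comp (w w0 : Equiv.Perm (Fin m)) (a : Fin m) :
    permVertex w0 ((w.trans w0.symm) a) = permVertex w a := by
  simp [permVertex]

theorem dotProduct_permVertex_le {c : Fin m → ℝ} {w0 : Equiv.Perm (Fin m)}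
    (h : ∀ a b, c a < c b → w0 a < w0 b) (w : Equiv.Perm (Fin m)) :
    c ⬝ᵥ permVertex w ≤ c ⬝ᵥ permVertex w0 := by
  have := (monovary_permVertex_iff.2 h).sum_mul_comp_perm_le_sum_mul (σ := w.trans w0.symm)
  simp only [permVertex_comp] at this
  exact this

theorem dotProduct_permVertex_eq_iff {c : Fin m → ℝ} {w0 : Equiv.Perm (Fin m)}
    (h : ∀ a b, c a < c b → w0 a < w0 b) (w : Equiv.Perm (Fin m)) :
    c ⬝ᵥ permVertex w = c ⬝ᵥ permVertex w0 ↔ ∀ a b, c a < c b → w a < w b := by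
  rw [← monovary_permVertex_iff]
  have := (monovary_permVertex_iff.2 h).sum_mul_comp_perm_eq_sum_mul_iff (σ := w.trans w0.symm)
  have h2 : permVertex w0 ∘ (w.trans w0.symm) = permVertex w :=
    funext fun a => permVertex_comp w w0 a
  rw [h2] at this
  simp only [permVertex_comp] at this
  exact this

/-- The vectors on which a linear form does not exceed `M` form a convex set. -/
theorem convex_dotProduct_le (c : Fin m → ℝ) (M : ℝ) : Convex ℝ {x | c ⬝ᵥ x ≤ M} :=
  convex_halfSpace_le ⟨fun x y => dotProduct_add c x y, fun r x => dotProduct_smul r c x⟩ M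

theorem convex_dotProduct_lt (c : Fin m → ℝ) (M : ℝ) : Convex ℝ {x | c ⬝ᵥ x < M} :=
  convex_halfSpace_lt ⟨fun x y => dotProduct_add c x y, fun r x => dotProduct_smul r c x⟩ M

theorem convex_le_dotProduct (c : Fin m → ℝ) (M : ℝ) : Convex ℝ {x | M ≤ c ⬝ᵥ x} :=
  convex_halfSpace_ge ⟨fun x y => dotProduct_add c x y, fun r x => dotProduct_smul r c x⟩ M

/-- The points of `S` off the supporting hyperplane have a convex hull strictly below it, so they
must enter a convex combination lying on the hyperplane with weight zero. -/
theorem mem_convexHull_of_dotProduct_eq {S : Set (Fin m → ℝ)} {c : Fin m → ℝ} {M : ℝ}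
    (hS : ∀ x ∈ S, c ⬝ᵥ x ≤ M) {x : Fin m → ℝ} (hx : x ∈ convexHull ℝ S) (hM : c ⬝ᵥ x = M) :
    x ∈ convexHull ℝ {y ∈ S | c ⬝ᵥ y = M} := by
  have hU : ∀ y ∈ convexHull ℝ {y ∈ S | c ⬝ᵥ y ≠ M}, c ⬝ᵥ y < M := by
    intro y hy
    refine convexHull_min ?_ (convex_dotProduct_lt c M) hy
    exact fun z hz => lt_of_le_of_ne (hS z hz.1) hz.2
  have hT : ∀ y ∈ convexHull ℝ {y ∈ S | c ⬝ᵥ y = M}, c ⬝ᵥ y ≤ M := by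
    intro y hy
    refine convexHull_min ?_ (convex_dotProduct_le c M) hy
    exact fun z hz => hz.2.le
  have hST : S = {y ∈ S | c ⬝ᵥ y = M} ∪ {y ∈ S | c ⬝ᵥ y ≠ M} := by
    ext y
    simp only [Set.mem_union, Set.mem_ofPred_eq]
    tauto
  rcases Set.eq_empty_or_nonempty {y ∈ S | c ⬝ᵥ y = M} with h1 | h1
  · rw [h1, Set.empty_union] at hST
    rw [hST] at hx
    exact absurd hM (hU x hx).ne
  rcases Set.eq_empty_or_nonempty {y ∈ S | c ⬝ᵥ y ≠ M} with h2 | h2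
  · rw [h2, Set.union_empty] at hST
    rwa [← hST]
  rw [hST, convexHull_union h1 h2, mem_convexJoin] at hx
  obtain ⟨t, ht, v, hv, a, b, ha, hb, hab, rfl⟩ := hx
  rw [dotProduct_add, dotProduct_smul, dotProduct_smul, smul_eq_mul, smul_eq_mul] at hM
  have h3 := hU v hv
  have h4 := hT t ht
  have hb0 : b = 0 := by
    by_contra hne
    have hb' : 0 < b := lt_of_le_of_ne hb (Ne.symm hne)
    have h5 : b * (c ⬝ᵥ v) < b * M := mul_lt_mul_of_pos_left h3 hb'
    have h6 : a * (c ⬝ᵥ t) ≤ a * M := mul_le_mul_of_nonneg_left h4 ha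
    have h7 : a * M + b * M = M := by rw [← add_mul, hab, one_mul]
    linarith
  rw [hb0, add_zero] at hab
  rwa [hb0, hab, one_smul, zero_smul, add_zero]

theorem permFace_subset {k : ℕ} (f : Fin m → Fin k) : permFace f ⊆ permutahedron m := by
  rw [permFace, permutahedron_eq, permVertices_eq]
  exact convexHull_mono (Set.image_subset_range _ _)

theorem permFace_nonempty {k : ℕ} (f : Fin m → Fin k) : (permFace f).Nonempty := by
  obtain ⟨w, hw⟩ := exists_perm_lt f
  refine ⟨permVertex w, subset_convexHull ℝ _ ?_⟩
  rw [permVertices_eq]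
  exact ⟨w, hw, rfl⟩

theorem permVertex_mem {k : ℕ} {f : Fin m → Fin k} {w : Equiv.Perm (Fin m)}
    (hw : ∀ a b, f a < f b → w a < w b) : permVertex w ∈ permFace f := by
  refine subset_convexHull ℝ _ ?_
  rw [permVertices_eq]
  exact ⟨w, hw, rfl⟩

/-- A linear form which is monotone along the blocks attains its maximum at the face. -/
theorem dotProduct_le_of_mem_permFace {k : ℕ} {f : Fin m → Fin k} {c : Fin m → ℝ}
    (h : ∀ a b, c a < c b → f a < f b) {x y : Fin m → ℝ} (hx : x ∈ permFace f)
    (hy : y ∈ permutahedron m) : c ⬝ᵥ y ≤ c ⬝ᵥ x := by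
  obtain ⟨w0, hw0⟩ := exists_perm_lt f
  have h0 : ∀ a b, c a < c b → w0 a < w0 b := fun a b hab => hw0 _ _ (h a b hab)
  have h1 : c ⬝ᵥ y ≤ c ⬝ᵥ permVertex w0 := by
    rw [permutahedron_eq] at hy
    refine convexHull_min ?_ (convex_dotProduct_le c _) hy
    rintro _ ⟨w, rfl⟩
    exact dotProduct_permVertex_le h0 w
  have h2 : c ⬝ᵥ permVertex w0 ≤ c ⬝ᵥ x := by
    refine convexHull_min ?_ (convex_le_dotProduct c _) hx
    rw [permVertices_eq]
    rintro _ ⟨w, hw, rfl⟩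
    exact ((dotProduct_permVertex_eq_iff h0 w).2 fun a b hab => hw _ _ (h a b hab)).ge
  exact h1.trans h2

/-- The equality case of the rearrangement inequality identifies the maximizing vertices with those
compatible with `f`; the previous lemmas pass to convex hulls. -/
theorem permFace_eq_maximizers {k : ℕ} {f : Fin m → Fin k} {c : Fin m → ℝ}
    (h : ∀ a b, c a < c b ↔ f a < f b) :
    permFace f = {x ∈ permutahedron m | ∀ y ∈ permutahedron m, c ⬝ᵥ y ≤ c ⬝ᵥ x} := by
  ext x
  constructor
  · intro hx
    exact ⟨permFace_subset f hx, fun y hy =>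
      dotProduct_le_of_mem_permFace (fun a b => (h a b).1) hx hy⟩
  · rintro ⟨hx, hmax⟩
    obtain ⟨w0, hw0⟩ := exists_perm_lt f
    have h0 : ∀ a b, c a < c b → w0 a < w0 b := fun a b hab => hw0 _ _ ((h a b).1 hab)
    have hP : permVertex w0 ∈ permutahedron m := permFace_subset f (permVertex_mem hw0)
    have hM : c ⬝ᵥ x = c ⬝ᵥ permVertex w0 := by
      refine le_antisymm ?_ (hmax _ hP)
      exact dotProduct_le_of_mem_permFace (fun a b => (h a b).1) (permVertex_mem hw0) hx
    rw [permutahedron_eq] at hx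
    have hx' := mem_convexHull_of_dotProduct_eq (M := c ⬝ᵥ permVertex w0) (by
      rintro _ ⟨w, rfl⟩
      exact dotProduct_permVertex_le h0 w) hx hM
    refine convexHull_mono ?_ hx'
    rintro _ ⟨⟨w, rfl⟩, hw⟩
    rw [permVertices_eq]
    refine ⟨w, fun a b hab => ?_, rfl⟩
    exact (dotProduct_permVertex_eq_iff h0 w).1 hw a b ((h a b).2 hab)

/-- The block numbers as real numbers. -/
def blockVector {k : ℕ} (f : Fin m → Fin k) (a : Fin m) : ℝ := ((f a : ℕ) : ℝ)

theorem blockVector_lt {k : ℕ} (f : Fin m → Fin k) (a b : Fin m) :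
    blockVector f a < blockVector f b ↔ f a < f b := by
  simp [blockVector]

theorem isCell_permFace {k : ℕ} (f : Fin m → Fin k) : IsCell (permutahedron m) (permFace f) := by
  refine ⟨permFace_nonempty f, fun _ => ?_⟩
  let l : (Fin m → ℝ) →ₗ[ℝ] ℝ :=
    { toFun := fun x => blockVector f ⬝ᵥ x
      map_add' := fun x y => dotProduct_add _ x y
      map_smul' := fun r x => dotProduct_smul r _ x }
  exact ⟨LinearMap.toContinuousLinearMap l, permFace_eq_maximizers (blockVector_lt f)⟩

theorem exists_ranking (c : Fin m → ℝ) : ∃ (k : ℕ) (f : Fin m → Fin k), Function.Surjective f ∧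
    ∀ a b, c a < c b ↔ f a < f b := by
  let s := Finset.univ.image c
  let e := s.orderIsoOfFin rfl
  have hc : ∀ a, c a ∈ s := fun a => Finset.mem_image_of_mem c (Finset.mem_univ a)
  refine ⟨s.card, fun a => e.symm ⟨c a, hc a⟩, fun y => ?_, fun a b => ?_⟩
  · obtain ⟨a, -, ha⟩ := Finset.mem_image.1 (e y).2
    refine ⟨a, ?_⟩
    rw [OrderIso.symm_apply_eq]
    exact Subtype.ext ha
  · rw [OrderIso.lt_iff_lt]
    rfl

/-- The blocks are the level sets of the coordinates of a linear form exposing `F`, in increasing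
order. -/
theorem IsCell.exists_permFace {F : Set (Fin m → ℝ)} (hF : IsCell (permutahedron m) F) :
    ∃ (k : ℕ) (f : Fin m → Fin k), Function.Surjective f ∧ F = permFace f := by
  obtain ⟨l, hl⟩ := hF.2 hF.1
  obtain ⟨c, hc⟩ : ∃ c : Fin m → ℝ, ∀ x, l x = c ⬝ᵥ x := by
    refine ⟨fun a => l (Pi.single a 1), fun x => ?_⟩
    conv_lhs => rw [pi_eq_sum_univ' x]
    simp only [map_sum, map_smul, smul_eq_mul, dotProduct]
    exact Finset.sum_congr rfl fun a _ => mul_comm _ _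
  obtain ⟨k, f, hf, h⟩ := exists_ranking c
  refine ⟨k, f, hf, ?_⟩
  rw [hl, permFace_eq_maximizers h]
  simp only [hc]

theorem permFace_subset_iff {k l : ℕ} {g : Fin m → Fin l} {f : Fin m → Fin k} :
    permFace g ⊆ permFace f ↔ ∀ a b, f a < f b → g a < g b := by
  constructor
  · intro h a b hab
    by_contra hgab
    -- A vertex of the face of `g` that ranks `b` first in its block, hence before `a`; it does not
    -- maximize the block numbers of `f`.
    obtain ⟨w, hw⟩ := exists_perm_lt (fun x => toLex (g x, if x = b then 0 else 1))
    have hwg : ∀ x y, g x < g y → w x < w y :=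
      fun x y hxy => hw x y (Prod.Lex.toLex_lt_toLex.2 (.inl hxy))
    have hwb : w b < w a := by
      refine hw b a (Prod.Lex.toLex_lt_toLex.2 ?_)
      rcases (not_lt.1 hgab).lt_or_eq with h1 | h1
      · exact .inl h1
      · refine .inr ⟨h1, ?_⟩
        have : a ≠ b := by
          rintro rfl
          exact lt_irrefl _ hab
        simp [this]
    have hx := h (permVertex_mem hwg)
    obtain ⟨w0, hw0⟩ := exists_perm_lt f
    have h0 : ∀ a b, blockVector f a < blockVector f b → w0 a < w0 b :=
      fun a b hab => hw0 _ _ ((blockVector_lt f a b).1 hab)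
    have h1 : blockVector f ⬝ᵥ permVertex w = blockVector f ⬝ᵥ permVertex w0 :=
      le_antisymm
        (dotProduct_le_of_mem_permFace (fun a b => (blockVector_lt f a b).1)
          (permVertex_mem hw0) (permFace_subset f hx))
        (dotProduct_le_of_mem_permFace (fun a b => (blockVector_lt f a b).1) hx
          (permFace_subset f (permVertex_mem hw0)))
    exact hwb.not_gt ((dotProduct_permVertex_eq_iff h0 w).1 h1 a b
      ((blockVector_lt f a b).2 hab))
  · intro h
    rw [permFace, permFace, permVertices_eq, permVertices_eq]
    exact convexHull_mono (Set.image_mono fun w hw a b hab => hw a b (h a b hab))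

/-- The vectors with vanishing sums over the blocks. -/
def blockKernel {k : ℕ} (f : Fin m → Fin k) : Submodule ℝ (Fin m → ℝ) where
  carrier := {v | ∀ j, ∑ a, (if f a = j then v a else 0) = 0}
  add_mem' := by
    intro v w hv hw j
    have h : ∀ a, (if f a = j then (v + w) a else 0) =
        (if f a = j then v a else 0) + (if f a = j then w a else 0) := by
      intro a
      split_ifs <;> simp
    rw [Finset.sum_congr rfl fun a _ => h a, Finset.sum_add_distrib, hv j, hw j, add_zero]
  zero_mem' := fun j => by simp
  smul_mem' := by
    intro r v hv j
    have h : ∀ a, (if f a = j then (r • v) a else 0) = r * (if f a = j then v a else 0) := by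
      intro a
      split_ifs <;> simp
    rw [Finset.sum_congr rfl fun a _ => h a, ← Finset.mul_sum, hv j, mul_zero]

theorem dotProduct_eq_sum_blocks {k : ℕ} (f : Fin m → Fin k) (c : Fin k → ℝ) (v : Fin m → ℝ) :
    (fun a => c (f a)) ⬝ᵥ v = ∑ j, c j * ∑ a, (if f a = j then v a else 0) := by
  simp only [Finset.mul_sum, dotProduct]
  rw [Finset.sum_comm]
  refine Finset.sum_congr rfl fun a _ => ?_
  simp

theorem sub_mem_blockKernel {k : ℕ} {f : Fin m → Fin k} {x y : Fin m → ℝ} (hx : x ∈ permFace f)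
    (hy : y ∈ permFace f) : x - y ∈ blockKernel f := by
  -- The indicator of the blocks from `t` onwards is monotone along the blocks, hence constant on
  -- the face. Subtracting consecutive values of `t` isolates one block.
  have key : ∀ (t : ℕ), ((fun a => if t ≤ (f a : ℕ) then (1 : ℝ) else 0) ⬝ᵥ x) =
      (fun a => if t ≤ (f a : ℕ) then (1 : ℝ) else 0) ⬝ᵥ y := by
    intro t
    have h : ∀ a b, (if t ≤ (f a : ℕ) then (1 : ℝ) else 0) <
        (if t ≤ (f b : ℕ) then (1 : ℝ) else 0) → f a < f b := by
      intro a b hab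
      split_ifs at hab with h1 h2 h2
      · exact absurd hab (lt_irrefl _)
      · norm_num at hab
      · rw [Fin.lt_def]
        omega
      · exact absurd hab (lt_irrefl _)
    exact le_antisymm (dotProduct_le_of_mem_permFace h hy (permFace_subset f hx))
      (dotProduct_le_of_mem_permFace h hx (permFace_subset f hy))
  intro j
  have h1 := key j
  have h2 := key (j + 1)
  rw [← sub_eq_zero, ← dotProduct_sub] at h1 h2
  have h : ∀ a, (if f a = j then (x - y) a else 0) =
      (if (j : ℕ) ≤ (f a : ℕ) then (1 : ℝ) else 0) * (x - y) a -
        (if (j : ℕ) + 1 ≤ (f a : ℕ) then (1 : ℝ) else 0) * (x - y) a := by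
    intro a
    by_cases h3 : f a = j
    · simp [h3]
    · have h4 : (f a : ℕ) ≠ j := fun h => h3 (Fin.ext h)
      by_cases h5 : (j : ℕ) ≤ f a
      · have h6 : (j : ℕ) + 1 ≤ f a := by omega
        simp [h3, h5, h6]
      · have h6 : ¬ (j : ℕ) + 1 ≤ f a := by omega
        simp [h3, h5, h6]
  simp only [dotProduct] at h1 h2
  rw [Finset.sum_congr rfl fun a _ => h a, Finset.sum_sub_distrib, h1, h2, sub_zero]

theorem vectorSpan_permFace_le {k : ℕ} (f : Fin m → Fin k) :
    vectorSpan ℝ (permFace f) ≤ blockKernel f := by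
  rw [vectorSpan, Submodule.span_le]
  rintro _ ⟨x, hx, y, hy, rfl⟩
  exact sub_mem_blockKernel hx hy

/-- Exchanging two values inside a block keeps a vertex in the face and moves it by a nonzero
multiple of this vector. -/
theorem single_sub_single_mem {k : ℕ} {f : Fin m → Fin k} {a b : Fin m} (h : f a = f b) :
    (Pi.single a 1 - Pi.single b 1 : Fin m → ℝ) ∈ vectorSpan ℝ (permFace f) := by
  rcases eq_or_ne a b with rfl | hab
  · rw [sub_self]
    exact Submodule.zero_mem _
  obtain ⟨w, hw⟩ := exists_perm_lt f
  have hw' : ∀ x y, f x < f y → ((Equiv.swap a b).trans w) x < ((Equiv.swap a b).trans w) y := by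
    have hf : ∀ x, f (Equiv.swap a b x) = f x := by
      intro x
      rw [Equiv.swap_apply_def]
      split_ifs with h1 h2
      · rw [h1, h]
      · rw [h2, h]
      · rfl
    intro x y hxy
    refine hw _ _ ?_
    rwa [hf, hf]
  have h1 := vsub_mem_vectorSpan ℝ (permVertex_mem hw') (permVertex_mem hw)
  have h2 : permVertex ((Equiv.swap a b).trans w) -ᵥ permVertex w =
      (permVertex w b - permVertex w a) • (Pi.single a 1 - Pi.single b 1 : Fin m → ℝ) := by
    funext x
    simp only [vsub_eq_sub, Pi.sub_apply, Pi.smul_apply, smul_eq_mul, permVertex,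
      Equiv.trans_apply]
    rcases eq_or_ne x a with rfl | hxa
    · simp [hab]
    · rcases eq_or_ne x b with rfl | hxb
      · simp [hab.symm]
      · simp [Equiv.swap_apply_of_ne_of_ne hxa hxb, hxa, hxb]
  have h3 : permVertex w b - permVertex w a ≠ 0 := by
    intro h3
    have h4 : ((w b : ℕ) : ℝ) = ((w a : ℕ) : ℝ) := by
      simp only [permVertex] at h3
      linarith
    exact hab (w.injective (Fin.ext (by exact_mod_cast h4))).symm
  rw [h2] at h1
  exact (Submodule.smul_mem_iff _ h3).1 h1

theorem vectorSpan_permFace {k : ℕ} {f : Fin m → Fin k} (hf : Function.Surjective f) :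
    vectorSpan ℝ (permFace f) = blockKernel f := by
  refine le_antisymm (vectorSpan_permFace_le f) fun v hv => ?_
  choose r hr using hf
  -- Here `r` picks a representative of each block; the subtracted terms cancel block by block
  -- because the block sums of `v` vanish.
  have h : v = ∑ a, v a • (Pi.single a 1 - Pi.single (r (f a)) 1 : Fin m → ℝ) := by
    have h1 : ∑ a, v a • (Pi.single (r (f a)) 1 : Fin m → ℝ) = 0 := by
      have h2 : ∀ a, v a • (Pi.single (r (f a)) 1 : Fin m → ℝ) =
          ∑ j, (if f a = j then v a else 0) • (Pi.single (r j) 1 : Fin m → ℝ) := by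
        intro a
        simp [ite_smul]
      rw [Finset.sum_congr rfl fun a _ => h2 a, Finset.sum_comm]
      refine Finset.sum_eq_zero fun j _ => ?_
      rw [← Finset.sum_smul, hv j, zero_smul]
    simp only [smul_sub, Finset.sum_sub_distrib, h1, sub_zero]
    funext x
    simp [Finset.sum_apply, Pi.single_apply]
  rw [h]
  exact Submodule.sum_mem _ fun a _ => Submodule.smul_mem _ _ (single_sub_single_mem (hr _).symm)

/-- The characteristic vectors of the blocks. -/
def blockIndicator {k : ℕ} (f : Fin m → Fin k) (j : Fin k) (a : Fin m) : ℝ :=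
  if f a = j then 1 else 0

theorem block_sum_indicator {k : ℕ} (f : Fin m → Fin k) (j l : Fin k) :
    ∑ a, (if f a = j then blockIndicator f l a else 0) =
      if j = l then ((Finset.univ.filter (f · = j)).card : ℝ) else 0 := by
  rw [Finset.card_filter]
  push_cast
  split_ifs with h
  · subst h
    exact Finset.sum_congr rfl fun a _ => by simp [blockIndicator]
  · refine Finset.sum_eq_zero fun a _ => ?_
    split_ifs with h1
    · rw [blockIndicator, if_neg]
      rw [h1]
      exact h
    · rfl

theorem card_block_pos {k : ℕ} {f : Fin m → Fin k} (hf : Function.Surjective f) (j : Fin k) :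
    (0 : ℝ) < ((Finset.univ.filter (f · = j)).card : ℝ) := by
  obtain ⟨a, ha⟩ := hf j
  exact_mod_cast Finset.card_pos.2 ⟨a, by simp [ha]⟩

theorem block_sum_combination {k : ℕ} (f : Fin m → Fin k) (c : Fin k → ℝ) (j : Fin k) :
    ∑ a, (if f a = j then (∑ l, c l • blockIndicator f l) a else 0) =
      c j * ((Finset.univ.filter (f · = j)).card : ℝ) := by
  have h : ∀ a, (if f a = j then (∑ l, c l • blockIndicator f l) a else 0) =
      ∑ l, c l * (if f a = j then blockIndicator f l a else 0) := by
    intro a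
    split_ifs <;> simp
  rw [Finset.sum_congr rfl fun a _ => h a, Finset.sum_comm]
  simp only [← Finset.mul_sum, block_sum_indicator]
  simp

/-- Every vector is the sum of a combination of the characteristic vectors of the blocks and of a
vector with vanishing sums over the blocks. -/
theorem sub_combination_mem_blockKernel {k : ℕ} {f : Fin m → Fin k} (hf : Function.Surjective f)
    (v : Fin m → ℝ) : v - ∑ j, ((∑ a, (if f a = j then v a else 0)) /
      ((Finset.univ.filter (f · = j)).card : ℝ)) • blockIndicator f j ∈ blockKernel f := by
  intro j
  have h : ∀ (x y : Fin m → ℝ) a, (if f a = j then (x - y) a else 0) =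
      (if f a = j then x a else 0) - (if f a = j then y a else 0) := by
    intro x y a
    split_ifs <;> simp
  rw [Finset.sum_congr rfl fun a _ => h _ _ a, Finset.sum_sub_distrib, block_sum_combination,
    div_mul_cancel₀ _ (card_block_pos hf j).ne', sub_self]

theorem combination_mem_blockKernel {k : ℕ} {f : Fin m → Fin k} (hf : Function.Surjective f)
    (c : Fin k → ℝ) (h : ∑ l, c l • blockIndicator f l ∈ blockKernel f) : c = 0 := by
  funext j
  have := h j
  rw [block_sum_combination] at this
  exact (mul_eq_zero.1 this).resolve_right (card_block_pos hf j).ne'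

theorem linearIndependent_blockIndicator {k : ℕ} {f : Fin m → Fin k}
    (hf : Function.Surjective f) : LinearIndependent ℝ (blockIndicator f) := by
  rw [Fintype.linearIndependent_iff]
  intro c hc
  have := combination_mem_blockKernel hf c (by rw [hc]; exact Submodule.zero_mem _)
  exact congrFun this

theorem disjoint_blockIndicator {k : ℕ} {f : Fin m → Fin k} (hf : Function.Surjective f) :
    Disjoint (Submodule.span ℝ (Set.range (blockIndicator f))) (blockKernel f) := by
  rw [Submodule.disjoint_def]
  intro v hv hv'
  obtain ⟨c, rfl⟩ := (Submodule.mem_span_range_iff_exists_fun ℝ).1 hv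
  rw [combination_mem_blockKernel hf c hv']
  simp

/-- The independent block indicators span a complement: subtracting the averages over the blocks
projects onto the kernel. -/
theorem finrank_blockKernel {k : ℕ} {f : Fin m → Fin k} (hf : Function.Surjective f) :
    k + Module.finrank ℝ (blockKernel f) = m := by
  have hc : IsCompl (Submodule.span ℝ (Set.range (blockIndicator f))) (blockKernel f) := by
    refine ⟨disjoint_blockIndicator hf, ?_⟩
    rw [codisjoint_iff, Submodule.eq_top_iff']
    intro v
    have h := sub_combination_mem_blockKernel hf v
    rw [← add_sub_cancel (∑ j, ((∑ a, (if f a = j then v a else 0)) /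
      ((Finset.univ.filter (f · = j)).card : ℝ)) • blockIndicator f j) v]
    exact Submodule.add_mem_sup (Submodule.sum_mem _ fun j _ => Submodule.smul_mem _ _
      (Submodule.subset_span ⟨j, rfl⟩)) h
  have := Submodule.finrank_add_eq_of_isCompl hc
  rw [finrank_span_eq_card (linearIndependent_blockIndicator hf)] at this
  simpa using this

theorem IsFrame.dim_eq {k d : ℕ} {f : Fin m → Fin k} (hf : Function.Surjective f)
    {b : Fin d → Fin m → ℝ} (hb : IsFrame (permFace f) b) : k + d = m := by
  have h1 := finrank_span_eq_card hb.1
  rw [hb.2, vectorSpan_permFace hf, Fintype.card_fin] at h1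
  rw [← h1]
  exact finrank_blockKernel hf

theorem exists_isFrame {k d : ℕ} {f : Fin m → Fin k} (hf : Function.Surjective f)
    (h : k + d = m) : ∃ b : Fin d → Fin m → ℝ, IsFrame (permFace f) b := by
  have hd : Module.finrank ℝ (blockKernel f) = d := by
    have := finrank_blockKernel hf
    omega
  let B := Module.finBasisOfFinrankEq ℝ (blockKernel f) hd
  refine ⟨fun i => (B i : Fin m → ℝ), ?_, ?_⟩
  · exact B.linearIndependent.map' (blockKernel f).subtype (Submodule.ker_subtype _)
  · rw [vectorSpan_permFace hf]
    have h1 : Set.range (fun i => (B i : Fin m → ℝ)) =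
        (blockKernel f).subtype '' Set.range B := by
      rw [← Set.range_comp]
      rfl
    rw [h1, ← Submodule.map_span, B.span_eq, Submodule.map_top, Submodule.range_subtype]

end Faces

/-! ## Orientations of the faces -/

section Orientation

open Matrix

variable {m : ℕ}

/-- The bijection enumerating first `Fin k` and then `Fin d`. -/
def stackEquiv {k d : ℕ} (h : k + d = m) : Fin k ⊕ Fin d ≃ Fin m :=
  finSumFinEquiv.trans (finCongr h)

/-- The vectors `r` followed by the vectors `b`, as the rows of a matrix. -/
def stack {k d : ℕ} (h : k + d = m) (r : Fin k → Fin m → ℝ) (b : Fin d → Fin m → ℝ) :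
    Matrix (Fin m) (Fin m) ℝ :=
  Matrix.of fun i => Sum.elim r b ((stackEquiv h).symm i)

theorem stack_inl {k d : ℕ} (h : k + d = m) (r : Fin k → Fin m → ℝ) (b : Fin d → Fin m → ℝ)
    (i : Fin k) : stack h r b (stackEquiv h (Sum.inl i)) = r i := by
  change Sum.elim r b ((stackEquiv h).symm _) = _
  rw [Equiv.symm_apply_apply]
  rfl

theorem stack_inr {k d : ℕ} (h : k + d = m) (r : Fin k → Fin m → ℝ) (b : Fin d → Fin m → ℝ)
    (i : Fin d) : stack h r b (stackEquiv h (Sum.inr i)) = b i := by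
  change Sum.elim r b ((stackEquiv h).symm _) = _
  rw [Equiv.symm_apply_apply]
  rfl

/-- The change of rows is block triangular, so the components of `r'` along `b` do not affect the
determinant. -/
theorem det_stack_combination {k d : ℕ} (h : k + d = m) (r r' : Fin k → Fin m → ℝ)
    (b b' : Fin d → Fin m → ℝ) (A : Matrix (Fin k) (Fin k) ℝ) (B : Matrix (Fin k) (Fin d) ℝ)
    (D : Matrix (Fin d) (Fin d) ℝ) (hr : ∀ i, r' i = ∑ j, A i j • r j + ∑ j, B i j • b j)
    (hb : b' = changeFrame D b) : (stack h r' b').det = A.det * D.det * (stack h r b).det := by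
  have h1 : stack h r' b' = ((fromBlocks A B 0 D).submatrix (stackEquiv h).symm
      (stackEquiv h).symm) * stack h r b := by
    refine Matrix.ext fun i x => ?_
    obtain ⟨i, rfl⟩ := (stackEquiv h).surjective i
    rw [mul_apply, ← (stackEquiv h).sum_comp, Fintype.sum_sum_type]
    rcases i with i | i
    · simp only [stack_inl, stack_inr, submatrix_apply, Equiv.symm_apply_apply,
        fromBlocks_apply₁₁, fromBlocks_apply₁₂, hr, Pi.add_apply, Finset.sum_apply, Pi.smul_apply,
        smul_eq_mul]
    · simp only [stack_inl, stack_inr, submatrix_apply, Equiv.symm_apply_apply,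
        fromBlocks_apply₂₁, fromBlocks_apply₂₂, hb, changeFrame, Finset.sum_apply, Pi.smul_apply,
        smul_eq_mul, Matrix.zero_apply, zero_mul, Finset.sum_const_zero, zero_add]
  rw [h1, det_mul, det_submatrix_equiv_self, det_fromBlocks_zero₂₁]

theorem det_stack_changeFrame {k d : ℕ} (h : k + d = m) (r : Fin k → Fin m → ℝ)
    (b : Fin d → Fin m → ℝ) (A : Matrix (Fin d) (Fin d) ℝ) :
    (stack h r (changeFrame A b)).det = A.det * (stack h r b).det := by
  rw [det_stack_combination h r r b _ 1 0 A (fun i => by simp [one_apply]) rfl, det_one, one_mul]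

theorem stack_cons {k d : ℕ} (h : k + (d + 1) = m) (r : Fin k → Fin m → ℝ) (v : Fin m → ℝ)
    (b : Fin d → Fin m → ℝ) :
    stack h r (Fin.cons v b) = stack (k := k + 1) (by omega) (Fin.snoc r v) b := by
  refine Matrix.ext fun i x => ?_
  obtain ⟨i, rfl⟩ := (stackEquiv h).surjective i
  rcases i with i | i
  · have e : stackEquiv h (Sum.inl i) =
        stackEquiv (k := k + 1) (d := d) (m := m) (by omega) (Sum.inl (Fin.castSucc i)) := by
      ext
      simp [stackEquiv]
    rw [stack_inl, e, stack_inl, Fin.snoc_castSucc]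
  · rw [stack_inr]
    refine Fin.cases ?_ (fun i => ?_) i
    · have e : stackEquiv h (Sum.inr 0) =
          stackEquiv (k := k + 1) (d := d) (m := m) (by omega) (Sum.inl (Fin.last k)) := by
        ext
        simp [stackEquiv]
      rw [e, stack_inl, Fin.snoc_last, Fin.cons_zero]
    · have e : stackEquiv h (Sum.inr i.succ) =
          stackEquiv (k := k + 1) (d := d) (m := m) (by omega) (Sum.inr i) := by
        ext
        simp [stackEquiv]
        omega
      rw [e, stack_inr, Fin.cons_succ]

/-- Permuting coordinates permutes columns, which is the source of the signature in the action on
oriented cells. -/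
theorem det_stack_comp {k d : ℕ} (h : k + d = m) (r : Fin k → Fin m → ℝ)
    (b : Fin d → Fin m → ℝ) (s : Equiv.Perm (Fin m)) :
    (stack h (fun i => r i ∘ s) (fun i => b i ∘ s)).det =
      ((Equiv.Perm.sign s : ℤˣ) : ℤ) * (stack h r b).det := by
  rw [← det_permute']
  congr 1
  refine Matrix.ext fun i x => ?_
  obtain ⟨i, rfl⟩ := (stackEquiv h).surjective i
  rcases i with i | i
  · rw [stack_inl, submatrix_apply, id, stack_inl]
    rfl
  · rw [stack_inr, submatrix_apply, id, stack_inr]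
    rfl

theorem det_stack_ne_zero_iff {k d : ℕ} (h : k + d = m) (r : Fin k → Fin m → ℝ)
    (b : Fin d → Fin m → ℝ) :
    (stack h r b).det ≠ 0 ↔ LinearIndependent ℝ (Sum.elim r b) := by
  rw [← isUnit_iff_ne_zero, ← isUnit_iff_isUnit_det, ← linearIndependent_rows_iff_isUnit,
    ← linearIndependent_equiv (stackEquiv h)]
  have e : (stack h r b).row ∘ stackEquiv h = Sum.elim r b := by
    funext i
    rcases i with i | i
    · exact stack_inl h r b i
    · exact stack_inr h r b i
  rw [e]

/-- The indicators span a complement of the directions of the face, so vectors in these directions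
form a basis of them exactly when the indicators complete them to a basis of the whole space. -/
theorem isFrame_iff {k d : ℕ} (h : k + d = m) {f : Fin m → Fin k} (hf : Function.Surjective f)
    (b : Fin d → Fin m → ℝ) : IsFrame (permFace f) b ↔
      (∀ i, b i ∈ blockKernel f) ∧ (stack h (blockIndicator f) b).det ≠ 0 := by
  rw [det_stack_ne_zero_iff, IsFrame, vectorSpan_permFace hf, linearIndependent_sum]
  simp only [Sum.elim_comp_inl, Sum.elim_comp_inr]
  constructor
  · rintro ⟨h1, h2⟩
    refine ⟨fun i => h2 ▸ Submodule.subset_span ⟨i, rfl⟩, linearIndependent_blockIndicator hf, h1,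
      ?_⟩
    rw [h2]
    exact disjoint_blockIndicator hf
  · rintro ⟨h1, -, h2, -⟩
    refine ⟨h2, ?_⟩
    refine Submodule.eq_of_le_of_finrank_eq ?_ ?_
    · rw [Submodule.span_le]
      rintro _ ⟨i, rfl⟩
      exact h1 i
    · rw [finrank_span_eq_card h2, Fintype.card_fin]
      have := finrank_blockKernel hf
      omega

theorem IsFrame.exists_changeFrame {d : ℕ} {F : Set (Fin m → ℝ)} {b b' : Fin d → Fin m → ℝ}
    (hb : IsFrame F b) (hb' : IsFrame F b') :
    ∃ A : Matrix (Fin d) (Fin d) ℝ, A.det ≠ 0 ∧ b' = changeFrame A b := by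
  have key : ∀ {b b' : Fin d → Fin m → ℝ}, IsFrame F b → IsFrame F b' →
      ∃ A : Matrix (Fin d) (Fin d) ℝ, b' = changeFrame A b := by
    intro b b' hb hb'
    have h : ∀ i, ∃ c : Fin d → ℝ, ∑ j, c j • b j = b' i := by
      intro i
      rw [← Submodule.mem_span_range_iff_exists_fun, hb.2, ← hb'.2]
      exact Submodule.subset_span ⟨i, rfl⟩
    choose A hA using h
    exact ⟨Matrix.of A, funext fun i => (hA i).symm⟩
  obtain ⟨A, hA⟩ := key hb hb'
  obtain ⟨B, hB⟩ := key hb' hb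
  refine ⟨A, ?_, hA⟩
  have h1 : changeFrame (B * A) b = b := by rw [changeFrame_mul, ← hA, ← hB]
  have h2 : B * A = 1 := by
    refine Matrix.ext fun i j => ?_
    have h3 := congrFun h1 i
    have h4 := Fintype.linearIndependent_iff.1 hb.1 (fun j => (B * A) i j - (1 : Matrix _ _ ℝ) i j)
      (by
        simp only [sub_smul, Finset.sum_sub_distrib]
        rw [sub_eq_zero]
        simpa [changeFrame, one_apply] using h3) j
    exact sub_eq_zero.1 h4
  intro h0
  have h3 := congrArg Matrix.det h2
  rw [det_mul, h0, mul_zero, det_one] at h3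
  exact zero_ne_one h3

theorem predAbove_succAbove_castSucc {k : ℕ} (a l : Fin k) :
    a.predAbove (a.castSucc.succAbove l) = l := by
  ext
  rw [predAbove_val, mergeNat]
  rcases lt_or_ge l.castSucc a.castSucc with h | h
  · rw [Fin.succAbove_of_castSucc_lt _ _ h]
    simp only [Fin.lt_def, Fin.val_castSucc] at h ⊢
    split_ifs <;> omega
  · rw [Fin.succAbove_of_le_castSucc _ _ h]
    simp only [Fin.le_def, Fin.val_castSucc, Fin.val_succ] at h ⊢
    split_ifs <;> omega

theorem predAbove_succAbove_succ {k : ℕ} (a l : Fin k) :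
    a.predAbove (a.succ.succAbove l) = l := by
  ext
  rw [predAbove_val, mergeNat]
  rcases lt_or_ge l.castSucc a.succ with h | h
  · rw [Fin.succAbove_of_castSucc_lt _ _ h]
    simp only [Fin.lt_def, Fin.val_castSucc, Fin.val_succ] at h ⊢
    split_ifs <;> omega
  · rw [Fin.succAbove_of_le_castSucc _ _ h]
    simp only [Fin.le_def, Fin.val_castSucc, Fin.val_succ] at h ⊢
    split_ifs <;> omega

/-- Expansion along the last row meets only the columns `a` and `a + 1`; deleting either of them
turns the merge matrix into the identity. -/
theorem det_merge_snoc {k : ℕ} (a : Fin k) (c : Fin (k + 1) → ℝ)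
    (hc : ∀ j, j ≠ a.castSucc → j ≠ a.succ → c j = 0) :
    (Matrix.of (Fin.snoc (fun i j => if a.predAbove j = i then 1 else 0) c :
      Fin (k + 1) → Fin (k + 1) → ℝ)).det = (-1) ^ (k + 1 + a : ℕ) * (c a.succ - c a.castSucc) := by
  have h1 : ∀ j : Fin (k + 1), (∀ l, a.predAbove (j.succAbove l) = l) →
      ((Matrix.of (Fin.snoc (fun i j => if a.predAbove j = i then 1 else 0) c :
        Fin (k + 1) → Fin (k + 1) → ℝ)).submatrix (Fin.last k).succAbove j.succAbove).det = 1 := by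
    intro j hj
    rw [← det_one (n := Fin k) (R := ℝ)]
    congr 1
    refine Matrix.ext fun i l => ?_
    simp [hj, one_apply, eq_comm]
  rw [det_succ_row _ (Fin.last k), Fintype.sum_eq_add a.castSucc a.succ
    (fun h => by simp [Fin.ext_iff] at h)]
  · rw [h1 _ (predAbove_succAbove_castSucc a), h1 _ (predAbove_succAbove_succ a)]
    simp only [of_apply, Fin.snoc_last, Fin.val_last, Fin.val_castSucc, Fin.val_succ]
    ring
  · rintro j ⟨h2, h3⟩
    simp [hc j h2 h3]

theorem blockIndicator_merge {k : ℕ} {a : Fin k} {f : Fin m → Fin k} {g : Fin m → Fin (k + 1)}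
    (hfg : ∀ x, f x = a.predAbove (g x)) (i : Fin k) :
    blockIndicator f i =
      ∑ j, (if a.predAbove j = i then (1 : ℝ) else 0) • blockIndicator g j := by
  funext x
  rw [Finset.sum_apply]
  simp only [Pi.smul_apply, smul_eq_mul, blockIndicator, hfg]
  simp

theorem block_sum_merge {k : ℕ} {a : Fin k} {f : Fin m → Fin k} {g : Fin m → Fin (k + 1)}
    (hfg : ∀ x, f x = a.predAbove (g x)) (v : Fin m → ℝ) (i : Fin k) :
    ∑ x, (if f x = i then v x else 0) =
      ∑ j, (if a.predAbove j = i then (1 : ℝ) else 0) * ∑ x, (if g x = j then v x else 0) := by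
  rw [← dotProduct_eq_sum_blocks]
  simp [dotProduct, hfg]

theorem blockKernel_le_merge {k : ℕ} {a : Fin k} {f : Fin m → Fin k} {g : Fin m → Fin (k + 1)}
    (hfg : ∀ x, f x = a.predAbove (g x)) : blockKernel g ≤ blockKernel f := by
  intro v hv i
  rw [block_sum_merge hfg]
  exact Finset.sum_eq_zero fun j _ => by rw [hv j, mul_zero]

theorem permFace_subset_merge {k : ℕ} {a : Fin k} {f : Fin m → Fin k} {g : Fin m → Fin (k + 1)}
    (hfg : ∀ x, f x = a.predAbove (g x)) : permFace g ⊆ permFace f := by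
  rw [permFace_subset_iff]
  intro x y hxy
  by_contra h
  rw [hfg, hfg] at hxy
  exact (Fin.predAbove_right_monotone a (not_lt.1 h)).not_gt hxy

theorem permFace_ssubset_merge {k : ℕ} {a : Fin k} {f : Fin m → Fin k} {g : Fin m → Fin (k + 1)}
    (hg : Function.Surjective g) (hfg : ∀ x, f x = a.predAbove (g x)) :
    ∃ y, y ∈ permFace f \ permFace g := by
  by_contra! h
  have h1 : permFace f ⊆ permFace g := by
    intro y hy
    by_contra h2
    exact h y ⟨hy, h2⟩
  rw [permFace_subset_iff] at h1
  obtain ⟨x, hx⟩ := hg a.castSucc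
  obtain ⟨y, hy⟩ := hg a.succ
  have h2 := h1 x y (by rw [hx, hy]; exact Fin.castSucc_lt_succ)
  rw [hfg, hfg, hx, hy] at h2
  simp at h2

/-- The linear form given by the block numbers is strictly larger on the face than elsewhere. -/
theorem dotProduct_lt_of_notMem {k : ℕ} {g : Fin m → Fin k} {x y : Fin m → ℝ}
    (hx : x ∈ permFace g) (hy : y ∈ permutahedron m) (hy' : y ∉ permFace g) :
    blockVector g ⬝ᵥ y < blockVector g ⬝ᵥ x := by
  refine lt_of_le_of_ne
    (dotProduct_le_of_mem_permFace (fun a b => (blockVector_lt g a b).1) hx hy) fun h => hy' ?_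
  rw [permFace_eq_maximizers (blockVector_lt g)]
  exact ⟨hy, fun z hz => h ▸
    dotProduct_le_of_mem_permFace (fun a b => (blockVector_lt g a b).1) hx hz⟩

/-- The orientations of a face and of its facet compare by the rule "outward vector first". -/
theorem exists_det_stack_outward {k d : ℕ} (h : k + (d + 1) = m) {a : Fin k} {f : Fin m → Fin k}
    {g : Fin m → Fin (k + 1)} (hg : Function.Surjective g) (hfg : ∀ x, f x = a.predAbove (g x))
    {b : Fin d → Fin m → ℝ} (hb : IsFrame (permFace g) b) {x y : Fin m → ℝ} (hx : x ∈ permFace g)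
    (hy : y ∈ permFace f \ permFace g) : ∃ t : ℝ, 0 < t ∧
      (stack h (blockIndicator f) (Fin.cons (x - y) b)).det =
        (-1) ^ (k + 1 + a : ℕ) * t * (stack (by omega) (blockIndicator g) b).det := by
  have hv : x - y ∈ blockKernel f := sub_mem_blockKernel (permFace_subset_merge hfg hx) hy.1
  have hpos : 0 < blockVector g ⬝ᵥ (x - y) := by
    rw [dotProduct_sub, sub_pos]
    exact dotProduct_lt_of_notMem hx (permFace_subset f hy.1) hy.2
  generalize x - y = v at hv hpos ⊢
  -- The block sums of `v` for `g`. Since `v` is a direction of the larger face, they vanish except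
  -- on the two merged blocks, where they are opposite.
  obtain ⟨S, hS⟩ : ∃ S : Fin (k + 1) → ℝ, ∀ j, S j = ∑ x, (if g x = j then v x else 0) :=
    ⟨_, fun _ => rfl⟩
  have hS1 : ∀ i, ∑ j, (if a.predAbove j = i then (1 : ℝ) else 0) * S j = 0 := by
    intro i
    have := hv i
    rw [block_sum_merge hfg] at this
    simpa only [hS] using this
  have hS0 : ∀ j, j ≠ a.castSucc → j ≠ a.succ → S j = 0 := by
    intro j h1 h2
    have h3 := hS1 (a.predAbove j)
    rw [Fintype.sum_eq_single j] at h3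
    · simpa using h3
    · intro l hl
      rw [if_neg, zero_mul]
      intro h4
      have h5 := congrArg Fin.val h4
      rw [predAbove_val, predAbove_val] at h5
      simp only [ne_eq, Fin.ext_iff, Fin.val_castSucc, Fin.val_succ] at h1 h2 hl
      unfold mergeNat at h5
      split_ifs at h5 <;> omega
  have hne : a.castSucc ≠ a.succ := fun h => by simp [Fin.ext_iff] at h
  have hS2 : S a.castSucc + S a.succ = 0 := by
    have h3 := hS1 a
    rw [Fintype.sum_eq_add a.castSucc a.succ hne] at h3
    · simpa using h3
    · rintro l ⟨h1, h2⟩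
      rw [hS0 l h1 h2, mul_zero]
  -- Pairing `v` with the block numbers of `g` gives `a * S a + (a + 1) * S (a + 1) = S (a + 1)`,
  -- which is positive because `v` points outwards.
  have hS3 : 0 < S a.succ := by
    have h3 := dotProduct_eq_sum_blocks g (fun j => ((j : ℕ) : ℝ)) v
    change blockVector g ⬝ᵥ v = _ at h3
    rw [h3, Fintype.sum_eq_add a.castSucc a.succ hne] at hpos
    · rw [← hS, ← hS] at hpos
      simp only [Fin.val_castSucc, Fin.val_succ] at hpos
      push_cast at hpos
      have : ((a : ℕ) : ℝ) * S a.castSucc = - (((a : ℕ) : ℝ) * S a.succ) := by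
        rw [eq_neg_of_add_eq_zero_left hS2, mul_neg]
      linarith
    · rintro l ⟨h1, h2⟩
      rw [← hS, hS0 l h1 h2, mul_zero]
  -- Modulo the directions of the facet, spanned by `b`, the vector `v` is the combination of
  -- indicators whose coefficients are block averages.
  have hdec := sub_combination_mem_blockKernel hg v
  simp only [← hS] at hdec
  obtain ⟨c, hc⟩ : ∃ c : Fin (k + 1) → ℝ,
      ∀ j, c j = S j / ((Finset.univ.filter (g · = j)).card : ℝ) := ⟨_, fun _ => rfl⟩
  simp only [← hc] at hdec
  rw [← vectorSpan_permFace hg, ← hb.2, Submodule.mem_span_range_iff_exists_fun] at hdec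
  obtain ⟨e, he⟩ := hdec
  refine ⟨c a.succ - c a.castSucc, ?_, ?_⟩
  · have h1 : 0 < c a.succ := by
      rw [hc]
      exact div_pos hS3 (card_block_pos hg _)
    have h2 : c a.castSucc < 0 := by
      rw [hc]
      exact div_neg_of_neg_of_pos (by linarith) (card_block_pos hg _)
    linarith
  -- The leading rows are the indicators of `f`, sums of indicators of `g`, followed by `v`. Their
  -- coefficient matrix is the one of `det_merge_snoc`, and `e` records the irrelevant components
  -- along `b`.
  · rw [stack_cons, det_stack_combination _ (blockIndicator g) _ b b
      (Matrix.of (Fin.snoc (fun i j => if a.predAbove j = i then 1 else 0) c))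
      (Matrix.of (Fin.snoc (fun _ => 0) e)) 1 ?_ (changeFrame_one b).symm, det_merge_snoc a c ?_,
      det_one, mul_one]
    · intro j h1 h2
      rw [hc, hS0 j h1 h2, zero_div]
    · intro i
      refine Fin.lastCases ?_ (fun i => ?_) i
      · simp only [Fin.snoc_last, of_apply, he]
        abel
      · simp only [Fin.snoc_castSucc, of_apply, blockIndicator_merge hfg]
        simp

theorem isFrame_outward {k d : ℕ} (h : k + (d + 1) = m) {a : Fin k} {f : Fin m → Fin k}
    {g : Fin m → Fin (k + 1)} (hf : Function.Surjective f) (hg : Function.Surjective g)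
    (hfg : ∀ x, f x = a.predAbove (g x)) {b : Fin d → Fin m → ℝ} (hb : IsFrame (permFace g) b)
    {x y : Fin m → ℝ} (hx : x ∈ permFace g) (hy : y ∈ permFace f \ permFace g) :
    IsFrame (permFace f) (Fin.cons (x - y) b) := by
  obtain ⟨t, ht, h1⟩ := exists_det_stack_outward h hg hfg hb hx hy
  have h2 := (isFrame_iff (by omega) hg b).1 hb
  rw [isFrame_iff h hf]
  refine ⟨fun i => ?_, ?_⟩
  · refine Fin.cases ?_ (fun i => ?_) i
    · exact sub_mem_blockKernel (permFace_subset_merge hfg hx) hy.1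
    · exact blockKernel_le_merge hfg (h2.1 i)
  · rw [h1]
    exact mul_ne_zero (mul_ne_zero (pow_ne_zero _ (by norm_num)) ht.ne') h2.2

end Orientation

/-! ## The chains of the permutahedra -/

section Comparison

open Matrix

/-- A function onto an initial segment is determined by the order it induces: each value is one more
than the preceding rank. -/
theorem IsSur.eq_of_lt_iff {m k k' : ℕ} {f f' : Fin m → ℕ} (hf : IsSur k f) (hf' : IsSur k' f')
    (h : ∀ a b, f a < f b ↔ f' a < f' b) : f = f' := by
  have key : ∀ n a, f a = n → f' a = n := by
    intro n
    induction n using Nat.strong_induction_on with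
    | _ n ih =>
      intro a ha
      refine le_antisymm ?_ ?_
      · by_contra hlt
        obtain ⟨c, hc⟩ := (hf' n).1 ((not_le.1 hlt).trans (hf'.lt a))
        have h1 := (h c a).2 (by omega)
        have h2 := ih (f c) (by omega) c rfl
        omega
      · rcases n.eq_zero_or_pos with rfl | hn
        · exact Nat.zero_le _
        obtain ⟨c, hc⟩ := (hf (n - 1)).1 (by have := hf.lt a; omega)
        have h1 := (h c a).1 (by omega)
        have h2 := ih (n - 1) (by omega) c hc
        omega
  exact funext fun a => (key _ a rfl).symm

/-- This identifies facets: a refinement with one block more splits a single block into two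
consecutive ones. The induced map `H` on block numbers starts at `0`, rises by at most `1` and ends
at `k - 1` after `k` steps, so it stalls exactly once. -/
theorem IsSur.exists_mergeNat {m k : ℕ} {f g : Fin m → ℕ} (hf : IsSur k f) (hg : IsSur (k + 1) g)
    (h : ∀ x y, f x < f y → g x < g y) : ∃ a < k, f = mergeNat a ∘ g := by
  have hmono : ∀ x y, g x ≤ g y → f x ≤ f y := fun x y hxy => by
    by_contra hlt
    exact (h y x (not_le.1 hlt)).not_ge hxy
  have hr : ∀ j, ∃ y, ∀ x, g x = j → f x = y := by
    intro j
    by_cases hj : ∃ x, g x = j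
    · obtain ⟨x0, hx0⟩ := hj
      exact ⟨f x0, fun x hx => le_antisymm (hmono _ _ (by omega)) (hmono _ _ (by omega))⟩
    · exact ⟨0, fun x hx => absurd ⟨x, hx⟩ hj⟩
  choose H hH using hr
  -- A skipped value of `f` would be attained at an element lying strictly between two consecutive
  -- blocks of `g`.
  have hstep : ∀ j < k, H (j + 1) ≤ H j + 1 := by
    intro j hj
    by_contra hlt
    obtain ⟨x, hx⟩ := (hg (j + 1)).1 (by omega)
    obtain ⟨y, hy⟩ := (hg j).1 (by omega)
    obtain ⟨z, hz⟩ := (hf (H j + 1)).1 (by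
      have := hf.lt x
      rw [hH _ x hx] at this
      omega)
    have h1 := h y z (by rw [hH _ y hy]; omega)
    have h2 := h z x (by rw [hH _ x hx]; omega)
    omega
  have hzero : H 0 = 0 := by
    obtain ⟨x, hx⟩ := (hg 0).1 (by omega)
    obtain ⟨z, hz⟩ := (hf 0).1 (by have := hf.lt x; omega)
    have := hmono x z (by omega)
    rw [hH _ x hx] at this
    omega
  have htop : H k = k - 1 := by
    obtain ⟨x, hx⟩ := (hg k).1 (by omega)
    have h0 := hf.lt x
    obtain ⟨z, hz⟩ := (hf (k - 1)).1 (by omega)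
    have := hmono z x (by have := hg.lt z; omega)
    rw [hH _ x hx] at this h0
    omega
  have hk : 0 < k := by
    obtain ⟨x, hx⟩ := (hg k).1 (by omega)
    have := hf.lt x
    omega
  -- The first such `a` is where `H` stalls; below it `H` is the identity, and above it the two
  -- bounds that follow force `H j = j - 1`.
  have hex : ∃ a, a < k ∧ H (a + 1) ≠ a + 1 :=
    ⟨k - 1, by omega, by rw [Nat.sub_add_cancel hk, htop]; omega⟩
  obtain ⟨ha, ha'⟩ := Nat.find_spec hex
  have hmin : ∀ j, j < Nat.find hex → H (j + 1) = j + 1 := by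
    intro j hj
    have := Nat.find_min hex hj
    by_contra hne
    exact this ⟨by omega, hne⟩
  generalize Nat.find hex = a at *
  have hlow : ∀ j ≤ a, H j = j := by
    intro j hj
    rcases j with _ | j
    · exact hzero
    · exact hmin j (by omega)
  have hupper : ∀ j, a + 1 + j ≤ k → H (a + 1 + j) ≤ a + j := by
    intro j
    induction j with
    | zero =>
      intro _
      have := hstep a ha
      rw [hlow a le_rfl] at this
      simp only [Nat.add_zero]
      omega
    | succ j ih =>
      intro hj
      have h1 := hstep (a + 1 + j) (by omega)
      have h2 := ih (by omega)
      rw [show a + 1 + (j + 1) = a + 1 + j + 1 by omega]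
      omega
  have hlower : ∀ j ≤ k, k - 1 ≤ H (k - j) + j := by
    intro j
    induction j with
    | zero =>
      intro _
      simp only [Nat.sub_zero, htop]
      omega
    | succ j ih =>
      intro hj
      have h1 := hstep (k - (j + 1)) (by omega)
      have h2 := ih (by omega)
      rw [show k - (j + 1) + 1 = k - j by omega] at h1
      omega
  refine ⟨a, ha, funext fun x => ?_⟩
  have hx := hg.lt x
  rw [Function.comp_apply, hH _ x rfl]
  generalize g x = j at hx
  unfold mergeNat
  split_ifs with h1
  · exact hlow j h1
  · have h2 := hupper (j - (a + 1)) (by omega)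
    have h3 := hlower (k - j) (by omega)
    rw [show a + 1 + (j - (a + 1)) = j by omega] at h2
    rw [show k - (k - j) = j by omega] at h3
    omega

theorem IsSur.mergeNat_injOn {m k : ℕ} {g : Fin m → ℕ} (hg : IsSur (k + 1) g) :
    Set.InjOn (fun a => mergeNat a ∘ g) {a | a < k} := by
  have key : ∀ a a', a < k → a < a' → mergeNat a ∘ g ≠ mergeNat a' ∘ g := by
    intro a a' ha haa h
    obtain ⟨x, hx⟩ := (hg (a + 1)).1 (by omega)
    have := congrFun h x
    simp only [Function.comp_apply, hx, mergeNat] at this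
    split_ifs at this <;> omega
  intro a ha a' ha' h
  rcases lt_trichotomy a a' with h1 | h1 | h1
  · exact absurd h (key a a' ha h1)
  · exact h1
  · exact absurd h.symm (key a' a ha' h1)

/-! ### Corollas and oriented cells -/

variable {m d : ℕ}

theorem PermCell.permFace_injective {i : ℤ} {c c' : PermCell m 0 i}
    (h : permFace c.f = permFace c'.f) : c = c' := by
  refine nat_injective (c.isSur.eq_of_lt_iff c'.isSur fun a b => ?_)
  exact ⟨permFace_subset_iff.1 h.ge a b, permFace_subset_iff.1 h.le a b⟩

theorem PermCell.k_add (c : PermCell m 0 (-(d : ℤ))) : c.k + d = m := by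
  have := c.deg_eq
  omega

theorem IsCell.exists_permCell (hm : 1 ≤ m) {F : Set (Fin m → ℝ)}
    (hF : IsCell (permutahedron m) F) {b : Fin d → Fin m → ℝ} (hb : IsFrame F b) :
    ∃ c : PermCell m 0 (-(d : ℤ)), F = permFace c.f := by
  obtain ⟨k, f, hf, rfl⟩ := hF.exists_permFace
  have h := hb.dim_eq hf
  refine ⟨⟨k, f, hf, ?_, rfl, by omega⟩, rfl⟩
  have := (f ⟨0, hm⟩).2
  omega

/-- The comparison of a frame with the orientation by the characteristic vectors of the blocks. -/
noncomputable def PermCell.orient (c : PermCell m 0 (-(d : ℤ))) (b : Fin d → Fin m → ℝ) :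
    SignType :=
  SignType.sign (stack c.k_add (blockIndicator c.f) b).det

theorem PermCell.isFrame_iff (c : PermCell m 0 (-(d : ℤ))) (b : Fin d → Fin m → ℝ) :
    IsFrame (permFace c.f) b ↔
      (∀ i, b i ∈ blockKernel c.f) ∧ (stack c.k_add (blockIndicator c.f) b).det ≠ 0 :=
  PermProp.isFrame_iff c.k_add c.surj b

theorem PermCell.exists_isFrame (c : PermCell m 0 (-(d : ℤ))) :
    ∃ b : Fin d → Fin m → ℝ, IsFrame (permFace c.f) b :=
  PermProp.exists_isFrame c.surj c.k_add

theorem PermCell.orient_changeFrame (c : PermCell m 0 (-(d : ℤ))) (A : Matrix (Fin d) (Fin d) ℝ)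
    (b : Fin d → Fin m → ℝ) : c.orient (changeFrame A b) = SignType.sign A.det * c.orient b := by
  rw [orient, det_stack_changeFrame, sign_mul, orient]

theorem PermCell.orient_ne_zero {c : PermCell m 0 (-(d : ℤ))} {b : Fin d → Fin m → ℝ}
    (hb : IsFrame (permFace c.f) b) : c.orient b ≠ 0 :=
  sign_ne_zero.2 ((c.isFrame_iff b).1 hb).2

variable {K : Type u} [Field K]

theorem sign_mul_self_cast {s : SignType} (hs : s ≠ 0) : (s : K) * (s : K) = 1 := by
  cases s <;> simp at hs ⊢

theorem PermCell.orient_mul_self {c : PermCell m 0 (-(d : ℤ))} {b : Fin d → Fin m → ℝ}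
    (hb : IsFrame (permFace c.f) b) : (c.orient b : K) * (c.orient b : K) = 1 :=
  sign_mul_self_cast (c.orient_ne_zero hb)

theorem outward_spec {F G : Set (Fin m → ℝ)} (h : ∃ x, x ∈ G) (h' : ∃ y, y ∈ F \ G) :
    ∃ x ∈ G, ∃ y ∈ F \ G, outward F G = x - y := by
  obtain ⟨x, hx⟩ := h
  obtain ⟨y, hy⟩ := h'
  exact Classical.epsilon_spec (p := fun v => ∃ x ∈ G, ∃ y ∈ F \ G, v = x - y)
    ⟨x - y, x, hx, y, hy, rfl⟩

/-- Stated for arbitrary block functions, so that `k = l + 1` can be substituted; the number of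
blocks of a `PermCell` is a projection, for which this is impossible directly. -/
theorem sign_det_outward {k l a : ℕ} {g : Fin m → Fin k} {f : Fin m → Fin l}
    (hg : Function.Surjective g) (hf : Function.Surjective f) (hk : k = l + 1) (ha : a < l)
    (hfg : ∀ x, (f x : ℕ) = mergeNat a (g x)) (e : l + (d + 1) = m) (e' : k + d = m)
    {b : Fin d → Fin m → ℝ} (hb : IsFrame (permFace g) b) :
    permFace g ⊆ permFace f ∧
    IsFrame (permFace f) (Fin.cons (outward (permFace f) (permFace g)) b) ∧
    SignType.sign (stack e (blockIndicator f)
      (Fin.cons (outward (permFace f) (permFace g)) b)).det =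
        (-1) ^ (k + a) * SignType.sign (stack e' (blockIndicator g) b).det := by
  subst hk
  have hfg' : ∀ x, f x = (⟨a, ha⟩ : Fin l).predAbove (g x) := fun x =>
    Fin.ext ((hfg x).trans (predAbove_val (⟨a, ha⟩ : Fin l) (g x)).symm)
  obtain ⟨x, hx, y, hy, hxy⟩ := outward_spec (F := permFace f) (G := permFace g)
    (permFace_nonempty g) (permFace_ssubset_merge hg hfg')
  rw [hxy]
  refine ⟨permFace_subset_merge hfg', isFrame_outward e hf hg hfg' hb hx hy, ?_⟩
  obtain ⟨t, ht, h1⟩ := exists_det_stack_outward e hg hfg' hb hx hy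
  rw [h1, sign_mul, sign_mul, sign_pos ht, mul_one, sign_pow]
  simp

theorem PermCell.orient_outward {g : PermCell m 0 (-(d : ℤ))} {a : ℕ} (ha : a < g.k - 1)
    (h : -((d + 1 : ℕ) : ℤ) + 1 = -(d : ℤ)) {b : Fin d → Fin m → ℝ} (hb : IsFrame (permFace g.f) b) :
    permFace g.f ⊆ permFace (g.merge h ha).f ∧
    IsFrame (permFace (g.merge h ha).f)
      (Fin.cons (outward (permFace (g.merge h ha).f) (permFace g.f)) b) ∧
    (g.merge h ha).orient (Fin.cons (outward (permFace (g.merge h ha).f) (permFace g.f)) b) =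
      (-1) ^ (g.k + a) * g.orient b :=
  sign_det_outward g.surj (g.merge h ha).surj (by
    have := g.k_add
    have := (g.merge h ha).k_add
    omega) ha (fun _ => rfl) _ _ hb

open Classical in
/-- The cellular chain with given coefficients. -/
noncomputable def chainFun (x : (W K).X m 0 (-(d : ℤ))) (F : Set (Fin m → ℝ))
    (b : Fin d → Fin m → ℝ) : K :=
  ∑ c : PermCell m 0 (-(d : ℤ)),
    if F = permFace c.f ∧ IsFrame F b then coords x c.nat * (c.orient b : K) else 0

theorem chainFun_permFace (x : (W K).X m 0 (-(d : ℤ))) {c : PermCell m 0 (-(d : ℤ))}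
    {b : Fin d → Fin m → ℝ} (hb : IsFrame (permFace c.f) b) :
    chainFun x (permFace c.f) b = coords x c.nat * (c.orient b : K) := by
  rw [chainFun, Fintype.sum_eq_single c, if_pos ⟨rfl, hb⟩]
  intro c' hc
  rw [if_neg]
  rintro ⟨h, -⟩
  exact hc (PermCell.permFace_injective h).symm

theorem chainFun_ne_zero {x : (W K).X m 0 (-(d : ℤ))} {F : Set (Fin m → ℝ)}
    {b : Fin d → Fin m → ℝ} (h : chainFun x F b ≠ 0) :
    ∃ c : PermCell m 0 (-(d : ℤ)), F = permFace c.f ∧ IsFrame F b ∧ coords x c.nat ≠ 0 := by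
  obtain ⟨c, -, hc⟩ := Finset.exists_ne_zero_of_sum_ne_zero h
  by_cases h1 : F = permFace c.f ∧ IsFrame F b
  · rw [if_pos h1] at hc
    exact ⟨c, h1.1, h1.2, left_ne_zero_of_mul hc⟩
  · rw [if_neg h1] at hc
    exact absurd rfl hc

/-- The cellular chains given by the elements of `W(m,0)`. -/
noncomputable def toChains (K : Type u) [Field K] (m d : ℕ) : (W K).X m 0 (-(d : ℤ)) →ₗ[K] cellChains K m d where
  toFun x := ⟨chainFun x, by
    refine ⟨fun F b h => ?_, fun F b A hA => ?_⟩
    · obtain ⟨c, rfl, hb, -⟩ := chainFun_ne_zero h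
      exact ⟨isCell_permFace _, hb⟩
    · unfold chainFun
      rw [Finset.mul_sum]
      refine Finset.sum_congr rfl fun c _ => ?_
      rw [isFrame_changeFrame hA, PermCell.orient_changeFrame, SignType.coe_mul]
      split_ifs
      · exact mul_left_comm _ _ _
      · simp⟩
  map_add' x y := by
    ext F b
    simp only [Submodule.coe_add, Pi.add_apply, chainFun, map_add, ← Finset.sum_add_distrib]
    refine Finset.sum_congr rfl fun c _ => ?_
    split_ifs
    · exact add_mul _ _ _
    · simp
  map_smul' r x := by
    ext F b
    simp only [Submodule.coe_smul, Pi.smul_apply, chainFun, map_smul, RingHom.id_apply, smul_eq_mul,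
      Finset.mul_sum]
    refine Finset.sum_congr rfl fun c _ => ?_
    split_ifs
    · exact mul_assoc _ _ _
    · simp

theorem toChains_val (x : (W K).X m 0 (-(d : ℤ))) : (toChains K m d x).1 = chainFun x := rfl

theorem cellChains_ext (hm : 1 ≤ m) {u v : cellChains K m d}
    (h : ∀ (c : PermCell m 0 (-(d : ℤ))) b, IsFrame (permFace c.f) b →
      u.1 (permFace c.f) b = v.1 (permFace c.f) b) : u = v := by
  ext F b
  by_cases h1 : IsCell (permutahedron m) F ∧ IsFrame F b
  · obtain ⟨c, rfl⟩ := h1.1.exists_permCell hm h1.2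
    exact h c b h1.2
  · have key : ∀ w : cellChains K m d, w.1 F b = 0 := fun w => by
      by_contra h2
      exact h1 (w.2.1 F b h2)
    rw [key, key]

theorem toChains_bijective (hm : 1 ≤ m) : Function.Bijective (toChains K m d) := by
  constructor
  · intro x y hxy
    refine coords_ext fun c => ?_
    obtain ⟨b, hb⟩ := c.exists_isFrame
    have h : chainFun x (permFace c.f) b = chainFun y (permFace c.f) b :=
      congrArg (fun w : cellChains K m d => w.1 (permFace c.f) b) hxy
    rw [chainFun_permFace x hb, chainFun_permFace y hb] at h
    exact mul_right_cancel₀ (left_ne_zero_of_mul_eq_one (c.orient_mul_self hb)) h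
  · intro u
    choose B hB using fun c : PermCell m 0 (-(d : ℤ)) => c.exists_isFrame
    -- The coefficient of a chain is read off at one chosen frame of each cell and corrected by the
    -- orientation of that frame.
    refine ⟨ofCoords (Function.extend PermCell.nat
      (fun c => u.1 (permFace c.f) (B c) * (c.orient (B c) : K)) 0),
      cellChains_ext hm fun c b hb => ?_⟩
    rw [toChains_val, chainFun_permFace _ hb, coords_ofCoords,
      PermCell.nat_injective.extend_apply]
    obtain ⟨A, hA, rfl⟩ := (hB c).exists_changeFrame hb
    rw [u.2.2 _ _ A hA, PermCell.orient_changeFrame, SignType.coe_mul]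
    linear_combination (u.1 (permFace c.f) (B c) * ((SignType.sign A.det : SignType) : K)) *
      c.orient_mul_self (K := K) (hB c)

/-- The cells having a given cell as a facet are its merges, and the rule of the outward vector
produces the same signs `(-1) ^ (g.k + a)` as `coords_permDiff`. -/
theorem cellBoundary_toChains (hm : 1 ≤ m) (h : -((d + 1 : ℕ) : ℤ) + 1 = -(d : ℤ))
    (x : (W K).X m 0 (-((d + 1 : ℕ) : ℤ))) :
    cellBoundary K m d (toChains K m (d + 1) x) =
      toChains K m d (permDiff K m 0 _ _ h x) := by
  refine cellChains_ext hm fun g b hb => ?_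
  rw [toChains_val, chainFun_permFace _ hb, coords_permDiff]
  change boundaryFun (chainFun x) (permFace g.f) b = _
  rw [boundaryFun, if_pos ⟨isCell_permFace _, hb⟩, Finset.sum_mul, Finset.sum_range]
  symm
  have hk : g.k - 1 + 1 = g.k := by
    have := g.one_le
    omega
  refine Finset.sum_of_injOn (fun a : Fin (g.k - 1) => permFace (g.merge h a.2).f) ?_ ?_ ?_ ?_
  · intro a _ a' _ haa
    have h1 := congrArg PermCell.nat (PermCell.permFace_injective haa)
    rw [PermCell.nat_merge, PermCell.nat_merge] at h1
    have hg := g.isSur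
    rw [← hk] at hg
    exact Fin.ext (hg.mergeNat_injOn a.2 a'.2 h1)
  · intro a _
    simp only [cells, Finset.coe_filter, Set.Finite.mem_toFinset, Set.mem_ofPred_eq]
    exact ⟨isCell_permFace _, (g.orient_outward a.2 h hb).1⟩
  -- A cell with a nonzero coefficient has exactly one block fewer than `g`, and containing the face
  -- of `g` makes it a merge of `g`.
  · intro F hF hF'
    by_contra hne
    obtain ⟨f, rfl, -, -⟩ := chainFun_ne_zero hne
    refine hF' ?_
    simp only [Finset.mem_filter] at hF
    have h1 := permFace_subset_iff.1 hF.2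
    have hg := g.isSur
    have hfk : g.k = f.k + 1 := by
      have := g.k_add
      have := f.k_add
      omega
    rw [hfk] at hg
    obtain ⟨a, ha, hfa⟩ := f.isSur.exists_mergeNat hg h1
    refine ⟨⟨a, by omega⟩, by simp, ?_⟩
    have h2 : g.merge h (a := a) (by omega) = f := PermCell.nat_injective hfa.symm
    change permFace (g.merge h (a := a) _).f = _
    rw [h2]
  · intro a _
    obtain ⟨-, h1, h2⟩ := g.orient_outward a.2 h hb
    rw [chainFun_permFace _ h1, h2, PermCell.nat_merge, SignType.coe_mul, SignType.coe_pow,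
      SignType.coe_neg_one]
    ring

theorem image_permFace {k : ℕ} (f : Fin m → Fin k) (s : Equiv.Perm (Fin m)) :
    (fun y : Fin m → ℝ => y ∘ s) '' permFace f = permFace (f ∘ s) := by
  have h := (LinearMap.funLeft ℝ ℝ s).image_convexHull (permVertices f)
  change (fun y : Fin m → ℝ => y ∘ s) '' permFace f = _ at h
  rw [h, permFace]
  congr 1
  ext x
  constructor
  · rintro ⟨y, ⟨w, hw, hy⟩, rfl⟩
    exact ⟨s.trans w, fun a b hab => hw _ _ hab, fun a => hy _⟩
  · rintro ⟨w, hw, hx⟩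
    refine ⟨x ∘ s.symm, ⟨s.symm.trans w, fun a b hab => hw _ _ ?_, fun a => hx _⟩, ?_⟩
    · simpa using hab
    · funext a
      exact congrArg x (s.symm_apply_apply a)

theorem comp_mem_blockKernel {k : ℕ} {f : Fin m → Fin k} {v : Fin m → ℝ} (s : Equiv.Perm (Fin m)) :
    v ∘ s ∈ blockKernel (f ∘ s) ↔ v ∈ blockKernel f :=
  forall_congr' fun j => by
    rw [← Equiv.sum_comp s (fun a => if f a = j then v a else 0)]
    rfl

theorem PermCell.det_stack_act (c : PermCell m 0 (-(d : ℤ))) (s : Equiv.Perm (Fin m))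
    (b : Fin d → Fin m → ℝ) :
    (stack (c.act s.symm).k_add (blockIndicator (c.act s.symm).f) (fun j => b j ∘ s)).det =
      ((Equiv.Perm.sign s : ℤˣ) : ℤ) * (stack c.k_add (blockIndicator c.f) b).det :=
  det_stack_comp c.k_add (blockIndicator c.f) b s

theorem PermCell.isFrame_act (c : PermCell m 0 (-(d : ℤ))) (s : Equiv.Perm (Fin m))
    (b : Fin d → Fin m → ℝ) :
    IsFrame (permFace (c.act s.symm).f) (fun j => b j ∘ s) ↔ IsFrame (permFace c.f) b := by
  rw [(c.act s.symm).isFrame_iff, c.isFrame_iff, det_stack_act]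
  refine and_congr (forall_congr' fun i => comp_mem_blockKernel s) ?_
  rw [mul_ne_zero_iff, and_iff_right]
  exact_mod_cast (Equiv.Perm.sign s).ne_zero

theorem PermCell.orient_act (c : PermCell m 0 (-(d : ℤ))) (s : Equiv.Perm (Fin m))
    (b : Fin d → Fin m → ℝ) : ((c.act s.symm).orient (fun j => b j ∘ s) : K) =
      ((Equiv.Perm.sign s : ℤˣ) : ℤ) * (c.orient b : K) := by
  rw [orient, det_stack_act, sign_mul, SignType.coe_mul, orient]
  congr 1
  rcases Int.units_eq_one_or (Equiv.Perm.sign s) with h | h <;> simp [h]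

/-- The signature in `coords_out` is the one by which permuting the coordinates changes the
determinant of a frame. -/
theorem chainFun_out (s : Equiv.Perm (Fin m)) (x : (W K).X m 0 (-(d : ℤ)))
    (F : Set (Fin m → ℝ)) (b : Fin d → Fin m → ℝ) :
    chainFun ((W K).out m 0 _ s x) F b =
      chainFun x ((fun y => y ∘ s) '' F) (fun j => b j ∘ s) := by
  by_cases hF : ∃ c : PermCell m 0 (-(d : ℤ)), F = permFace c.f
  · obtain ⟨c, rfl⟩ := hF
    have h1 : (fun y : Fin m → ℝ => y ∘ s) '' permFace c.f = permFace (c.act s.symm).f :=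
      image_permFace c.f s
    rw [h1]
    by_cases hb : IsFrame (permFace c.f) b
    · rw [chainFun_permFace _ hb, chainFun_permFace _ ((c.isFrame_act s b).2 hb),
        PermCell.orient_act, coords_out, PermCell.nat_act, Equiv.symm_symm]
      ring
    · have h2 : chainFun ((W K).out m 0 _ s x) (permFace c.f) b = 0 := by
        by_contra h
        obtain ⟨-, -, h, -⟩ := chainFun_ne_zero h
        exact hb h
      rw [h2]
      by_contra h
      obtain ⟨-, -, h, -⟩ := chainFun_ne_zero (Ne.symm h)
      exact hb ((c.isFrame_act s b).1 h)
  · have h2 : chainFun ((W K).out m 0 _ s x) F b = 0 := by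
      by_contra h
      obtain ⟨c, h, -⟩ := chainFun_ne_zero h
      exact hF ⟨c, h⟩
    rw [h2]
    by_contra h
    obtain ⟨c, h, -⟩ := chainFun_ne_zero (Ne.symm h)
    refine hF ⟨c.act s, ?_⟩
    have h3 := image_permFace c.f s.symm
    rw [← h, Set.image_image] at h3
    refine Eq.trans ?_ h3
    have h4 : ∀ y : Fin m → ℝ, (y ∘ s) ∘ s.symm = y := fun y => by
      funext a
      exact congrArg y (s.apply_symm_apply a)
    simp only [h4, Set.image_id']

end Comparison

/-! ## The canonical isomorphism -/

section Canonical

open Matrix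

variable {K : Type u} [Field K] {m d : ℕ} {P : DGProperad K} {ι : Hom (W K) P.mod}

/-- The isomorphism of a properad which is free on `W` with the cellular chains. -/
noncomputable def chainsEquiv (hι : ∀ m n i, Function.Bijective (ι.f m n i)) (m d : ℕ) :
    P.mod.X (m + 1) 0 (-(d : ℤ)) ≃ₗ[K] cellChains K (m + 1) d :=
  (LinearEquiv.ofBijective (ι.f (m + 1) 0 (-(d : ℤ))) (hι _ _ _)).symm.trans
    (LinearEquiv.ofBijective (toChains K (m + 1) d) (toChains_bijective (by omega)))

theorem chainsEquiv_apply (hι : ∀ m n i, Function.Bijective (ι.f m n i))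
    (x : (W K).X (m + 1) 0 (-(d : ℤ))) :
    chainsEquiv hι m d (ι.f _ _ _ x) = toChains K (m + 1) d x := by
  have h : (LinearEquiv.ofBijective (ι.f (m + 1) 0 (-(d : ℤ))) (hι _ _ _)).symm (ι.f _ _ _ x) = x :=
    LinearEquiv.symm_apply_apply
      (LinearEquiv.ofBijective (ι.f (m + 1) 0 (-(d : ℤ))) (hι _ _ _)) x
  rw [chainsEquiv, LinearEquiv.trans_apply, h]
  rfl

theorem permFace_topCell (m : ℕ) : permFace (topCell m).f = permutahedron (m + 1) := by
  unfold permFace permutahedron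
  congr 1
  ext x
  constructor
  · rintro ⟨w, -, hx⟩
    exact ⟨w, hx⟩
  · rintro ⟨w, hx⟩
    exact ⟨w, fun a b hab => absurd hab (lt_irrefl (0 : Fin 1)), hx⟩

/-- Each of the `m + 1` elements contributes `2` to the exponent and there are no inversions, so the
normalization of the top cell holds without a correction. -/
theorem theta_topCell (m : ℕ) : (topCell m).theta K = 1 := by
  have h : orientExponent (topCell m).k (topCell m).nat = (m + 1) * 2 := by
    have h1 : (topCell m).nat = fun _ => 0 := rfl
    have h2 : (topCell m).k = 1 := rfl
    simp [orientExponent, inversions, h1, h2]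
  rw [PermCell.theta, h, pow_mul']
  simp

theorem stack_one (h : 1 + m = m + 1) (r : Fin 1 → Fin (m + 1) → ℝ)
    (b : Fin m → Fin (m + 1) → ℝ) :
    stack h r b = Matrix.of (Fin.cons (r 0) b : Fin (m + 1) → Fin (m + 1) → ℝ) := by
  refine Matrix.ext fun i x => ?_
  obtain ⟨i, rfl⟩ := (stackEquiv h).surjective i
  rcases i with i | i
  · have hi : stackEquiv h (Sum.inl i) = 0 := by
      ext
      simp [stackEquiv]
    rw [stack_inl, hi, Subsingleton.elim i 0]
    rfl
  · have hi : stackEquiv h (Sum.inr i) = i.succ := by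
      ext
      simp [stackEquiv]
    rw [stack_inr, hi]
    rfl

theorem stack_topCell (b : Fin m → Fin (m + 1) → ℝ) :
    stack (topCell m).k_add (blockIndicator (topCell m).f) b =
      Matrix.of (Fin.cons (fun _ => 1) b : Fin (m + 1) → Fin (m + 1) → ℝ) := by
  have h : blockIndicator (topCell m).f (0 : Fin 1) = fun _ => 1 := funext fun x => if_pos rfl
  rw [← h]
  exact stack_one _ _ b

theorem isCanonical_chainsEquiv (hι : ∀ m n i, Function.Bijective (ι.f m n i))
    (hd : P.HasPermDifferential ι) (m : ℕ) : IsCanonical P ι m (chainsEquiv hι m) where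
  boundary d x := by
    obtain ⟨x, rfl⟩ := (hι _ _ _).2 x
    rw [hd.d_eq, chainsEquiv_apply, chainsEquiv_apply]
    exact cellBoundary_toChains (by omega) _ x
  equivariant d s x F b := by
    obtain ⟨x, rfl⟩ := (hι _ _ _).2 x
    rw [← ι.map_out, chainsEquiv_apply, chainsEquiv_apply]
    exact chainFun_out s x F b
  cell d c F b h := by
    rw [chainsEquiv_apply] at h
    obtain ⟨c', rfl, -, h1⟩ := chainFun_ne_zero h
    rw [coords_corollaW] at h1
    rw [PermCell.nat_injective (of_not_not fun h2 => h1 (if_neg h2))]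
  orientation d c b hb := by
    rw [chainsEquiv_apply, toChains_val, chainFun_permFace _ hb, coords_corollaW, if_pos rfl]
    refine mul_self_eq_one_iff.1 ?_
    rw [mul_mul_mul_comm, c.theta_mul_self, c.orient_mul_self hb, one_mul]
  top b hb hpos := by
    rw [← permFace_topCell] at hb ⊢
    rw [chainsEquiv_apply, toChains_val, chainFun_permFace _ hb, coords_corollaW, if_pos rfl,
      theta_topCell, PermCell.orient, stack_topCell, sign_pos hpos]
    simp

/-- Reversing the first vector repairs a negative orientation; for `m = 0` there is no such vector,
but the determinant is `1`. -/
theorem isFrame_exists_det_pos {b : Fin m → Fin (m + 1) → ℝ}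
    (hb : IsFrame (permutahedron (m + 1)) b) : ∃ b' : Fin m → Fin (m + 1) → ℝ,
      IsFrame (permutahedron (m + 1)) b' ∧
      0 < (Matrix.of (Fin.cons (fun _ => 1) b' : Fin (m + 1) → Fin (m + 1) → ℝ)).det := by
  have h0 : (Matrix.of (Fin.cons (fun _ => 1) b : Fin (m + 1) → Fin (m + 1) → ℝ)).det ≠ 0 := by
    rw [← permFace_topCell, PermCell.isFrame_iff] at hb
    rw [← stack_topCell]
    exact hb.2
  rcases lt_or_gt_of_ne h0 with h | h
  swap
  · exact ⟨b, hb, h⟩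
  rcases m with _ | m
  · simp at h
    exact absurd h (by norm_num)
  · have hA : (Matrix.diagonal (Function.update 1 0 (-1) : Fin (m + 1) → ℝ)).det = -1 := by
      rw [det_diagonal, Finset.prod_update_of_mem (Finset.mem_univ _)]
      simp
    refine ⟨changeFrame (Matrix.diagonal (Function.update 1 0 (-1))) b, ?_, ?_⟩
    · rwa [isFrame_changeFrame]
      rw [hA]
      norm_num
    · rw [← stack_topCell, det_stack_changeFrame, hA, stack_topCell]
      linarith

/-- Two chains supported at the same cell agree if they agree for one orientation. -/
theorem cellChains_eq_of_frame {F : Set (Fin m → ℝ)} {u v : cellChains K m d}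
    (hu : ∀ G b, u.1 G b ≠ 0 → G = F) (hv : ∀ G b, v.1 G b ≠ 0 → G = F)
    {b : Fin d → Fin m → ℝ} (hb : IsFrame F b) (h : u.1 F b = v.1 F b) : u = v := by
  ext G b'
  by_cases hG : G = F ∧ IsFrame F b'
  · obtain ⟨rfl, hb'⟩ := hG
    obtain ⟨A, hA, rfl⟩ := hb.exists_changeFrame hb'
    rw [u.2.2 _ _ A hA, v.2.2 _ _ A hA, h]
  · have key : ∀ w : cellChains K m d, (∀ G b, w.1 G b ≠ 0 → G = F) → w.1 G b' = 0 := by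
      intro w hw
      by_contra h2
      have h3 := hw G b' h2
      exact hG ⟨h3, h3 ▸ (w.2.1 G b' h2).2⟩
    rw [key u hu, key v hv]

/-! ### Uniqueness of the canonical isomorphism -/

variable {φ φ' : ∀ d : ℕ, P.mod.X (m + 1) 0 (-(d : ℤ)) ≃ₗ[K] cellChains K (m + 1) d}

/-- Each corolla is carried to its own cell, so only the corolla `g` contributes at the face of `g`;
its coefficient in `x` is `theta` times the coordinate. -/
theorem IsCanonical.coeff_eq (h : IsCanonical P ι m φ) (x : (W K).X (m + 1) 0 (-(d : ℤ)))
    (g : PermCell (m + 1) 0 (-(d : ℤ))) (b : Fin d → Fin (m + 1) → ℝ) :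
    (φ d (ι.f _ _ _ x)).1 (permFace g.f) b =
      g.theta K * coords x g.nat * (φ d (ι.f _ _ _ (corollaW K g))).1 (permFace g.f) b := by
  induction x using corollaW_induction with
  | h0 => simp
  | hadd x y hx hy =>
    simp only [map_add, Submodule.coe_add, Pi.add_apply, hx, hy]
    ring
  | hc r c =>
    simp only [map_smul, Submodule.coe_smul, Pi.smul_apply, smul_eq_mul, coords_corollaW]
    by_cases hc : c = g
    · subst hc
      rw [if_pos rfl]
      linear_combination -(r * (φ d (ι.f _ _ _ (corollaW K c))).1 (permFace c.f) b) *
        c.theta_mul_self (K := K)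
    · rw [if_neg fun h1 => hc (PermCell.nat_injective h1).symm]
      have h2 : (φ d (ι.f _ _ _ (corollaW K c))).1 (permFace g.f) b = 0 := by
        by_contra h3
        exact hc (PermCell.permFace_injective (h.cell d c _ _ h3)).symm
      rw [h2]
      ring

/-- Induction on the number of blocks. The top cell is normalized, and every other cell is a facet
of one with fewer blocks, in whose boundary it has a nonzero coefficient; compatibility with the
boundary then transfers the orientation. -/
theorem IsCanonical.corolla_eq (hd : P.HasPermDifferential ι) (h : IsCanonical P ι m φ)
    (h' : IsCanonical P ι m φ') (l : ℕ) : ∀ (d : ℕ) (g : PermCell (m + 1) 0 (-(d : ℤ))),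
      g.k = l + 1 → φ d (ι.f _ _ _ (corollaW K g)) = φ' d (ι.f _ _ _ (corollaW K g)) := by
  induction l with
  | zero =>
    intro d g hg
    have hdm := g.k_add
    obtain rfl : d = m := by omega
    obtain rfl : g = topCell d := by
      refine PermCell.nat_injective (funext fun x => ?_)
      have h1 := (g.f x).2
      have h2 : (topCell d).nat x = 0 := rfl
      rw [h2]
      change (g.f x : ℕ) = 0
      omega
    obtain ⟨b, hb⟩ := (topCell d).exists_isFrame
    have hb1 := hb
    rw [permFace_topCell] at hb1
    obtain ⟨b', hb', hpos⟩ := isFrame_exists_det_pos hb1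
    have hb2 := hb'
    rw [← permFace_topCell] at hb2
    refine cellChains_eq_of_frame (h.cell d _) (h'.cell d _) hb2 ?_
    rw [permFace_topCell, h.top b' hb' hpos, h'.top b' hb' hpos]
  | succ l ih =>
    intro d g hg
    obtain ⟨b, hb⟩ := g.exists_isFrame
    refine cellChains_eq_of_frame (h.cell d g) (h'.cell d g) hb ?_
    have hdeg : -((d + 1 : ℕ) : ℤ) + 1 = -(d : ℤ) := by push_cast; ring
    -- There are at least two blocks, so the first two can be merged to obtain a cell of which `g`
    -- is a facet.
    have h0 : 0 < g.k - 1 := by omega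
    have hf : (g.merge hdeg h0).k = l + 1 := by
      have h1 := (g.merge hdeg h0).k_add
      have h2 := g.k_add
      omega
    have key := congrArg (fun u => (cellBoundary K (m + 1) d u).1 (permFace g.f) b)
      (ih (d + 1) (g.merge hdeg h0) hf)
    rw [h.boundary, h'.boundary, hd.d_eq, h.coeff_eq, h'.coeff_eq] at key
    refine mul_left_cancel₀ (mul_ne_zero g.theta_ne_zero ?_) key
    rw [coords_permDiff, Finset.sum_eq_single 0]
    · rw [coords_corollaW, if_pos (g.nat_merge hdeg h0).symm]
      exact mul_ne_zero (pow_ne_zero _ (by simp)) (PermCell.theta_ne_zero _)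
    · intro a ha hne
      rw [coords_corollaW, if_neg, mul_zero]
      rw [PermCell.nat_merge]
      intro h1
      have hsur := g.isSur
      rw [hg] at hsur
      refine hne (hsur.mergeNat_injOn ?_ ?_ h1)
      · have := Finset.mem_range.1 ha
        change a < l + 1
        omega
      · exact Nat.succ_pos l
    · intro h1
      exact absurd (Finset.mem_range.2 h0) h1

theorem IsCanonical.unique (hι : ∀ m n i, Function.Bijective (ι.f m n i))
    (hd : P.HasPermDifferential ι) (h : IsCanonical P ι m φ) (h' : IsCanonical P ι m φ') :
    φ = φ' := by
  funext d
  ext1 x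
  obtain ⟨x, rfl⟩ := (hι _ _ _).2 x
  induction x using corollaW_induction with
  | h0 => simp
  | hadd x y hx hy => simp only [map_add, hx, hy]
  | hc r c =>
    have h1 := c.one_le
    rw [map_smul, map_smul, map_smul, h.corolla_eq hd h' (c.k - 1) d c (by omega)]

end Canonical

end PermProp

theorem proposition3p2p1 (K : Type*) [Field K] [CharZero K] :
    -- The dg free properad generated by `W` with the stated differential exists,
    (∃ (P : PermProp.DGProperad K) (ι : PermProp.Hom (PermProp.W K) P.mod),
      P.str.IsFree ι ∧ P.HasPermDifferential ι) ∧
    -- and every such properad has the following properties.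
    ∀ (P : PermProp.DGProperad K) (ι : PermProp.Hom (PermProp.W K) P.mod),
      P.str.IsFree ι → P.HasPermDifferential ι →
      -- (i) It is canonically isomorphic to the complex of oriented cells of the permutahedra.
      ((∀ m : ℕ, ∃! φ : ∀ d : ℕ,
          P.mod.X (m + 1) 0 (-(d : ℤ)) ≃ₗ[K] PermProp.cellChains K (m + 1) d,
            PermProp.IsCanonical P ι m φ) ∧
        ∀ m n i, (m = 0 ∨ n ≠ 0 ∨ 0 < i) → Subsingleton (P.mod.X m n i)) ∧
      -- (ii) Its cohomology is concentrated in degree zero, and the induced properad structure on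
      -- the cohomology is free on the symmetric corollas given by the sums of all vertices.
      ((∀ m n i, i ≠ 0 → Subsingleton ((PermProp.cohomology P.diff).X m n i)) ∧
        ∃ T : PermProp.ProperadStr (PermProp.cohomology P.diff), P.IsInduced T ∧
          ∃ j : PermProp.Hom (PermProp.SymCorollas K) (PermProp.cohomology P.diff), T.IsFree j ∧
            ∀ (m : ℕ) (hm : 1 ≤ m),
              ∃ h : ι.f m 0 0 (PermProp.vertexSum K m hm) ∈ PermProp.cocycles P.diff m 0 0,
                j.f m 0 0 (PermProp.symCorolla K m hm) =
                  PermProp.cohomClass P.diff (ι.f m 0 0 (PermProp.vertexSum K m hm)) h) := by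
  refine ⟨PermProp.exists_permProperad, fun P ι hfree hd => ?_⟩
  -- Freeness enters only here, as bijectivity of the embedding of the generators.
  have hι := (PermProp.ProperadStr.isFree_iff PermProp.W_noInputs _ _).1 hfree
  refine ⟨⟨fun m => ⟨PermProp.chainsEquiv hι m, PermProp.isCanonical_chainsEquiv hι hd m,
    fun φ hφ => hφ.unique hι hd (PermProp.isCanonical_chainsEquiv hι hd m)⟩,
    fun m n i h => PermProp.subsingleton_of_bijective hι h⟩,
    fun m n i hi => PermProp.cohomology_subsingleton hι hd m n i hi,
    PermProp.exists_induced_free hι hd⟩
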